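/- **Setting.** Let $P$ be a reversible Markov chain on a finite state space $X$: a row-stochastic matrix which is ergodic (some power has only positive entries) and which satisfies $\pi_xP_{xy}=\pi_yP_{yx}$ for its stationary distribution $\pi$. Let $M\subseteq X$ be a set of marked vertices. The hitting time $HT(P,M)\in[0,\infty]$ is the expectation of the smallest $n\ge 0$ with $Y_n\in M$ ($\infty$ if there is none), where $(Y_n)_{n\ge 0}$ evolves according to $P$ from $Y_0\sim\pi$. A quantum algorithm works on two vertex registers with state space $\mathbb C^X$, each initialized to a fixed reference unit vector $|\bar 0\rangle$, and on a finite-dimensional memory of its own that contains a qubit $R_3$. It is a finite sequence of operations, followed by a measurement of the second vertex register in the vertex basis, whose outcome is the output. The possible operations are: * $\mathtt{Setup}(P)$ on the second vertex register, a unitary with $|\bar 0\rangle\mapsto\sum_{x}\sqrt{\pi_x}\,|x\rangle$, or its inverse, at cost $\mathsf S$; * $\mathtt{Update}(P)$ on the two vertex registers, at cost $\mathsf U$: one of the following, controlled by the memory: $\mathrm{Shift}\colon|x,y\rangle\mapsto|y,x\rangle$; $\mathrm{Ref}=(2|\bar 0\rangle\langle\bar 0|-I)\otimes I$; a unitary $V$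 with $V|\bar 0\rangle|x\rangle=\sum_y\sqrt{P_{xy}}\,|y,x\rangle$ for all $x$; or $V^{-1}$; * $\mathtt{Check}(M)$, at cost $\mathsf C$: flip the qubit $R_3$ if the vertex in the second vertex register is in $M$; * any unitary on the algorithm's own memory, at no cost. The complexity of an algorithm is the sum of the costs of its operations. $P$, $\pi$, $M$ are accessible to the algorithm only through the black boxes. **Theorem 1.** There is a constant $c>0$ such that for every real number $T\ge 3$ there is a quantum algorithm of the above kind, with complexity at most $$c\left(\mathsf S\sqrt{\log T}+\sqrt{T}\,(\mathsf U+\mathsf C)\sqrt{\log T\cdot\log\log T}\right)\quad\text{for all costs } \mathsf S,\mathsf U,\mathsf C\ge 0,$$ which has the following property. For every reversible Markov chain $P$ on a finite state space $X$ and every marked set $M\subseteq X$ with $HT(P,M)\le T$ (that is, $T$ is a known upper bound on the hitting time), and for all unitaries $\mathtt{Setup}(P)$ and $V$ as above, the algorithm outputs a vertex of $M$ with probability at least $2/3$. -/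

import Mathlib

open scoped ENNReal Kronecker
open MeasureTheory ProbabilityTheory

noncomputable section

/-! ### Finite Markov chains and hitting times -/

section MarkovChain

variable {X : Type*} [Fintype X] [DecidableEq X]

/-- A probability vector on a finite set, as a `PMF`. -/
def pmfOfSimplex (p : stdSimplex ℝ X) : PMF X :=
  PMF.ofFintype (fun x => ENNReal.ofReal (p.1 x)) (by
    rw [← ENNReal.ofReal_sum_of_nonneg fun x _ => p.2.1 x, p.2.2, ENNReal.ofReal_one])

/-- The row of a row-stochastic matrix that belongs to the state `x`: the law of the next state of
the walk when the present state is `x`. -/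
def transitionRow (P : Matrix.rowStochastic ℝ X) (x : X) : stdSimplex ℝ X :=
  ⟨fun y => P.1 x y, fun y => P.2.1 x y, Matrix.sum_row_of_mem_rowStochastic P.2 x⟩

/-- The transition kernel of the time-independent Markov chain with transition matrix `P`, as a
kernel from histories `(y₀, …, yₙ)` to the next state: it depends on `yₙ` only. -/
def historyKernel [MeasurableSpace X] [DiscreteMeasurableSpace X]
    (P : Matrix.rowStochastic ℝ X) (n : ℕ) : Kernel ((i : Finset.Iic n) → X) X where
  toFun h := (pmfOfSimplex (transitionRow P (h ⟨n, Finset.mem_Iic.2 le_rfl⟩))).toMeasure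
  measurable' :=
    (measurable_of_countable fun x : X => (pmfOfSimplex (transitionRow P x)).toMeasure).comp
      (measurable_pi_apply _)

instance [MeasurableSpace X] [DiscreteMeasurableSpace X] (P : Matrix.rowStochastic ℝ X) (n : ℕ) :
    IsMarkovKernel (historyKernel P n) :=
  ⟨fun _ => PMF.toMeasure.isProbabilityMeasure _⟩

/-- The law, on sequences `y : ℕ → X`, of the Markov chain `(Y₀, Y₁, …)` evolving according to `P`
from `Y₀ ∼ ρ`. -/
def chainLaw [MeasurableSpace X] [DiscreteMeasurableSpace X]
    (P : Matrix.rowStochastic ℝ X) (ρ : stdSimplex ℝ X) : Measure (ℕ → X) :=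
  Kernel.trajMeasure (X := fun _ => X) (pmfOfSimplex ρ).toMeasure (historyKernel P)

/-- The hitting time of `M`: the expectation of the smallest `n` with `Yₙ ∈ M` (`∞` if there is no
such `n`), where `Y` evolves according to `P` from `Y₀ ∼ π`. -/
def hittingTime (P : Matrix.rowStochastic ℝ X) (π : stdSimplex ℝ X) (M : Finset X) : ℝ≥0∞ :=
  letI : MeasurableSpace X := ⊤
  ∫⁻ y, (⨅ n : ℕ, ⨅ _ : y n ∈ M, (n : ℝ≥0∞)) ∂(chainLaw P π)

/-- `P` is a reversible (in particular ergodic) chain, and `π` is its stationary distribution. -/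
structure IsReversibleChain (P : Matrix.rowStochastic ℝ X) (π : stdSimplex ℝ X) : Prop where
  ergodic : P.1.IsPrimitive
  stationary : Matrix.vecMul π.1 P.1 = π.1
  detailed_balance : ∀ x y, π.1 x * P.1 x y = π.1 y * P.1 y x

end MarkovChain

/-! ### The black boxes -/

/-- An implementation of the black boxes `Update(P)` and `Setup(P)` on vertex registers with state
space `ℂ^X`, with respect to a fixed reference state. Nothing is prescribed about the unitaries
beyond their action on the reference state. -/
structure WalkImplementation {X : Type*} [Fintype X] [DecidableEq X]
    (P : Matrix.rowStochastic ℝ X) (π : stdSimplex ℝ X) where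
  /-- the reference state `|0̄⟩`, a unit vector -/
  ref : X → ℂ
  ref_unit : ∑ x, ‖ref x‖ ^ 2 = 1
  /-- the unitary `V(P)` -/
  V : Matrix.unitaryGroup (X × X) ℂ
  /-- `V(P) |0̄⟩|x⟩ = ∑ y, √(P x y) |y, x⟩` -/
  V_apply : ∀ x : X,
    V.1.mulVec (fun p => if p.2 = x then ref p.1 else 0) =
      fun p => if p.2 = x then ((√(P.1 x p.1) : ℝ) : ℂ) else 0
  /-- the unitary that prepares the stationary superposition -/
  setup : Matrix.unitaryGroup X ℂ
  /-- `Setup(P) |0̄⟩ = ∑ x, √(π x) |x⟩` -/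
  setup_apply : setup.1.mulVec ref = fun x => ((√(π.1 x) : ℝ) : ℂ)

/-! ### Quantum algorithms that use the black boxes -/

/-- The computational basis of the algorithm's own memory: the qubit `R₃` on which `Check` acts,
and a workspace of dimension `K + 1`. -/
abbrev Memory (K : ℕ) : Type := Bool × Fin (K + 1)

/-- The computational basis of the whole machine: own memory, first and second vertex register. -/
abbrev Config (K : ℕ) (X : Type*) : Type _ := Memory K × (X × X)

/-- The elementary operations of a quantum algorithm. The operations on the vertex registers are
the black boxes only. A parameter `c` is the set of memory basis states on which a controlled
operation is applied. -/
inductive Gate (K : ℕ) : Type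
  /-- an arbitrary unitary on the algorithm's own memory -/
  | memory (W : Matrix.unitaryGroup (Memory K) ℂ)
  /-- `Setup(P)` on the second vertex register -/
  | setup
  /-- the inverse of `Setup(P)` -/
  | setupInv
  /-- controlled `Shift` -/
  | shift (c : Finset (Memory K))
  /-- controlled `Ref` -/
  | reflect (c : Finset (Memory K))
  /-- controlled `V(P)` -/
  | walk (c : Finset (Memory K))
  /-- controlled inverse of `V(P)` -/
  | walkInv (c : Finset (Memory K))
  /-- `Check(M)` on the second vertex register and the qubit `R₃` -/
  | check

/-- A quantum algorithm with memory of dimension `2 (K + 1)`: a finite sequence of operations,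
followed by a measurement of the second vertex register, whose outcome is the output. -/
abbrev QuantumAlgorithm (K : ℕ) : Type := List (Gate K)

/-- The cost of an operation, where `S`, `U`, `C` are the costs of `Setup`, `Update`, `Check`. -/
def Gate.cost {K : ℕ} (S U C : ℝ) : Gate K → ℝ
  | .memory _ => 0
  | .setup => S
  | .setupInv => S
  | .shift _ => U
  | .reflect _ => U
  | .walk _ => U
  | .walkInv _ => U
  | .check => C

/-- The complexity of an algorithm: the sum of the costs of its operations. -/
def QuantumAlgorithm.cost {K : ℕ} (A : QuantumAlgorithm K) (S U C : ℝ) : ℝ :=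
  (A.map (Gate.cost S U C)).sum

section Semantics

variable {X : Type*} [Fintype X] [DecidableEq X] {K : ℕ}

/-- `Shift |x, y⟩ = |y, x⟩`. -/
def shiftMatrix (X : Type*) [DecidableEq X] : Matrix (X × X) (X × X) ℂ :=
  Matrix.of fun p q => if p = q.swap then 1 else 0

/-- `Ref = (2 |0̄⟩⟨0̄| - I) ⊗ I`. -/
def refMatrix (r : X → ℂ) : Matrix (X × X) (X × X) ℂ :=
  ((2 : ℂ) • Matrix.vecMulVec r (star r) - 1) ⊗ₖ (1 : Matrix X X ℂ)

/-- The operation `A` on the vertex registers, controlled on the memory being in a basis state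
that belongs to `c`. -/
def controlled (c : Finset (Memory K)) (A : Matrix (X × X) (X × X) ℂ) :
    Matrix (Config K X) (Config K X) ℂ :=
  Matrix.of fun p q =>
    if p.1 = q.1 then (if q.1 ∈ c then A p.2 q.2 else (1 : Matrix (X × X) (X × X) ℂ) p.2 q.2)
    else 0

/-- `Check(M)`: flips the qubit `R₃` if the second vertex register holds a vertex of `M`. -/
def checkMatrix (K : ℕ) (M : Finset X) : Matrix (Config K X) (Config K X) ℂ :=
  Matrix.of fun p q =>
    if p = ((if q.2.2 ∈ M then !q.1.1 else q.1.1, q.1.2), q.2) then 1 else 0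

variable {P : Matrix.rowStochastic ℝ X} {π : stdSimplex ℝ X}

/-- The action of an operation on the machine's state space. -/
def Gate.toMatrix (O : WalkImplementation P π) (M : Finset X) :
    Gate K → Matrix (Config K X) (Config K X) ℂ
  | .memory W => W.1 ⊗ₖ (1 : Matrix (X × X) (X × X) ℂ)
  | .setup => (1 : Matrix (Memory K) (Memory K) ℂ) ⊗ₖ ((1 : Matrix X X ℂ) ⊗ₖ O.setup.1)
  | .setupInv =>
      (1 : Matrix (Memory K) (Memory K) ℂ) ⊗ₖ ((1 : Matrix X X ℂ) ⊗ₖ O.setup.1.conjTranspose)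
  | .shift c => controlled c (shiftMatrix X)
  | .reflect c => controlled c (refMatrix O.ref)
  | .walk c => controlled c O.V.1
  | .walkInv c => controlled c O.V.1.conjTranspose
  | .check => checkMatrix K M

/-- The initial state `|0⟩ |0̄⟩ |0̄⟩`. -/
def initialState (K : ℕ) (O : WalkImplementation P π) : Config K X → ℂ :=
  fun p => if p.1 = (false, 0) then O.ref p.2.1 * O.ref p.2.2 else 0

/-- The state in which the algorithm ends. -/
def QuantumAlgorithm.finalState (A : QuantumAlgorithm K) (O : WalkImplementation P π)
    (M : Finset X) : Config K X → ℂ :=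
  A.foldl (fun ψ g => (g.toMatrix O M).mulVec ψ) (initialState K O)

/-- The probability that the final measurement yields the vertex `x`. -/
def QuantumAlgorithm.outputProb (A : QuantumAlgorithm K) (O : WalkImplementation P π)
    (M : Finset X) (x : X) : ℝ :=
  ∑ m : Memory K, ∑ y : X, ‖A.finalState O M (m, (y, x))‖ ^ 2

end Semantics

end

/-! Slow the chain down at marked vertices by a factor `ρ`, let `D` be the discriminant of the
slowed chain, and look at the marked entries of `D ^ t √π`. As `D` is diagonally similar to the
slowed chain and has nonnegative entries, the square of the entry at `x ∈ M` is at least `ρ π(x)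
u²`, where `u` is the probability that the slowed chain from `x` is unmarked at time `t`
(`le_discriminant_pow_mulVec_sq`).

No single `ρ` has to make this large, but the powers of two do so jointly. Let `r_ρ` be the
probability of being unmarked at an independent geometric time with mean of order `T`. Reversibility
gives Green's identity `∑_{Mᶜ} π (r_ρ - r_ρ') = (ρ' - ρ) ∑_M π r_ρ r_ρ'`
(`sum_unmarkedResolvent_sub`), which telescopes along `ρ = 2 ^ j`. If `π(M)` is small, then `∑_{Mᶜ}
π r_ρ` is large at `ρ = 1`, by stationarity. At `ρ = 2 ^ J` of order `T` it is small, because the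
chain probably hits `M` before the geometric time and is then held there. So the contributions of
the `J + 1 = O(log T)` slowdowns add up to a constant (`le_sum_unmarkedProb_sq`). If `π(M)` is
large, the slowest chain alone suffices (`one_tenth_le_sum_discriminant`).

The times `t` are cut off at `n = O(T)`, and `D ^ t` is fast-forwarded: it is the average of the
Chebyshev polynomials `T_k(D)` with `k = |W_t|` for a simple random walk `W`
(`pow_mulVec_eq_walkMean`). Up to probability `O(1 / log T)`, `k` is at most `τ = O(√(T log log
T))`. By Jensen's inequality, the marked weight of `D ^ t √π` is at most the average of the marked
weights of `T_k(D) √π`, so it is enough to choose `k` and `j` at random; no linear combination of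
unitaries has to be postselected. The compression of `k` steps of a quantum walk to its initial
subspace is `T_k(D)` (`coinProject_iterate`). A superposition of such walks is therefore marked with
probability at least `1 / (20 (J + 1))` (`le_sum_stepWeight`).

Amplitude amplification runs in rounds of `1, 2, 4, …` iterations, and every round moves the marked
part to a fresh label. The amplitude that is never found is a product of cosines, equal to `sin (2 ^
(m + 1) θ) / (2 ^ (m + 1) sin θ)` for every angle `θ`, so the success probability need not be known
(`searchCircuit_success`). It suffices that `4 ^ (m + 1)` is of order `log T`, that is, `O(√(log
T))` uses of the walks. -/

noncomputable section

set_option linter.unusedSectionVars false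

/-! ### Resolvents of the slowed chains and Green's identity -/

section Resolvent

variable {X : Type*} [Fintype X] [DecidableEq X]

/-- The chain that at a marked vertex follows `P` only with probability `1/ρ`, and stays put
otherwise. -/
def slowed (P : Matrix X X ℝ) (M : Finset X) (ρ : ℝ) : Matrix X X ℝ := fun x y =>
  if x ∈ M then ρ⁻¹ * P x y + (1 - ρ⁻¹) * (if x = y then 1 else 0) else P x y

/-- The indicator function of the unmarked vertices. -/
def unmarked (M : Finset X) : X → ℝ := fun x => if x ∈ M then 0 else 1

/-- The probability that the slowed chain started at `x` is unmarked at time `t`. -/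
def unmarkedProb (P : Matrix X X ℝ) (M : Finset X) (ρ : ℝ) (t : ℕ) : X → ℝ :=
  (slowed P M ρ ^ t).mulVec (unmarked M)

/-- The transitions of `P` between unmarked vertices. -/
def killed (P : Matrix X X ℝ) (M : Finset X) : Matrix X X ℝ := fun x y =>
  if x ∉ M ∧ y ∉ M then P x y else 0

/-- The probability that the slowed chain started at `x` is unmarked at an independent geometric
time with parameter `1 - l`. -/
def unmarkedResolvent (P : Matrix X X ℝ) (M : Finset X) (l ρ : ℝ) (x : X) : ℝ :=
  (1 - l) * ∑' t, l ^ t * unmarkedProb P M ρ t x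

/-- The resolvent `unmarkedResolvent`, truncated to times below `n`. -/
def truncResolvent (P : Matrix X X ℝ) (M : Finset X) (l ρ : ℝ) (n : ℕ) (x : X) : ℝ :=
  (1 - l) * ∑ t ∈ Finset.range n, l ^ t * unmarkedProb P M ρ t x

variable {P : Matrix X X ℝ} {M : Finset X} {l ρ : ℝ}

lemma slowed_one : slowed P M 1 = P := by
  ext x y; simp [slowed]

lemma slowed_mulVec_of_mem {x : X} (hx : x ∈ M) (f : X → ℝ) :
    (slowed P M ρ).mulVec f x = ρ⁻¹ * P.mulVec f x + (1 - ρ⁻¹) * f x := by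
  simp [slowed, Matrix.mulVec, dotProduct, hx, add_mul, Finset.sum_add_distrib, Finset.mul_sum,
    mul_assoc]

lemma slowed_mulVec_of_notMem {x : X} (hx : x ∉ M) (f : X → ℝ) :
    (slowed P M ρ).mulVec f x = P.mulVec f x := by
  simp [slowed, Matrix.mulVec, dotProduct, hx]

lemma slowed_nonneg (hP : ∀ x y, 0 ≤ P x y) (hρ : 1 ≤ ρ) (x y : X) : 0 ≤ slowed P M ρ x y := by
  have h1 : 0 ≤ ρ⁻¹ := by positivity
  have h2 : ρ⁻¹ ≤ 1 := inv_le_one_of_one_le₀ hρ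
  have := hP x y
  unfold slowed
  split_ifs <;> nlinarith [mul_nonneg h1 this]

lemma mulVec_mono (hP : ∀ x y, 0 ≤ P x y) {f g : X → ℝ} (h : ∀ x, f x ≤ g x) (x : X) :
    P.mulVec f x ≤ P.mulVec g x :=
  Finset.sum_le_sum fun y _ => mul_le_mul_of_nonneg_left (h y) (hP x y)

lemma mulVec_const (hs : ∀ x, ∑ y, P x y = 1) (c : ℝ) (x : X) : P.mulVec (fun _ => c) x = c := by
  simp [Matrix.mulVec, dotProduct, ← Finset.sum_mul, hs]

lemma unmarkedProb_succ (t : ℕ) :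
    unmarkedProb P M ρ (t + 1) = (slowed P M ρ).mulVec (unmarkedProb P M ρ t) := by
  simp [unmarkedProb, pow_succ', Matrix.mulVec_mulVec]

lemma unmarkedProb_zero : unmarkedProb P M ρ 0 = unmarked M := by
  simp [unmarkedProb]

lemma unmarkedProb_nonneg (hP : ∀ x y, 0 ≤ P x y) (hρ : 1 ≤ ρ) (t : ℕ) (x : X) :
    0 ≤ unmarkedProb P M ρ t x := by
  induction t generalizing x with
  | zero => rw [unmarkedProb_zero, unmarked]; split_ifs <;> norm_num
  | succ t ih =>
    rw [unmarkedProb_succ]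
    exact Finset.sum_nonneg fun y _ => mul_nonneg (slowed_nonneg hP hρ x y) (ih y)

lemma unmarkedProb_le_one (hP : ∀ x y, 0 ≤ P x y) (hs : ∀ x, ∑ y, P x y = 1) (hρ : 1 ≤ ρ)
    (t : ℕ) (x : X) : unmarkedProb P M ρ t x ≤ 1 := by
  induction t generalizing x with
  | zero => rw [unmarkedProb_zero, unmarked]; split_ifs <;> norm_num
  | succ t ih =>
    rw [unmarkedProb_succ]
    refine (mulVec_mono (slowed_nonneg hP hρ) ih x).trans ?_
    by_cases hx : x ∈ M
    · rw [slowed_mulVec_of_mem hx, mulVec_const hs]; linarith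
    · rw [slowed_mulVec_of_notMem hx, mulVec_const hs]

lemma summable_pow_mul (h0 : 0 ≤ l) (h1 : l < 1) {f : ℕ → ℝ} (hf0 : ∀ t, 0 ≤ f t)
    (hf1 : ∀ t, f t ≤ 1) : Summable fun t => l ^ t * f t :=
  Summable.of_nonneg_of_le (fun t => mul_nonneg (pow_nonneg h0 t) (hf0 t))
    (fun t => mul_le_of_le_one_right (pow_nonneg h0 t) (hf1 t)) (summable_geometric_of_lt_one h0 h1)

section Stochastic

variable (hP : ∀ x y, 0 ≤ P x y) (hs : ∀ x, ∑ y, P x y = 1)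
include hP hs

lemma summable_unmarkedProb (h0 : 0 ≤ l) (h1 : l < 1) (hρ : 1 ≤ ρ) (x : X) :
    Summable fun t => l ^ t * unmarkedProb P M ρ t x :=
  summable_pow_mul h0 h1 (fun t => unmarkedProb_nonneg hP hρ t x)
    fun t => unmarkedProb_le_one hP hs hρ t x

lemma unmarkedResolvent_nonneg (h0 : 0 ≤ l) (h1 : l < 1) (hρ : 1 ≤ ρ) (x : X) :
    0 ≤ unmarkedResolvent P M l ρ x :=
  mul_nonneg (by linarith) (tsum_nonneg fun t =>
    mul_nonneg (pow_nonneg h0 t) (unmarkedProb_nonneg hP hρ t x))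

lemma unmarkedResolvent_le_one (h0 : 0 ≤ l) (h1 : l < 1) (hρ : 1 ≤ ρ) (x : X) :
    unmarkedResolvent P M l ρ x ≤ 1 := by
  have h : ∑' t, l ^ t * unmarkedProb P M ρ t x ≤ (1 - l)⁻¹ := by
    rw [← tsum_geometric_of_lt_one h0 h1]
    exact (summable_unmarkedProb hP hs h0 h1 hρ x).tsum_le_tsum (fun t =>
      mul_le_of_le_one_right (pow_nonneg h0 t) (unmarkedProb_le_one hP hs hρ t x))
      (summable_geometric_of_lt_one h0 h1)
  calc unmarkedResolvent P M l ρ x ≤ (1 - l) * (1 - l)⁻¹ :=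
        mul_le_mul_of_nonneg_left h (by linarith)
    _ = 1 := mul_inv_cancel₀ (by linarith)

lemma unmarkedResolvent_eq (h0 : 0 ≤ l) (h1 : l < 1) (hρ : 1 ≤ ρ) (x : X) :
    unmarkedResolvent P M l ρ x = (1 - l) * unmarked M x
      + l * (slowed P M ρ).mulVec (unmarkedResolvent P M l ρ) x := by
  have hsum := fun y => summable_unmarkedProb (M := M) hP hs h0 h1 hρ y
  have e : ∑' t, l ^ (t + 1) * unmarkedProb P M ρ (t + 1) x
      = l * ∑ y, slowed P M ρ x y * ∑' t, l ^ t * unmarkedProb P M ρ t y := by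
    simp_rw [← tsum_mul_left]
    rw [← Summable.tsum_finsetSum fun y _ => (hsum y).mul_left _, ← tsum_mul_left]
    refine tsum_congr fun t => ?_
    rw [unmarkedProb_succ, Matrix.mulVec, dotProduct, Finset.mul_sum, Finset.mul_sum]
    exact Finset.sum_congr rfl fun y _ => by ring
  have e2 : (slowed P M ρ).mulVec (unmarkedResolvent P M l ρ) x
      = (1 - l) * ∑ y, slowed P M ρ x y * ∑' t, l ^ t * unmarkedProb P M ρ t y := by
    simp only [Matrix.mulVec, dotProduct, unmarkedResolvent, Finset.mul_sum]
    exact Finset.sum_congr rfl fun y _ => by ring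
  rw [e2, unmarkedResolvent, (hsum x).tsum_eq_zero_add, e, unmarkedProb_zero]
  ring

/-- Multiplying the one-step equation by `ρ` leaves `P` itself on the right; the slowdown enters
only through the coefficient on the left. This makes different values of `ρ` comparable. -/
lemma unmarkedResolvent_of_mem (h0 : 0 ≤ l) (h1 : l < 1) (hρ : 1 ≤ ρ) {x : X} (hx : x ∈ M) :
    (l + (1 - l) * ρ) * unmarkedResolvent P M l ρ x
      = l * P.mulVec (unmarkedResolvent P M l ρ) x := by
  have h := unmarkedResolvent_eq (M := M) hP hs h0 h1 hρ x
  rw [slowed_mulVec_of_mem hx] at h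
  have hρ0 : ρ ≠ 0 := by positivity
  simp only [unmarked, hx, if_true] at h
  field_simp at h
  linear_combination h

lemma unmarkedResolvent_of_notMem (h0 : 0 ≤ l) (h1 : l < 1) (hρ : 1 ≤ ρ) {x : X} (hx : x ∉ M) :
    unmarkedResolvent P M l ρ x = (1 - l) + l * P.mulVec (unmarkedResolvent P M l ρ) x := by
  have h := unmarkedResolvent_eq (M := M) hP hs h0 h1 hρ x
  rw [slowed_mulVec_of_notMem hx] at h
  simpa [unmarked, hx] using h

variable {π : X → ℝ} (hπ : ∀ x, 0 ≤ π x) (hπ1 : ∑ x, π x = 1)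
  (hdb : ∀ x y, π x * P x y = π y * P y x)

omit hP hs in
include hdb in
lemma sum_mulVec_mul_symm (f g : X → ℝ) :
    ∑ x, π x * (P.mulVec f x * g x) = ∑ x, π x * (f x * P.mulVec g x) := by
  simp only [Matrix.mulVec, dotProduct, Finset.sum_mul, Finset.mul_sum]
  rw [Finset.sum_comm]
  refine Finset.sum_congr rfl fun x _ => Finset.sum_congr rfl fun y _ => ?_
  linear_combination (f x * g y) * hdb y x

include hdb in
/-- Green's identity for the resolvents of two slowed chains. -/
lemma sum_unmarkedResolvent_sub (h0 : 0 ≤ l) (h1 : l < 1) {ρ' : ℝ} (hρ : 1 ≤ ρ) (hρ' : 1 ≤ ρ') :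
    ∑ x ∈ Mᶜ, π x * (unmarkedResolvent P M l ρ x - unmarkedResolvent P M l ρ' x)
      = (ρ' - ρ) * ∑ x ∈ M, π x * (unmarkedResolvent P M l ρ x * unmarkedResolvent P M l ρ' x) := by
  set r := unmarkedResolvent P M l ρ with hr
  set r' := unmarkedResolvent P M l ρ' with hr'
  -- The form `∑ π (P r) r'` is symmetric. The resolvent equations eliminate `P r` and `P r'`: over
  -- `Mᶜ` only the source `1 - l` survives, over `M` only the difference of the coefficients.
  have h := sum_mulVec_mul_symm hdb r r'
  rw [← Finset.sum_add_sum_compl M, ← Finset.sum_add_sum_compl M (fun x => π x * (r x * _))] at h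
  have e1 : l * ∑ x ∈ M, π x * (P.mulVec r x * r' x)
      = (l + (1 - l) * ρ) * ∑ x ∈ M, π x * (r x * r' x) := by
    simp only [Finset.mul_sum]
    refine Finset.sum_congr rfl fun x hx => ?_
    linear_combination (-(π x * r' x)) * unmarkedResolvent_of_mem hP hs h0 h1 hρ hx
  have e2 : l * ∑ x ∈ M, π x * (r x * P.mulVec r' x)
      = (l + (1 - l) * ρ') * ∑ x ∈ M, π x * (r x * r' x) := by
    simp only [Finset.mul_sum]
    refine Finset.sum_congr rfl fun x hx => ?_
    linear_combination (-(π x * r x)) * unmarkedResolvent_of_mem hP hs h0 h1 hρ' hx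
  have e3 : l * ∑ x ∈ Mᶜ, π x * (P.mulVec r x * r' x)
      - l * ∑ x ∈ Mᶜ, π x * (r x * P.mulVec r' x)
      = (1 - l) * ∑ x ∈ Mᶜ, π x * (r x - r' x) := by
    simp only [Finset.mul_sum]
    rw [← Finset.sum_sub_distrib]
    refine Finset.sum_congr rfl fun x hx => ?_
    have hx := Finset.mem_compl.1 hx
    linear_combination (-(π x * r' x)) * unmarkedResolvent_of_notMem hP hs h0 h1 hρ hx
      + (π x * r x) * unmarkedResolvent_of_notMem hP hs h0 h1 hρ' hx
  have hl : 1 - l ≠ 0 := by linarith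
  apply mul_left_cancel₀ hl
  linear_combination -e3 + e2 - e1 + l * h

include hdb in
-- For `ρ = 2 ^ j` and `ρ' = 2 ^ (j + 1)` the factor `ρ' - ρ` in Green's identity is `2 ^ j`, and
-- the left sides telescope.
lemma sum_dyadic_unmarkedResolvent (h0 : 0 ≤ l) (h1 : l < 1) (J : ℕ) :
    ∑ j ∈ Finset.range J, (2 : ℝ) ^ j * ∑ x ∈ M, π x *
        (unmarkedResolvent P M l (2 ^ j) x * unmarkedResolvent P M l (2 ^ (j + 1)) x)
      = ∑ x ∈ Mᶜ, π x * (unmarkedResolvent P M l 1 x - unmarkedResolvent P M l (2 ^ J) x) := by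
  induction J with
  | zero => simp
  | succ J ih =>
    have h := sum_unmarkedResolvent_sub (M := M) hP hs hdb h0 h1
      (one_le_pow₀ (M₀ := ℝ) one_le_two (n := J))
      (one_le_pow₀ (M₀ := ℝ) one_le_two (n := J + 1))
    have e : (2 : ℝ) ^ (J + 1) - 2 ^ J = 2 ^ J := by ring
    rw [e] at h
    rw [Finset.sum_range_succ, ih, ← h, ← Finset.sum_add_distrib]
    exact Finset.sum_congr rfl fun x _ => by ring

include hπ hπ1 hdb in
-- For `ρ = 1` the chain is `P`, and `π` is stationary: averaged over all starting vertices the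
-- resolvent is exactly `π(Mᶜ)`, of which the starting vertices in `M` carry at most `π(M)`.
lemma le_sum_unmarkedResolvent_one (h0 : 0 ≤ l) (h1 : l < 1) :
    1 - 2 * ∑ x ∈ M, π x ≤ ∑ x ∈ Mᶜ, π x * unmarkedResolvent P M l 1 x := by
  have hP1 : P.mulVec (fun _ => 1) = fun _ => 1 := funext fun x => mulVec_const hs 1 x
  have key : ∑ x, π x * unmarkedResolvent P M l 1 x = ∑ x ∈ Mᶜ, π x := by
    have h := sum_mulVec_mul_symm hdb (unmarkedResolvent P M l 1) (fun _ => 1)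
    rw [hP1] at h
    simp only [mul_one] at h
    have e : ∀ x, unmarkedResolvent P M l 1 x
        = (1 - l) * unmarked M x + l * P.mulVec (unmarkedResolvent P M l 1) x := fun x => by
      simpa [slowed_one] using unmarkedResolvent_eq (M := M) hP hs h0 h1 le_rfl x
    have e2 : ∑ x, π x * unmarkedResolvent P M l 1 x = (1 - l) * ∑ x, π x * unmarked M x
        + l * ∑ x, π x * P.mulVec (unmarkedResolvent P M l 1) x := by
      rw [Finset.mul_sum, Finset.mul_sum, ← Finset.sum_add_distrib]
      exact Finset.sum_congr rfl fun x _ => by rw [e x]; ring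
    have e3 : ∑ x, π x * unmarked M x = ∑ x ∈ Mᶜ, π x := by
      rw [← Finset.sum_add_sum_compl M, Finset.sum_eq_zero, zero_add]
      · exact Finset.sum_congr rfl fun x hx => by simp [unmarked, Finset.mem_compl.1 hx]
      · intro x hx; simp [unmarked, hx]
    rw [h, e3] at e2
    have hl : 1 - l ≠ 0 := by linarith
    apply mul_left_cancel₀ hl
    linear_combination e2
  have hle : ∑ x ∈ M, π x * unmarkedResolvent P M l 1 x ≤ ∑ x ∈ M, π x :=
    Finset.sum_le_sum fun x _ => mul_le_of_le_one_right (hπ x)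
      (unmarkedResolvent_le_one hP hs h0 h1 le_rfl x)
  rw [← Finset.sum_add_sum_compl M] at key hπ1
  linarith

/-- Leaving a marked vertex takes at least about `ρ` steps, so a large `ρ` makes it unlikely to
escape before the geometric time. -/
lemma unmarkedResolvent_le_of_mem (h0 : 0 ≤ l) (h1 : l < 1) (hρ : 1 ≤ ρ) {x : X} (hx : x ∈ M) :
    unmarkedResolvent P M l ρ x ≤ ((1 - l) * ρ)⁻¹ := by
  have h := unmarkedResolvent_of_mem hP hs h0 h1 hρ hx
  have h2 : P.mulVec (unmarkedResolvent P M l ρ) x ≤ 1 :=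
    (mulVec_mono hP (unmarkedResolvent_le_one hP hs h0 h1 hρ) x).trans_eq (mulVec_const hs 1 x)
  have h3 := unmarkedResolvent_nonneg (M := M) hP hs h0 h1 hρ x
  have hpos : 0 < (1 - l) * ρ := mul_pos (by linarith) (by linarith)
  rw [← one_div, le_div_iff₀ hpos]
  nlinarith

/-- To be unmarked at the geometric time, the chain must have left `M` after hitting it, or not have
hit `M` by that time, or the time must exceed `n`. The three terms bound these cases, by induction
on `n` through the first step. -/
lemma unmarkedResolvent_le_killed (h0 : 0 ≤ l) (h1 : l < 1) (hρ : 1 ≤ ρ) (n : ℕ) {x : X}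
    (hx : x ∉ M) :
    unmarkedResolvent P M l ρ x ≤ ((1 - l) * ρ)⁻¹
      + (1 - l) * ∑ t ∈ Finset.range n, (killed P M ^ t).mulVec (unmarked M) x + l ^ n := by
  have hκ : 0 ≤ ((1 - l) * ρ)⁻¹ :=
    inv_nonneg.2 (mul_nonneg (by linarith) (by linarith))
  set κ := ((1 - l) * ρ)⁻¹
  induction n generalizing x with
  | zero => simpa using (unmarkedResolvent_le_one hP hs h0 h1 hρ x).trans (by linarith)
  | succ n ih =>
    have hk : ∀ t, (killed P M ^ (t + 1)).mulVec (unmarked M) x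
        = ∑ y ∈ Mᶜ, P x y * (killed P M ^ t).mulVec (unmarked M) y := fun t => by
      rw [pow_succ', ← Matrix.mulVec_mulVec]
      simp only [Matrix.mulVec, dotProduct, killed, hx, not_false_eq_true, true_and, ite_mul,
        zero_mul]
      rw [← Finset.sum_filter]
      congr 1; ext; simp
    rw [unmarkedResolvent_of_notMem hP hs h0 h1 hρ hx, Finset.sum_range_succ', pow_zero,
      Matrix.one_mulVec]
    simp only [hk]
    have hu : unmarked M x = 1 := by simp [unmarked, hx]
    have hkn : ∀ t y, 0 ≤ (killed P M ^ t).mulVec (unmarked M) y := by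
      intro t
      induction t with
      | zero => intro y; simp only [pow_zero, Matrix.one_mulVec, unmarked]; split_ifs <;> norm_num
      | succ t ih' =>
        intro y
        rw [pow_succ', ← Matrix.mulVec_mulVec]
        refine Finset.sum_nonneg fun z _ => mul_nonneg ?_ (ih' z)
        simp only [killed]; split_ifs
        exacts [hP _ _, le_rfl]
    set F := fun y => ∑ t ∈ Finset.range n, (killed P M ^ t).mulVec (unmarked M) y with hF
    have hFn : ∀ y, 0 ≤ F y := fun y => Finset.sum_nonneg fun t _ => hkn t y
    have e : ∑ t ∈ Finset.range n, ∑ y ∈ Mᶜ, P x y * (killed P M ^ t).mulVec (unmarked M) y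
        = ∑ y ∈ Mᶜ, P x y * F y := by
      rw [Finset.sum_comm]; simp [hF, Finset.mul_sum]
    rw [e, hu]
    have hb : P.mulVec (unmarkedResolvent P M l ρ) x
        ≤ κ + (1 - l) * ∑ y ∈ Mᶜ, P x y * F y + l ^ n := by
      have c1 : ∑ y ∈ M, P x y * unmarkedResolvent P M l ρ y ≤ ∑ y ∈ M, P x y * (κ + l ^ n) :=
        Finset.sum_le_sum fun y hy => mul_le_mul_of_nonneg_left
          ((unmarkedResolvent_le_of_mem hP hs h0 h1 hρ hy).trans
            (by have := pow_nonneg h0 n; linarith)) (hP x y)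
      have c2 : ∑ y ∈ Mᶜ, P x y * unmarkedResolvent P M l ρ y
          ≤ ∑ y ∈ Mᶜ, (P x y * (κ + l ^ n) + (1 - l) * (P x y * F y)) :=
        Finset.sum_le_sum fun y hy => by
          have := mul_le_mul_of_nonneg_left (ih (Finset.mem_compl.1 hy)) (hP x y)
          refine this.trans_eq ?_
          simp only [hF]; ring
      have c3 : ∑ y ∈ M, P x y * (κ + l ^ n) + ∑ y ∈ Mᶜ, P x y * (κ + l ^ n) = κ + l ^ n := by
        rw [Finset.sum_add_sum_compl, ← Finset.sum_mul, hs, one_mul]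
      rw [Finset.sum_add_distrib, ← Finset.mul_sum] at c2
      rw [Matrix.mulVec, dotProduct, ← Finset.sum_add_sum_compl M]
      linarith
    have hG : 0 ≤ ∑ y ∈ Mᶜ, P x y * F y :=
      Finset.sum_nonneg fun y _ => mul_nonneg (hP x y) (hFn y)
    have hb' := mul_le_mul_of_nonneg_left hb h0
    have hG' : 0 ≤ (1 - l) * ((1 - l) * ∑ y ∈ Mᶜ, P x y * F y) :=
      mul_nonneg (by linarith) (mul_nonneg (by linarith) hG)
    have : 0 ≤ (1 - l) * κ := mul_nonneg (by linarith) hκ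
    rw [pow_succ]
    nlinarith

include hπ hπ1 in
lemma sum_unmarkedResolvent_le (h0 : 0 ≤ l) (h1 : l < 1) (hρ : 1 ≤ ρ) {T : ℝ}
    (hT : ∀ n, ∑ t ∈ Finset.range n, ∑ x ∈ Mᶜ, π x * (killed P M ^ t).mulVec (unmarked M) x ≤ T) :
    ∑ x ∈ Mᶜ, π x * unmarkedResolvent P M l ρ x ≤ (1 - l) * T + ((1 - l) * ρ)⁻¹ := by
  have hκ : 0 ≤ ((1 - l) * ρ)⁻¹ :=
    inv_nonneg.2 (mul_nonneg (by linarith) (by linarith))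
  have key : ∀ n : ℕ, ∑ x ∈ Mᶜ, π x * unmarkedResolvent P M l ρ x
      ≤ (1 - l) * T + ((1 - l) * ρ)⁻¹ + l ^ n := fun n => by
    have hl := pow_nonneg h0 n
    have hU : ∑ x ∈ Mᶜ, π x ≤ 1 := by
      rw [← hπ1]; exact Finset.sum_le_sum_of_subset_of_nonneg (Finset.subset_univ _)
        fun x _ _ => hπ x
    calc _ ≤ ∑ x ∈ Mᶜ, (π x * (((1 - l) * ρ)⁻¹ + l ^ n) + (1 - l) *
          ∑ t ∈ Finset.range n, π x * (killed P M ^ t).mulVec (unmarked M) x) := by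
          refine Finset.sum_le_sum fun x hx => ?_
          refine (mul_le_mul_of_nonneg_left (unmarkedResolvent_le_killed hP hs h0 h1 hρ n
            (Finset.mem_compl.1 hx)) (hπ x)).trans_eq ?_
          rw [← Finset.mul_sum]; ring
      _ = (∑ x ∈ Mᶜ, π x) * (((1 - l) * ρ)⁻¹ + l ^ n) + (1 - l) * ∑ t ∈ Finset.range n,
          ∑ x ∈ Mᶜ, π x * (killed P M ^ t).mulVec (unmarked M) x := by
          rw [Finset.sum_add_distrib, ← Finset.sum_mul, ← Finset.mul_sum, Finset.sum_comm]
      _ ≤ 1 * (((1 - l) * ρ)⁻¹ + l ^ n) + (1 - l) * T :=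
          add_le_add (mul_le_mul_of_nonneg_right hU (by linarith))
            (mul_le_mul_of_nonneg_left (hT n) (by linarith))
      _ = _ := by ring
  -- The number `n` is free, so the remainder `l ^ n` is sent to `0`.
  refine ge_of_tendsto' (x := Filter.atTop) ?_ key
  simpa using (tendsto_pow_atTop_nhds_zero_of_lt_one h0 h1).const_add
    ((1 - l) * T + ((1 - l) * ρ)⁻¹)

lemma truncResolvent_nonneg (h0 : 0 ≤ l) (h1 : l < 1) (hρ : 1 ≤ ρ) (n : ℕ) (x : X) :
    0 ≤ truncResolvent P M l ρ n x :=
  mul_nonneg (by linarith) (Finset.sum_nonneg fun t _ =>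
    mul_nonneg (pow_nonneg h0 t) (unmarkedProb_nonneg hP hρ t x))

lemma unmarkedResolvent_sq_le (h0 : 0 ≤ l) (h1 : l < 1) (hρ : 1 ≤ ρ) (x : X) :
    unmarkedResolvent P M (l ^ 2) ρ x ≤ 2 * unmarkedResolvent P M l ρ x := by
  have h2 : l ^ 2 < 1 := pow_lt_one₀ h0 h1 two_ne_zero
  have h : ∑' t, (l ^ 2) ^ t * unmarkedProb P M ρ t x ≤ ∑' t, l ^ t * unmarkedProb P M ρ t x :=
    (summable_unmarkedProb hP hs (by positivity) h2 hρ x).tsum_le_tsum (fun t =>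
      mul_le_mul_of_nonneg_right (pow_le_pow_left₀ (by positivity) (by nlinarith) t)
        (unmarkedProb_nonneg hP hρ t x)) (summable_unmarkedProb hP hs h0 h1 hρ x)
  have h3 : 0 ≤ ∑' t, l ^ t * unmarkedProb P M ρ t x := tsum_nonneg fun t =>
    mul_nonneg (pow_nonneg h0 t) (unmarkedProb_nonneg hP hρ t x)
  unfold unmarkedResolvent
  calc _ ≤ (1 - l ^ 2) * ∑' t, l ^ t * unmarkedProb P M ρ t x :=
        mul_le_mul_of_nonneg_left h (by linarith)
    _ ≤ (2 * (1 - l)) * ∑' t, l ^ t * unmarkedProb P M ρ t x :=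
        mul_le_mul_of_nonneg_right (by nlinarith) h3
    _ = _ := by ring

/-- Half of the decay `(l ^ 2) ^ t` pays for the tail, the other half keeps a resolvent with
parameter `l`. The error is thus relative to a resolvent; an additive one would be multiplied by
weights up to `2 ^ J`. -/
lemma unmarkedResolvent_sub_trunc_le (h0 : 0 ≤ l) (h1 : l < 1) (hρ : 1 ≤ ρ) (n : ℕ) (x : X) :
    unmarkedResolvent P M (l ^ 2) ρ x - truncResolvent P M (l ^ 2) ρ n x
      ≤ 2 * l ^ n * unmarkedResolvent P M l ρ x := by
  have h2 : l ^ 2 < 1 := pow_lt_one₀ h0 h1 two_ne_zero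
  have hsum2 := summable_unmarkedProb (M := M) hP hs (by positivity) h2 hρ x
  have hsum := summable_unmarkedProb (M := M) hP hs h0 h1 hρ x
  have ha := fun t => unmarkedProb_nonneg (M := M) hP hρ t x
  have h : ∑' t, (l ^ 2) ^ (t + n) * unmarkedProb P M ρ (t + n) x
      ≤ l ^ n * ∑' t, l ^ (t + n) * unmarkedProb P M ρ (t + n) x := by
    rw [← tsum_mul_left]
    refine Summable.tsum_le_tsum (fun t => ?_) ((summable_nat_add_iff n).2 hsum2)
      (((summable_nat_add_iff n).2 hsum).mul_left _)
    rw [← mul_assoc]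
    refine mul_le_mul_of_nonneg_right ?_ (ha _)
    rw [← pow_mul, ← pow_add]
    exact pow_le_pow_of_le_one h0 h1.le (by omega)
  have h3 : ∑' t, l ^ (t + n) * unmarkedProb P M ρ (t + n) x
      ≤ ∑' t, l ^ t * unmarkedProb P M ρ t x := by
    rw [← hsum.sum_add_tsum_nat_add n]
    have : 0 ≤ ∑ t ∈ Finset.range n, l ^ t * unmarkedProb P M ρ t x :=
      Finset.sum_nonneg fun t _ => mul_nonneg (pow_nonneg h0 t) (ha t)
    linarith
  have h4 : 0 ≤ ∑' t, l ^ t * unmarkedProb P M ρ t x :=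
    tsum_nonneg fun t => mul_nonneg (pow_nonneg h0 t) (ha t)
  unfold unmarkedResolvent truncResolvent
  rw [← mul_sub, ← hsum2.sum_add_tsum_nat_add n, add_sub_cancel_left]
  have hn := pow_nonneg h0 n
  calc _ ≤ (1 - l ^ 2) * (l ^ n * ∑' t, l ^ t * unmarkedProb P M ρ t x) :=
        mul_le_mul_of_nonneg_left (h.trans (mul_le_mul_of_nonneg_left h3 hn)) (by linarith)
    _ ≤ (2 * (1 - l)) * (l ^ n * ∑' t, l ^ t * unmarkedProb P M ρ t x) :=
        mul_le_mul_of_nonneg_right (by nlinarith) (mul_nonneg hn h4)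
    _ = _ := by ring

lemma truncResolvent_le (h0 : 0 ≤ l) (h1 : l < 1) (hρ : 1 ≤ ρ) (n : ℕ) (x : X) :
    truncResolvent P M l ρ n x ≤ unmarkedResolvent P M l ρ x :=
  mul_le_mul_of_nonneg_left ((summable_unmarkedProb hP hs h0 h1 hρ x).sum_le_tsum _ fun t _ =>
    mul_nonneg (pow_nonneg h0 t) (unmarkedProb_nonneg hP hρ t x)) (by linarith)

lemma mul_sub_trunc_le (h0 : 0 ≤ l) (h1 : l < 1) {ρ' : ℝ} (hρ : 1 ≤ ρ) (hρ' : 1 ≤ ρ') (n : ℕ)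
    (x : X) :
    unmarkedResolvent P M (l ^ 2) ρ x * unmarkedResolvent P M (l ^ 2) ρ' x
      - 8 * l ^ n * (unmarkedResolvent P M l ρ x * unmarkedResolvent P M l ρ' x)
      ≤ truncResolvent P M (l ^ 2) ρ n x * truncResolvent P M (l ^ 2) ρ' n x := by
  have h2 : l ^ 2 < 1 := pow_lt_one₀ h0 h1 two_ne_zero
  have hn := pow_nonneg h0 n
  have a1 := unmarkedResolvent_sub_trunc_le (M := M) hP hs h0 h1 hρ n x
  have a2 := unmarkedResolvent_sub_trunc_le (M := M) hP hs h0 h1 hρ' n x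
  have b1 := unmarkedResolvent_sq_le (M := M) hP hs h0 h1 hρ x
  have b2 := unmarkedResolvent_sq_le (M := M) hP hs h0 h1 hρ' x
  have c1 := truncResolvent_nonneg (M := M) hP hs (sq_nonneg l) h2 hρ n x
  have c2 := truncResolvent_nonneg (M := M) hP hs (sq_nonneg l) h2 hρ' n x
  have d1 := truncResolvent_le (M := M) hP hs (sq_nonneg l) h2 hρ n x
  have d2 := truncResolvent_le (M := M) hP hs (sq_nonneg l) h2 hρ' n x
  have e1 := unmarkedResolvent_nonneg (M := M) hP hs h0 h1 hρ x
  have e2 := unmarkedResolvent_nonneg (M := M) hP hs h0 h1 hρ' x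
  have m1 := mul_le_mul a1 b2 (c2.trans d2) (mul_nonneg (by linarith) e1)
  have m2 := mul_le_mul (d1.trans b1) a2 (by linarith) (by linarith)
  linarith

include hπ hπ1 hdb in
/-- The main lower bound: on average over the dyadic slowdowns and over the time, the chains
started at marked vertices are unmarked often enough. -/
theorem le_sum_unmarkedProb_sq (h0 : 0 ≤ l) (h1 : l < 1) {T : ℝ}
    (hT : ∀ n, ∑ t ∈ Finset.range n, ∑ x ∈ Mᶜ, π x * (killed P M ^ t).mulVec (unmarked M) x ≤ T)
    (n J : ℕ) :
    1 - 2 * ∑ x ∈ M, π x - (1 - l ^ 2) * T - ((1 - l ^ 2) * 2 ^ J)⁻¹ - 8 * l ^ n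
      ≤ ∑ j ∈ Finset.range (J + 1), (1 - l ^ 2) * ∑ t ∈ Finset.range n, (l ^ 2) ^ t *
          (2 ^ j * ∑ x ∈ M, π x * unmarkedProb P M (2 ^ j) t x ^ 2) := by
  have h2 : l ^ 2 < 1 := pow_lt_one₀ h0 h1 two_ne_zero
  have hl2 : 0 ≤ l ^ 2 := sq_nonneg l
  have hn := pow_nonneg h0 n
  have p1 : ∀ j : ℕ, (1 : ℝ) ≤ 2 ^ j := fun j => one_le_pow₀ one_le_two
  set R := fun (l : ℝ) (j : ℕ) x => unmarkedResolvent P M l (2 ^ j) x with hR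
  set S := fun (j : ℕ) x => truncResolvent P M (l ^ 2) (2 ^ j) n x with hS
  have s1 : 1 - 2 * ∑ x ∈ M, π x - (1 - l ^ 2) * T - ((1 - l ^ 2) * 2 ^ J)⁻¹
      ≤ ∑ j ∈ Finset.range J, (2 : ℝ) ^ j * ∑ x ∈ M, π x * (R (l ^ 2) j x * R (l ^ 2) (j + 1) x) := by
    have a := sum_dyadic_unmarkedResolvent (M := M) hP hs hdb hl2 h2 J
    have b := le_sum_unmarkedResolvent_one (M := M) hP hs hπ hπ1 hdb hl2 h2
    have c := sum_unmarkedResolvent_le (M := M) hP hs hπ hπ1 hl2 h2 (p1 J) hT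
    simp only [mul_sub, Finset.sum_sub_distrib] at a
    simp only [hR]
    linarith
  -- The same dyadic sum for `l` instead of `l ^ 2` also telescopes and is at most `1`; hence
  -- truncation costs at most `8 * l ^ n`, independently of `J`.
  have s2 : ∑ j ∈ Finset.range J, (2 : ℝ) ^ j * ∑ x ∈ M, π x * (R l j x * R l (j + 1) x) ≤ 1 := by
    simp only [hR]
    rw [sum_dyadic_unmarkedResolvent (M := M) hP hs hdb h0 h1 J]
    have hsplit := Finset.sum_add_sum_compl M π
    have : 0 ≤ ∑ x ∈ M, π x := Finset.sum_nonneg fun x _ => hπ x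
    have : ∑ x ∈ Mᶜ, π x * (unmarkedResolvent P M l 1 x - unmarkedResolvent P M l (2 ^ J) x)
        ≤ ∑ x ∈ Mᶜ, π x := Finset.sum_le_sum fun x _ => mul_le_of_le_one_right (hπ x) <| by
      have := unmarkedResolvent_le_one (M := M) hP hs h0 h1 le_rfl x
      have := unmarkedResolvent_nonneg (M := M) hP hs h0 h1 (p1 J) x
      linarith
    linarith
  have s3 : ∑ j ∈ Finset.range J, (2 : ℝ) ^ j * ∑ x ∈ M, π x * (R (l ^ 2) j x * R (l ^ 2) (j + 1) x)
      - 8 * l ^ n * ∑ j ∈ Finset.range J, (2 : ℝ) ^ j * ∑ x ∈ M, π x * (R l j x * R l (j + 1) x)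
      ≤ ∑ j ∈ Finset.range J, (2 : ℝ) ^ j * ∑ x ∈ M, π x * (S j x * S (j + 1) x) := by
    rw [Finset.mul_sum, ← Finset.sum_sub_distrib]
    refine Finset.sum_le_sum fun j _ => ?_
    rw [mul_left_comm, ← mul_sub, Finset.mul_sum, ← Finset.sum_sub_distrib]
    refine mul_le_mul_of_nonneg_left (Finset.sum_le_sum fun x _ => ?_) (by positivity)
    have := mul_le_mul_of_nonneg_left
      (mul_sub_trunc_le (M := M) hP hs h0 h1 (p1 j) (p1 (j + 1)) n x) (hπ x)
    refine le_trans (le_of_eq ?_) this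
    simp only [hR]; ring
  set N := fun j : ℕ => (2 : ℝ) ^ j * ∑ x ∈ M, π x * S j x ^ 2 with hN
  have hNn : ∀ j, 0 ≤ N j := fun j => mul_nonneg (by positivity)
    (Finset.sum_nonneg fun x _ => mul_nonneg (hπ x) (sq_nonneg _))
  -- AM-GM separates neighbouring slowdowns: each product contributes at most `(N j + N (j + 1)) /
  -- 2`.
  have s4 : ∑ j ∈ Finset.range J, (2 : ℝ) ^ j * ∑ x ∈ M, π x * (S j x * S (j + 1) x)
      ≤ ∑ j ∈ Finset.range (J + 1), N j := by
    have a : ∑ j ∈ Finset.range J, (2 : ℝ) ^ j * ∑ x ∈ M, π x * (S j x * S (j + 1) x)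
        ≤ ∑ j ∈ Finset.range J, (1 / 2 * N j + 1 / 2 * N (j + 1)) := by
      refine Finset.sum_le_sum fun j _ => ?_
      simp only [hN, Finset.mul_sum]
      rw [← Finset.sum_add_distrib]
      refine Finset.sum_le_sum fun x _ => ?_
      have h2j : 0 ≤ (2 : ℝ) ^ j * π x := mul_nonneg (by positivity) (hπ x)
      have q1 := mul_nonneg h2j (sq_nonneg (S j x - S (j + 1) x))
      have q2 := mul_nonneg h2j (sq_nonneg (S (j + 1) x))
      rw [pow_succ (2 : ℝ) j]
      linarith
    rw [Finset.sum_add_distrib, ← Finset.mul_sum, ← Finset.mul_sum] at a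
    have b := Finset.sum_range_succ N J
    have c := Finset.sum_range_succ' N J
    have := hNn 0
    have := hNn J
    linarith
  have s5 : ∀ j, N j ≤ (1 - l ^ 2) * ∑ t ∈ Finset.range n, (l ^ 2) ^ t *
          (2 ^ j * ∑ x ∈ M, π x * unmarkedProb P M (2 ^ j) t x ^ 2) := fun j => by
    -- Cauchy-Schwarz for the geometric weights, whose total mass is at most `1`.
    have hjen : ∀ x, S j x ^ 2 ≤
        (1 - l ^ 2) * ∑ t ∈ Finset.range n, (l ^ 2) ^ t * unmarkedProb P M (2 ^ j) t x ^ 2 := by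
      intro x
      have hg : (1 - l ^ 2) * ∑ t ∈ Finset.range n, (l ^ 2) ^ t ≤ 1 := by
        have := mul_neg_geom_sum (l ^ 2) n
        have := pow_nonneg hl2 n
        linarith
      have cs := Finset.sum_mul_sq_le_sq_mul_sq (Finset.range n) (fun t => l ^ t)
        (fun t => l ^ t * unmarkedProb P M (2 ^ j) t x)
      have i1 : ∑ t ∈ Finset.range n, l ^ t * (l ^ t * unmarkedProb P M (2 ^ j) t x)
          = ∑ t ∈ Finset.range n, (l ^ 2) ^ t * unmarkedProb P M (2 ^ j) t x :=
        Finset.sum_congr rfl fun t _ => by ring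
      have i2 : ∑ t ∈ Finset.range n, (l ^ t) ^ 2 = ∑ t ∈ Finset.range n, (l ^ 2) ^ t :=
        Finset.sum_congr rfl fun t _ => by ring
      have i3 : ∑ t ∈ Finset.range n, (l ^ t * unmarkedProb P M (2 ^ j) t x) ^ 2
          = ∑ t ∈ Finset.range n, (l ^ 2) ^ t * unmarkedProb P M (2 ^ j) t x ^ 2 :=
        Finset.sum_congr rfl fun t _ => by ring
      rw [i1, i2, i3] at cs
      have hpos : 0 ≤ ∑ t ∈ Finset.range n, (l ^ 2) ^ t * unmarkedProb P M (2 ^ j) t x ^ 2 :=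
        Finset.sum_nonneg fun t _ => by positivity
      simp only [hS, truncResolvent]
      rw [mul_pow]
      have hd : 0 ≤ 1 - l ^ 2 := by linarith
      calc _ ≤ (1 - l ^ 2) ^ 2 * _ := mul_le_mul_of_nonneg_left cs (sq_nonneg _)
        _ = ((1 - l ^ 2) * ∑ t ∈ Finset.range n, (l ^ 2) ^ t) * ((1 - l ^ 2) *
            ∑ t ∈ Finset.range n, (l ^ 2) ^ t * unmarkedProb P M (2 ^ j) t x ^ 2) := by ring
        _ ≤ 1 * _ := mul_le_mul_of_nonneg_right hg (mul_nonneg hd hpos)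
        _ = _ := one_mul _
    calc N j ≤ 2 ^ j * ∑ x ∈ M, π x * ((1 - l ^ 2) * ∑ t ∈ Finset.range n, (l ^ 2) ^ t *
          unmarkedProb P M (2 ^ j) t x ^ 2) :=
          mul_le_mul_of_nonneg_left (Finset.sum_le_sum fun x _ =>
            mul_le_mul_of_nonneg_left (hjen x) (hπ x)) (by positivity)
      _ = _ := by
          simp only [Finset.mul_sum]
          rw [Finset.sum_comm]
          exact Finset.sum_congr rfl fun t _ => Finset.sum_congr rfl fun x _ => by ring
  have s6 := s4.trans (Finset.sum_le_sum fun j _ => s5 j)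
  have s7 : 8 * l ^ n * ∑ j ∈ Finset.range J, (2 : ℝ) ^ j * ∑ x ∈ M, π x * (R l j x * R l (j + 1) x)
      ≤ 8 * l ^ n := mul_le_of_le_one_right (by positivity) s2
  linarith

end Stochastic

end Resolvent

/-! ### The hitting time as a bound for sums of survival probabilities -/

section HittingTime

variable {X : Type*} [Fintype X] [DecidableEq X]

lemma lintegral_pmfOfSimplex [MeasurableSpace X] [DiscreteMeasurableSpace X]
    (p : stdSimplex ℝ X) {h : X → ℝ} (hh : ∀ x, 0 ≤ h x) :
    ∫⁻ x, ENNReal.ofReal (h x) ∂(pmfOfSimplex p).toMeasure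
      = ENNReal.ofReal (∑ x, p.1 x * h x) := by
  rw [lintegral_fintype, ENNReal.ofReal_sum_of_nonneg fun x _ => mul_nonneg (p.2.1 x) (hh x)]
  refine Finset.sum_congr rfl fun x _ => ?_
  rw [PMF.toMeasure_apply_singleton _ _ (measurableSet_singleton x), mul_comm,
    ENNReal.ofReal_mul (p.2.1 x)]
  rfl

/-- The trajectories that avoid `M` up to time `t`. -/
def avoiding (M : Finset X) (t : ℕ) : Set (ℕ → X) := {y | ∀ i ≤ t, y i ∉ M}

variable [MeasurableSpace X] [DiscreteMeasurableSpace X]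

lemma map_eval_zero_chainLaw (P : Matrix.rowStochastic ℝ X) (π : stdSimplex ℝ X) :
    (chainLaw P π).map (fun y => y 0) = (pmfOfSimplex π).toMeasure := by
  have e : (fun y : ℕ → X => y 0) = (MeasurableEquiv.piUnique fun _ : Finset.Iic 0 => X) ∘
      (Preorder.frestrictLe (π := fun _ => X) 0) := rfl
  have hp : IsProbabilityMeasure (pmfOfSimplex π).toMeasure :=
    PMF.toMeasure.isProbabilityMeasure _
  rw [e, ← Measure.map_map (by fun_prop) (by fun_prop), chainLaw, Kernel.trajMeasure,
    Measure.map_comp _ _ (by fun_prop), Kernel.traj_map_frestrictLe, Kernel.partialTraj_self,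
    Measure.id_comp, Measure.map_map (by fun_prop) (by fun_prop)]
  convert Measure.map_id
  ext x
  simp

lemma mem_avoiding_iff {M : Finset X} {t : ℕ} {y : ℕ → X} :
    y ∈ avoiding M t ↔ ∀ i, Preorder.frestrictLe (π := fun _ => X) t y i ∉ M := by
  simp [avoiding]

/-- The Markov property. The factor `G` is an arbitrary function of the history so that it can be
the indicator of avoiding `M`. -/
lemma lintegral_chainLaw_succ (P : Matrix.rowStochastic ℝ X) (π : stdSimplex ℝ X) (t : ℕ)
    (G : ((i : Finset.Iic t) → X) → ℝ≥0∞) {h : X → ℝ} (hh : ∀ x, 0 ≤ h x) :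
    ∫⁻ y, G (Preorder.frestrictLe t y) * ENNReal.ofReal (h (y (t + 1))) ∂(chainLaw P π)
      = ∫⁻ y, G (Preorder.frestrictLe t y) * ENNReal.ofReal (P.1.mulVec h (y t))
          ∂(chainLaw P π) := by
  have hp : IsProbabilityMeasure (pmfOfSimplex π).toMeasure :=
    PMF.toMeasure.isProbabilityMeasure _
  have key := Kernel.map_frestrictLe_trajMeasure_compProd_eq_map_trajMeasure
    (X := fun _ => X) (μ₀ := (pmfOfSimplex π).toMeasure) (κ := historyKernel P) (a := t)
  have : IsProbabilityMeasure (chainLaw P π) := by unfold chainLaw; infer_instance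
  have : IsProbabilityMeasure ((chainLaw P π).map (Preorder.frestrictLe (π := fun _ => X) t)) :=
    Measure.isProbabilityMeasure_map (by fun_prop)
  calc _ = ∫⁻ p, G p.1 * ENNReal.ofReal (h p.2)
        ∂((chainLaw P π).map fun y => (Preorder.frestrictLe (π := fun _ => X) t y, y (t + 1))) := by
        rw [lintegral_map (measurable_of_countable _) (by fun_prop)]
    _ = ∫⁻ p, G p.1 * ENNReal.ofReal (h p.2) ∂((chainLaw P π).map
          (Preorder.frestrictLe (π := fun _ => X) t) ⊗ₘ historyKernel P t) := by
        rw [chainLaw, key]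
    _ = ∫⁻ g, ∫⁻ z, G g * ENNReal.ofReal (h z) ∂(historyKernel P t g)
          ∂((chainLaw P π).map (Preorder.frestrictLe (π := fun _ => X) t)) := by
        rw [Measure.lintegral_compProd (measurable_of_countable _)]
    _ = ∫⁻ y, ∫⁻ z, G (Preorder.frestrictLe t y) * ENNReal.ofReal (h z)
          ∂(historyKernel P t (Preorder.frestrictLe t y)) ∂(chainLaw P π) := by
        rw [lintegral_map (measurable_of_countable _) (by fun_prop)]
    _ = _ := by
        refine lintegral_congr fun y => ?_
        rw [lintegral_const_mul _ (measurable_of_countable _)]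
        congr 1
        exact lintegral_pmfOfSimplex (transitionRow P (y t)) hh

lemma killed_mulVec (P : Matrix X X ℝ) (M : Finset X) (h : X → ℝ) {x : X} (hx : x ∉ M) :
    (killed P M).mulVec h x = P.mulVec (fun y => unmarked M y * h y) x := by
  simp only [Matrix.mulVec, dotProduct, killed, unmarked, hx, not_false_eq_true, true_and]
  exact Finset.sum_congr rfl fun y _ => by by_cases hy : y ∈ M <;> simp [hy]

lemma killed_nonneg {P : Matrix X X ℝ} (hP : ∀ x y, 0 ≤ P x y) (M : Finset X) (x y : X) :
    0 ≤ killed P M x y := by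
  unfold killed; split_ifs
  exacts [hP x y, le_rfl]

lemma unmarked_nonneg (M : Finset X) (x : X) : 0 ≤ unmarked M x := by
  unfold unmarked; split_ifs <;> norm_num

open Classical in
-- Integrating out the last step turns `h` into `killed P M` applied to `h`; the induction therefore
-- needs all `h`, although only `unmarked M` is used later.
lemma lintegral_avoiding (P : Matrix.rowStochastic ℝ X) (π : stdSimplex ℝ X) (M : Finset X)
    (t : ℕ) {h : X → ℝ} (hh : ∀ x, 0 ≤ h x) :
    ∫⁻ y, (if y ∈ avoiding M t then 1 else 0) * ENNReal.ofReal (h (y t)) ∂(chainLaw P π)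
      = ENNReal.ofReal (∑ x ∈ Mᶜ, π.1 x * (killed P.1 M ^ t).mulVec h x) := by
  induction t generalizing h with
  | zero =>
    have hu : ∀ x, 0 ≤ unmarked M x * h x := fun x => mul_nonneg (unmarked_nonneg M x) (hh x)
    have e : ∀ y : ℕ → X, (if y ∈ avoiding M 0 then 1 else 0) * ENNReal.ofReal (h (y 0))
        = ENNReal.ofReal (unmarked M (y 0) * h (y 0)) := fun y => by
      by_cases hy : y 0 ∈ M <;> simp [avoiding, unmarked, hy]
    simp_rw [e]
    rw [← lintegral_map (f := fun x => ENNReal.ofReal (unmarked M x * h x)) (g := fun y : ℕ → X => y 0)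
      (measurable_of_countable _) (by fun_prop), map_eval_zero_chainLaw, lintegral_pmfOfSimplex _ hu]
    congr 1
    rw [← Finset.sum_add_sum_compl M, Finset.sum_eq_zero, zero_add]
    · exact Finset.sum_congr rfl fun x hx => by simp [unmarked, Finset.mem_compl.1 hx]
    · intro x hx; simp [unmarked, hx]
  | succ t ih =>
    have hu : ∀ x, 0 ≤ unmarked M x * h x := fun x => mul_nonneg (unmarked_nonneg M x) (hh x)
    have e : ∀ y : ℕ → X, (if y ∈ avoiding M (t + 1) then 1 else 0)
          * ENNReal.ofReal (h (y (t + 1)))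
        = (if ∀ i, Preorder.frestrictLe (π := fun _ => X) t y i ∉ M then 1 else 0)
          * ENNReal.ofReal (unmarked M (y (t + 1)) * h (y (t + 1))) := fun y => by
      have : y ∈ avoiding M (t + 1) ↔ y ∈ avoiding M t ∧ y (t + 1) ∉ M := by
        simp only [avoiding, Set.mem_ofPred_eq, Nat.le_succ_iff]
        grind
      simp only [← mem_avoiding_iff]
      by_cases h1 : y ∈ avoiding M t <;> by_cases h2 : y (t + 1) ∈ M <;>
        simp [this, h1, h2, unmarked]
    simp_rw [e]
    rw [lintegral_chainLaw_succ P π t (fun g => if ∀ i, g i ∉ M then 1 else 0) hu]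
    have e2 : ∀ y : ℕ → X, (if ∀ i, Preorder.frestrictLe (π := fun _ => X) t y i ∉ M
          then (1 : ℝ≥0∞) else 0)
          * ENNReal.ofReal (P.1.mulVec (fun y => unmarked M y * h y) (y t))
        = (if y ∈ avoiding M t then 1 else 0)
          * ENNReal.ofReal ((killed P.1 M).mulVec h (y t)) := fun y => by
      simp only [← mem_avoiding_iff]
      by_cases h1 : y ∈ avoiding M t
      · simp [h1, killed_mulVec _ _ _ (h1 t le_rfl)]
      · simp [h1]
    simp_rw [e2]
    have hk : ∀ x, 0 ≤ (killed P.1 M).mulVec h x := fun x =>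
      Finset.sum_nonneg fun y _ => mul_nonneg (killed_nonneg P.2.1 M x y) (hh y)
    rw [ih hk]
    simp [pow_succ, Matrix.mulVec_mulVec]

omit [MeasurableSpace X] [DiscreteMeasurableSpace X] in
/-- The probabilities that the chain avoids `M` up to time `t` add up to at most the hitting
time. -/
theorem sum_survival_le (P : Matrix.rowStochastic ℝ X) (π : stdSimplex ℝ X) (M : Finset X)
    {T : ℝ} (hT : 0 ≤ T) (h : hittingTime P π M ≤ ENNReal.ofReal T) (n : ℕ) :
    ∑ t ∈ Finset.range n, ∑ x ∈ Mᶜ, π.1 x * (killed P.1 M ^ t).mulVec (unmarked M) x ≤ T := by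
  classical
  let _ : MeasurableSpace X := ⊤
  have hk : ∀ t x, 0 ≤ (killed P.1 M ^ t).mulVec (unmarked M) x := by
    intro t
    induction t with
    | zero => simpa using unmarked_nonneg M
    | succ t ih =>
      intro x
      rw [pow_succ', ← Matrix.mulVec_mulVec]
      exact Finset.sum_nonneg fun z _ => mul_nonneg (killed_nonneg P.2.1 M x z) (ih z)
  have hn : ∀ t, 0 ≤ ∑ x ∈ Mᶜ, π.1 x * (killed P.1 M ^ t).mulVec (unmarked M) x := fun t =>
    Finset.sum_nonneg fun x _ => mul_nonneg (π.2.1 x) (hk t x)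
  rw [← ENNReal.ofReal_le_ofReal_iff hT, ENNReal.ofReal_sum_of_nonneg fun t _ => hn t]
  refine le_trans ?_ h
  simp_rw [← fun t => lintegral_avoiding P π M t (unmarked_nonneg M)]
  rw [← lintegral_finsetSum']
  · rw [hittingTime]
    -- Pointwise, a trajectory with `y m ∈ M` can avoid `M` only up to times `t < m`. On
    -- trajectories that never hit `M` the infimum is `∞`, and no `m` has to be considered.
    refine lintegral_mono fun y => le_iInf₂ fun m hm => ?_
    calc ∑ t ∈ Finset.range n, (if y ∈ avoiding M t then 1 else 0)
          * ENNReal.ofReal (unmarked M (y t))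
        ≤ ∑ t ∈ Finset.range n, (if t < m then (1 : ℝ≥0∞) else 0) := by
          refine Finset.sum_le_sum fun t _ => ?_
          by_cases htm : t < m
          · rw [if_pos htm]
            refine mul_le_one' (by split_ifs <;> simp) ?_
            rw [ENNReal.ofReal_le_one, unmarked]
            split_ifs <;> norm_num
          · have : y ∉ avoiding M t := fun hy => hy m (not_lt.1 htm) hm
            simp [this]
      _ ≤ (m : ℝ≥0∞) := by
          rw [← Finset.sum_filter, Finset.sum_const, nsmul_eq_mul, mul_one, Nat.cast_le]
          refine (Finset.card_le_card (t := Finset.range m) fun t ht => ?_).trans_eq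
            (Finset.card_range m)
          simpa using (Finset.mem_filter.1 ht).2
  · intro t _
    refine Measurable.aemeasurable (Measurable.mul ?_ ?_)
    · refine Measurable.ite ?_ measurable_const measurable_const
      have : avoiding M t = (Preorder.frestrictLe (π := fun _ => X) t) ⁻¹'
          {g | ∀ i, g i ∉ M} := by
        ext y; exact mem_avoiding_iff
      rw [this]
      exact (by fun_prop : Measurable (Preorder.frestrictLe (π := fun _ => X) t))
        (Set.toFinite _).measurableSet
    · exact (measurable_of_countable fun x => ENNReal.ofReal (unmarked M x)).comp
        (measurable_pi_apply t)

end HittingTime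

/-! ### The simple random walk on the integers and its Gaussian tail -/

section RandomWalk

/-- One step of averaging over the two neighbours of an integer. -/
def neighbourMean : (ℤ → ℝ) →ₗ[ℝ] (ℤ → ℝ) where
  toFun g k := (g (k + 1) + g (k - 1)) / 2
  map_add' f g := by ext k; simp only [Pi.add_apply]; ring
  map_smul' c g := by ext k; simp only [Pi.smul_apply, smul_eq_mul, RingHom.id_apply]; ring

/-- The expectation of a function of the position of the simple random walk on `ℤ` at time `t`. -/
def walkMean : ℕ → (ℤ → ℝ) →ₗ[ℝ] ℝ
  | 0 => LinearMap.proj 0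
  | t + 1 => walkMean t ∘ₗ neighbourMean

lemma walkMean_zero (g : ℤ → ℝ) : walkMean 0 g = g 0 := rfl

lemma walkMean_succ (t : ℕ) (g : ℤ → ℝ) :
    walkMean (t + 1) g = walkMean t fun k => (g (k + 1) + g (k - 1)) / 2 := rfl

lemma walkMean_mono (t : ℕ) {f g : ℤ → ℝ} (h : ∀ k, f k ≤ g k) : walkMean t f ≤ walkMean t g := by
  induction t generalizing f g with
  | zero => exact h 0
  | succ t ih =>
    rw [walkMean_succ, walkMean_succ]
    exact ih fun k => by linarith [h (k + 1), h (k - 1)]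

lemma walkMean_nonneg (t : ℕ) {f : ℤ → ℝ} (h : ∀ k, 0 ≤ f k) : 0 ≤ walkMean t f := by
  simpa using walkMean_mono t (f := 0) h

lemma walkMean_one (t : ℕ) : walkMean t (fun _ => 1) = 1 := by
  induction t with
  | zero => rfl
  | succ t ih => rw [walkMean_succ]; norm_num [ih]

lemma walkMean_sq_le (t : ℕ) (g : ℤ → ℝ) : walkMean t g ^ 2 ≤ walkMean t fun k => g k ^ 2 := by
  induction t generalizing g with
  | zero => exact le_rfl
  | succ t ih =>
    rw [walkMean_succ, walkMean_succ]
    exact (ih _).trans (walkMean_mono t fun k => by nlinarith [sq_nonneg (g (k + 1) - g (k - 1))])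

lemma walkMean_exp (t : ℕ) (θ : ℝ) :
    walkMean t (fun k => Real.exp (θ * k)) = Real.cosh θ ^ t := by
  induction t with
  | zero => simp [walkMean_zero]
  | succ t ih =>
    have e : (fun k : ℤ => (Real.exp (θ * ((k + 1 : ℤ) : ℝ)) + Real.exp (θ * ((k - 1 : ℤ) : ℝ))) / 2)
        = Real.cosh θ • fun k : ℤ => Real.exp (θ * k) := by
      ext k
      rw [Pi.smul_apply, smul_eq_mul, Real.cosh_eq, Int.cast_add, Int.cast_sub, Int.cast_one, mul_add,
        mul_sub, mul_one, Real.exp_add, Real.exp_sub, Real.exp_neg]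
      field_simp
    rw [walkMean_succ, e, map_smul, ih, smul_eq_mul, pow_succ, mul_comm]

/-- Hoeffding's inequality for the simple random walk. -/
lemma walkMean_tail_le {t n : ℕ} (hn : 0 < n) (htn : t ≤ n) (τ : ℕ) :
    walkMean t (fun k => if k.natAbs ≤ τ then 0 else 1)
      ≤ 2 * Real.exp (-(τ ^ 2 / (2 * n) : ℝ)) := by
  -- The Chernoff parameter that minimizes `θ ^ 2 * n / 2 - θ * τ`.
  set θ : ℝ := τ / n with hθ
  have hn' : (0 : ℝ) < n := by exact_mod_cast hn
  have hθ0 : 0 ≤ θ := by positivity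
  have h1 : walkMean t (fun k => if k.natAbs ≤ τ then 0 else 1) ≤ walkMean t
      (Real.exp (-(θ * τ)) • ((fun k : ℤ => Real.exp (θ * k)) + fun k : ℤ => Real.exp (-θ * k))) := by
    refine walkMean_mono t fun k => ?_
    simp only [Pi.smul_apply, Pi.add_apply, smul_eq_mul]
    split_ifs with hk
    · positivity
    · have hk' : (τ : ℝ) ≤ |(k : ℝ)| := by
        have : (τ : ℤ) ≤ |k| := by rw [Int.abs_eq_natAbs]; omega
        exact_mod_cast this
      rw [mul_add, ← Real.exp_add, ← Real.exp_add]
      rcases le_total 0 (k : ℝ) with h0 | h0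
      · rw [abs_of_nonneg h0] at hk'
        have : 1 ≤ Real.exp (-(θ * τ) + θ * k) := Real.one_le_exp (by nlinarith)
        linarith [Real.exp_pos (-(θ * τ) + -θ * k)]
      · rw [abs_of_nonpos h0] at hk'
        have : 1 ≤ Real.exp (-(θ * τ) + -θ * k) := Real.one_le_exp (by nlinarith)
        linarith [Real.exp_pos (-(θ * τ) + θ * k)]
  rw [map_smul, map_add, walkMean_exp, walkMean_exp, Real.cosh_neg, smul_eq_mul] at h1
  have h2 : Real.cosh θ ^ t ≤ Real.exp (θ ^ 2 / 2 * n) := by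
    calc Real.cosh θ ^ t ≤ Real.cosh θ ^ n := pow_le_pow_right₀ (Real.one_le_cosh θ) htn
      _ ≤ Real.exp (θ ^ 2 / 2) ^ n :=
          pow_le_pow_left₀ (Real.cosh_pos θ).le (Real.cosh_le_exp_half_sq θ) n
      _ = _ := by rw [← Real.exp_nat_mul, mul_comm]
  calc _ ≤ _ := h1
    _ ≤ Real.exp (-(θ * τ)) * (Real.exp (θ ^ 2 / 2 * n) + Real.exp (θ ^ 2 / 2 * n)) := by gcongr
    _ = 2 * Real.exp (-(θ * τ) + θ ^ 2 / 2 * n) := by rw [Real.exp_add]; ring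
    _ = _ := by
        congr 2
        rw [hθ]; field_simp; ring

/-- The probability that the simple random walk is at distance `k` from the origin at time `t`. -/
def walkWeight (t k : ℕ) : ℝ := walkMean t fun m => if m.natAbs = k then 1 else 0

lemma walkWeight_nonneg (t k : ℕ) : 0 ≤ walkWeight t k :=
  walkMean_nonneg t fun m => by split_ifs <;> norm_num

lemma sum_walkWeight_mul (t τ : ℕ) (F : ℕ → ℝ) :
    ∑ k ∈ Finset.range (τ + 1), walkWeight t k * F k
      = walkMean t fun m => if m.natAbs ≤ τ then F m.natAbs else 0 := by
  have e : (fun m : ℤ => if m.natAbs ≤ τ then F m.natAbs else 0)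
      = ∑ k ∈ Finset.range (τ + 1), F k • fun m : ℤ => if m.natAbs = k then (1 : ℝ) else 0 := by
    ext m
    simp only [Finset.sum_apply, Pi.smul_apply, smul_eq_mul, mul_ite, mul_one, mul_zero,
      Finset.sum_ite_eq, Finset.mem_range, Nat.lt_succ_iff]
  rw [e, map_sum]
  exact Finset.sum_congr rfl fun k _ => by rw [map_smul, smul_eq_mul, mul_comm, walkWeight]

lemma sum_walkWeight_le_one (t τ : ℕ) : ∑ k ∈ Finset.range (τ + 1), walkWeight t k ≤ 1 := by
  have h := sum_walkWeight_mul t τ fun _ => 1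
  simp only [mul_one] at h
  rw [h]
  exact (walkMean_mono t (g := fun _ => 1) fun m => by split_ifs <;> norm_num).trans_eq
    (walkMean_one t)

lemma walkMean_natAbs_le {t n : ℕ} (hn : 0 < n) (htn : t ≤ n) (τ : ℕ) {F : ℕ → ℝ}
    (hF : ∀ k, F k ≤ 1) :
    (walkMean t fun m => F m.natAbs) ≤ ∑ k ∈ Finset.range (τ + 1), walkWeight t k * F k
      + 2 * Real.exp (-(τ ^ 2 / (2 * n) : ℝ)) := by
  refine le_trans ?_ (add_le_add_right (walkMean_tail_le hn htn τ) _)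
  rw [sum_walkWeight_mul, ← map_add]
  refine walkMean_mono t fun m => ?_
  simp only [Pi.add_apply]
  split_ifs
  · simp
  · simpa using hF _

end RandomWalk

/-! ### Powers of a matrix as averages of Chebyshev polynomials -/

section Chebyshev

variable {X : Type*} [Fintype X] [DecidableEq X]

/-- The vectors `T_k(D) v`, where `T_k` are the Chebyshev polynomials of the first kind. -/
def chebVec (D : Matrix X X ℝ) (v : X → ℝ) : ℕ → X → ℝ
  | 0 => v
  | 1 => D.mulVec v
  | k + 2 => fun x => 2 * D.mulVec (chebVec D v (k + 1)) x - chebVec D v k x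

lemma chebVec_add_two (D : Matrix X X ℝ) (v : X → ℝ) (k : ℕ) (x : X) :
    chebVec D v (k + 2) x = 2 * D.mulVec (chebVec D v (k + 1)) x - chebVec D v k x := rfl

/-- With `T_{-k} = T_k` the recurrence `T_{k+1} + T_{k-1} = 2 x T_k` holds for all integers `k`, so
multiplication by `D` is a step of the simple random walk in the degree. -/
lemma mean_chebVec (D : Matrix X X ℝ) (v : X → ℝ) (k : ℤ) (x : X) :
    (chebVec D v (k + 1).natAbs x + chebVec D v (k - 1).natAbs x) / 2
      = D.mulVec (chebVec D v k.natAbs) x := by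
  have key : ∀ m : ℕ, (chebVec D v (m + 1 + 1) x + chebVec D v m x) / 2
      = D.mulVec (chebVec D v (m + 1)) x := fun m => by
    rw [chebVec_add_two]; ring
  rcases lt_trichotomy k 0 with h | h | h
  · obtain ⟨m, rfl⟩ : ∃ m : ℕ, k = -(m + 1 : ℕ) := ⟨k.natAbs - 1, by omega⟩
    have e1 : (-((m + 1 : ℕ) : ℤ) + 1).natAbs = m := by omega
    have e2 : (-((m + 1 : ℕ) : ℤ) - 1).natAbs = m + 1 + 1 := by omega
    have e3 : (-((m + 1 : ℕ) : ℤ)).natAbs = m + 1 := by omega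
    rw [e1, e2, e3, ← key m, add_comm]
  · subst h
    have e1 : ((0 : ℤ) + 1).natAbs = 1 := rfl
    have e2 : ((0 : ℤ) - 1).natAbs = 1 := rfl
    rw [e1, e2]
    simp [chebVec]
  · obtain ⟨m, rfl⟩ : ∃ m : ℕ, k = (m + 1 : ℕ) := ⟨k.natAbs - 1, by omega⟩
    have e1 : (((m + 1 : ℕ) : ℤ) + 1).natAbs = m + 1 + 1 := by omega
    have e2 : (((m + 1 : ℕ) : ℤ) - 1).natAbs = m := by omega
    have e3 : (((m + 1 : ℕ) : ℤ)).natAbs = m + 1 := by omega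
    rw [e1, e2, e3, ← key m]

/-- The powers of `D` are averages of Chebyshev polynomials over a simple random walk. -/
lemma pow_mulVec_eq_walkMean (D : Matrix X X ℝ) (v : X → ℝ) (t : ℕ) (x : X) :
    (D ^ t).mulVec v x = walkMean t fun k => chebVec D v k.natAbs x := by
  induction t generalizing x with
  | zero => simp [walkMean_zero, chebVec]
  | succ t ih =>
    rw [walkMean_succ]
    simp only [mean_chebVec]
    have e : (fun k : ℤ => D.mulVec (chebVec D v k.natAbs) x)
        = ∑ y, D x y • fun k : ℤ => chebVec D v k.natAbs y := by
      ext k; simp [Matrix.mulVec, dotProduct]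
    rw [e, map_sum, pow_succ', ← Matrix.mulVec_mulVec, Matrix.mulVec, dotProduct]
    exact Finset.sum_congr rfl fun y _ => by rw [map_smul, ih, smul_eq_mul]

/-- Jensen's inequality takes the square inside the average over the random walk: a random Chebyshev
degree does at least as well as `D ^ t`. Degrees above `τ` are dropped at the price of the tail of
the walk. -/
lemma sum_pow_mulVec_sq_le {D : Matrix X X ℝ} {v : X → ℝ} {M : Finset X}
    (hF : ∀ k, ∑ x ∈ M, chebVec D v k x ^ 2 ≤ 1) {t n : ℕ} (hn : 0 < n) (htn : t ≤ n) (τ : ℕ) :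
    ∑ x ∈ M, (D ^ t).mulVec v x ^ 2
      ≤ ∑ k ∈ Finset.range (τ + 1), walkWeight t k * ∑ x ∈ M, chebVec D v k x ^ 2
        + 2 * Real.exp (-(τ ^ 2 / (2 * n) : ℝ)) := by
  refine le_trans ?_ (walkMean_natAbs_le hn htn τ hF)
  have e : (fun m : ℤ => ∑ x ∈ M, chebVec D v m.natAbs x ^ 2)
      = ∑ x ∈ M, fun m : ℤ => chebVec D v m.natAbs x ^ 2 := by
    ext m; simp
  rw [e, map_sum]
  refine Finset.sum_le_sum fun x _ => ?_
  rw [pow_mulVec_eq_walkMean]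
  exact walkMean_sq_le t _

end Chebyshev

/-! ### The discriminant of the slowed chain and its marked entries -/

section Discriminant

variable {X : Type*} [Fintype X] [DecidableEq X]

/-- The discriminant matrix of the slowed chain. -/
def discriminant (P : Matrix X X ℝ) (M : Finset X) (ρ : ℝ) : Matrix X X ℝ := fun x y =>
  √(slowed P M ρ x y * slowed P M ρ y x)

variable {P : Matrix X X ℝ} {M : Finset X} {ρ : ℝ} {π : X → ℝ}

lemma pow_mulVec_mono {D : Matrix X X ℝ} (hD : ∀ x y, 0 ≤ D x y) {f g : X → ℝ}
    (h : ∀ x, f x ≤ g x) (t : ℕ) (x : X) : (D ^ t).mulVec f x ≤ (D ^ t).mulVec g x := by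
  induction t generalizing x with
  | zero => simpa using h x
  | succ t ih =>
    rw [pow_succ', ← Matrix.mulVec_mulVec, ← Matrix.mulVec_mulVec]
    exact mulVec_mono hD ih x

lemma discriminant_nonneg (x y : X) : 0 ≤ discriminant P M ρ x y := Real.sqrt_nonneg _

/-- The square root of an unnormalised stationary distribution of the slowed chain. -/
def slowedAmplitude (π : X → ℝ) (M : Finset X) (ρ : ℝ) (x : X) : ℝ :=
  √(π x) * if x ∈ M then 1 else √ρ⁻¹

lemma slowed_detailed_balance (hπ : ∀ x, 0 ≤ π x) (hdb : ∀ x y, π x * P x y = π y * P y x)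
    (hρ : 1 ≤ ρ) (x y : X) :
    slowedAmplitude π M ρ x ^ 2 * slowed P M ρ x y
      = slowedAmplitude π M ρ y ^ 2 * slowed P M ρ y x := by
  have h := hdb x y
  by_cases hxy : x = y
  · subst hxy; rfl
  have hyx : y ≠ x := fun h => hxy h.symm
  have hρ0 : 0 ≤ ρ⁻¹ := by positivity
  simp only [slowedAmplitude, slowed, mul_pow, Real.sq_sqrt (hπ _), hxy, hyx, if_false, mul_zero,
    add_zero]
  split_ifs <;> simp only [one_pow, Real.sq_sqrt hρ0] <;> linear_combination ρ⁻¹ * h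

/-- Both sides are nonnegative and have equal squares, by detailed balance. So the discriminant is
the slowed chain conjugated by a diagonal matrix. -/
lemma discriminant_mul_slowedAmplitude (hP : ∀ x y, 0 ≤ P x y) (hπ : ∀ x, 0 ≤ π x)
    (hdb : ∀ x y, π x * P x y = π y * P y x) (hρ : 1 ≤ ρ) (x y : X) :
    discriminant P M ρ x y * slowedAmplitude π M ρ y
      = slowedAmplitude π M ρ x * slowed P M ρ x y := by
  have hA : ∀ z, 0 ≤ slowedAmplitude π M ρ z := fun z =>
    mul_nonneg (Real.sqrt_nonneg _) (by split_ifs <;> positivity)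
  have hs := slowed_nonneg (M := M) hP hρ
  refine (pow_left_inj₀ (mul_nonneg (discriminant_nonneg x y) (hA y))
    (mul_nonneg (hA x) (hs x y)) two_ne_zero).1 ?_
  rw [mul_pow, discriminant, Real.sq_sqrt (mul_nonneg (hs x y) (hs y x))]
  linear_combination (-slowed P M ρ x y) * slowed_detailed_balance (M := M) hπ hdb hρ x y

lemma discriminant_pow_mulVec (hP : ∀ x y, 0 ≤ P x y) (hπ : ∀ x, 0 ≤ π x)
    (hdb : ∀ x y, π x * P x y = π y * P y x) (hρ : 1 ≤ ρ) (f : X → ℝ) (t : ℕ) (x : X) :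
    (discriminant P M ρ ^ t).mulVec (fun y => slowedAmplitude π M ρ y * f y) x
      = slowedAmplitude π M ρ x * (slowed P M ρ ^ t).mulVec f x := by
  induction t generalizing x with
  | zero => simp
  | succ t ih =>
    rw [pow_succ', ← Matrix.mulVec_mulVec, pow_succ', ← Matrix.mulVec_mulVec, funext ih]
    simp only [Matrix.mulVec, dotProduct, Finset.mul_sum]
    refine Finset.sum_congr rfl fun y _ => Finset.sum_congr rfl fun z _ => ?_
    linear_combination ((slowed P M ρ ^ t) y z * f z) *
      discriminant_mul_slowedAmplitude (M := M) hP hπ hdb hρ x y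

/-- On `Mᶜ`, `√π` is `√ρ` times the slowed amplitude, and powers of a nonnegative matrix preserve
the resulting lower bound for `√π`. At a marked `x` the slowed amplitude is `√(π x)` itself, so the
factor `√ρ` is gained. -/
lemma le_discriminant_pow_mulVec_sq (hP : ∀ x y, 0 ≤ P x y) (hπ : ∀ x, 0 ≤ π x)
    (hdb : ∀ x y, π x * P x y = π y * P y x) (hρ : 1 ≤ ρ) (t : ℕ) {x : X} (hx : x ∈ M) :
    ρ * (π x * unmarkedProb P M ρ t x ^ 2)
      ≤ (discriminant P M ρ ^ t).mulVec (fun y => √(π y)) x ^ 2 := by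
  have hρ0 : 0 ≤ ρ := by linarith
  have hle : √ρ * (√(π x) * unmarkedProb P M ρ t x)
      ≤ (discriminant P M ρ ^ t).mulVec (fun y => √(π y)) x := by
    have h := pow_mulVec_mono (D := discriminant P M ρ) discriminant_nonneg
      (f := fun y => slowedAmplitude π M ρ y * (√ρ * unmarked M y)) (g := fun y => √(π y))
      (fun y => by
        by_cases hy : y ∈ M
        · simp [unmarked, hy]
        · have : √ρ⁻¹ * √ρ = 1 := by
            rw [← Real.sqrt_mul (by positivity), inv_mul_cancel₀ (by positivity), Real.sqrt_one]
          simp only [unmarked, hy, slowedAmplitude, if_false, mul_one, mul_assoc, this, le_refl]) t x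
    rw [discriminant_pow_mulVec hP hπ hdb hρ] at h
    refine le_trans (le_of_eq ?_) h
    have e : (fun y => √ρ * unmarked M y) = √ρ • unmarked M := rfl
    rw [e, Matrix.mulVec_smul]
    simp only [slowedAmplitude, hx, if_true, Pi.smul_apply, smul_eq_mul, unmarkedProb]
    ring
  have h0 : 0 ≤ √ρ * (√(π x) * unmarkedProb P M ρ t x) :=
    mul_nonneg (Real.sqrt_nonneg _) (mul_nonneg (Real.sqrt_nonneg _) (unmarkedProb_nonneg hP hρ t x))
  refine le_trans (le_of_eq ?_) (pow_le_pow_left₀ h0 hle 2)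
  rw [mul_pow, mul_pow, Real.sq_sqrt hρ0, Real.sq_sqrt (hπ x)]

/-- Only the path that stays at `x` is kept; the diagonal entry there is at least `1 - ρ⁻¹`. This
serves the case of large `π(M)`. -/
lemma le_discriminant_pow_mulVec_sq' (hP : ∀ x y, 0 ≤ P x y) (hπ : ∀ x, 0 ≤ π x) (hρ : 1 ≤ ρ)
    (t : ℕ) {x : X} (hx : x ∈ M) :
    ((1 - ρ⁻¹) ^ 2) ^ t * π x ≤ (discriminant P M ρ ^ t).mulVec (fun y => √(π y)) x ^ 2 := by
  have hr : 0 ≤ 1 - ρ⁻¹ := sub_nonneg.2 (inv_le_one_of_one_le₀ hρ)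
  have hρ0 : 0 ≤ ρ⁻¹ := by positivity
  have hn : ∀ (t : ℕ) y, 0 ≤ (discriminant P M ρ ^ t).mulVec (fun y => √(π y)) y := fun t y => by
    simpa [Matrix.mulVec_zero] using pow_mulVec_mono (D := discriminant P M ρ) discriminant_nonneg
      (f := 0) (g := fun y => √(π y)) (fun y => Real.sqrt_nonneg _) t y
  have hle : (1 - ρ⁻¹) ^ t * √(π x) ≤ (discriminant P M ρ ^ t).mulVec (fun y => √(π y)) x := by
    induction t with
    | zero => simp
    | succ t ih =>
      have hd : 1 - ρ⁻¹ ≤ discriminant P M ρ x x := by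
        rw [discriminant, Real.sqrt_mul_self (slowed_nonneg hP hρ x x)]
        have := mul_nonneg hρ0 (hP x x)
        simpa [slowed, hx] using this
      rw [pow_succ', pow_succ', mul_assoc, ← Matrix.mulVec_mulVec]
      refine le_trans (mul_le_mul hd ih (by positivity) (hr.trans hd)) ?_
      exact Finset.single_le_sum (f := fun y => discriminant P M ρ x y *
        (discriminant P M ρ ^ t).mulVec (fun y => √(π y)) y)
        (fun y _ => mul_nonneg (discriminant_nonneg x y) (hn t y)) (Finset.mem_univ x)
  refine le_trans (le_of_eq ?_) (pow_le_pow_left₀ (by positivity) hle 2)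
  rw [mul_pow, Real.sq_sqrt (hπ x), pow_right_comm]

end Discriminant

/-! ### Unitarity, inversion and composition of gates -/

section MatrixActions

variable {m n : Type*} [Fintype m] [Fintype n] [DecidableEq m] [DecidableEq n]

lemma kronecker_one_mulVec (A : Matrix m m ℂ) (f : m × n → ℂ) (i : m) (j : n) :
    (A ⊗ₖ (1 : Matrix n n ℂ)).mulVec f (i, j) = ∑ i', A i i' * f (i', j) := by
  simp [Matrix.mulVec, dotProduct, Fintype.sum_prod_type, Matrix.one_apply]

lemma one_kronecker_mulVec (B : Matrix n n ℂ) (f : m × n → ℂ) (i : m) (j : n) :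
    ((1 : Matrix m m ℂ) ⊗ₖ B).mulVec f (i, j) = B.mulVec (fun j' => f (i, j')) j := by
  simp only [Matrix.mulVec, dotProduct, Fintype.sum_prod_type, Matrix.kronecker_apply,
    Matrix.one_apply, ite_mul, one_mul, zero_mul]
  rw [Finset.sum_comm]
  simp

/-- The matrix of an involution of the basis. -/
lemma permMatrix_mem_unitaryGroup {A : Matrix n n ℂ} {σ : n → n} (hσ : ∀ i, σ (σ i) = i)
    (hA : ∀ i j, A i j = if i = σ j then 1 else 0) :
    A.conjTranspose = A ∧ A ∈ Matrix.unitaryGroup n ℂ := by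
  have h1 : A.conjTranspose = A := by
    ext i j
    rw [Matrix.conjTranspose_apply, hA, hA]
    have : j = σ i ↔ i = σ j := ⟨fun h => by rw [h, hσ], fun h => by rw [h, hσ]⟩
    by_cases h : i = σ j <;> simp [this, h, hσ]
  refine ⟨h1, ?_⟩
  rw [Matrix.mem_unitaryGroup_iff, Matrix.star_eq_conjTranspose, h1]
  ext i j
  rw [Matrix.mul_apply]
  simp only [hA, mul_ite, mul_one, mul_zero, Finset.sum_ite_eq', Finset.mem_univ, if_true, hσ,
    Matrix.one_apply]

end MatrixActions

section Gates

variable {X : Type*} [Fintype X] [DecidableEq X] {K : ℕ}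

lemma controlled_mulVec (c : Finset (Memory K)) (A : Matrix (X × X) (X × X) ℂ)
    (f : Config K X → ℂ) (m : Memory K) (v : X × X) :
    (controlled c A).mulVec f (m, v)
      = if m ∈ c then A.mulVec (fun w => f (m, w)) v else f (m, v) := by
  rw [Matrix.mulVec, dotProduct, Fintype.sum_prod_type, Finset.sum_eq_single m]
  · by_cases hm : m ∈ c <;> simp [controlled, hm, Matrix.mulVec, dotProduct, Matrix.one_apply]
  · intro m' _ h
    simp [controlled, h.symm]
  · simp

lemma controlled_conjTranspose (c : Finset (Memory K)) (A : Matrix (X × X) (X × X) ℂ) :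
    (controlled c A).conjTranspose = controlled c A.conjTranspose := by
  ext ⟨m, v⟩ ⟨m', w⟩
  by_cases h : m = m'
  · subst h
    simp only [controlled, Matrix.conjTranspose_apply, Matrix.of_apply, if_true]
    split_ifs
    · rfl
    · rw [← Matrix.conjTranspose_apply, Matrix.conjTranspose_one]
  · simp [controlled, h, Ne.symm h]

lemma controlled_mem_unitaryGroup (c : Finset (Memory K)) {A : Matrix (X × X) (X × X) ℂ}
    (hA : A ∈ Matrix.unitaryGroup (X × X) ℂ) :
    controlled c A ∈ Matrix.unitaryGroup (Config K X) ℂ := by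
  rw [Matrix.mem_unitaryGroup_iff, Matrix.star_eq_conjTranspose] at hA ⊢
  rw [controlled_conjTranspose]
  refine Matrix.ext_of_mulVec_single fun p => funext fun q => ?_
  rw [← Matrix.mulVec_mulVec, Matrix.one_mulVec]
  generalize (Pi.single p 1 : Config K X → ℂ) = f
  obtain ⟨m, v⟩ := q
  rw [controlled_mulVec]
  simp only [controlled_mulVec]
  by_cases hm : m ∈ c
  · simp [hm, Matrix.mulVec_mulVec, hA]
  · simp [hm]

lemma shiftMatrix_conj_mem :
    (shiftMatrix X).conjTranspose = shiftMatrix X ∧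
      shiftMatrix X ∈ Matrix.unitaryGroup (X × X) ℂ :=
  permMatrix_mem_unitaryGroup (σ := Prod.swap) (fun p => Prod.swap_swap p) fun _ _ => rfl

lemma checkMatrix_conj_mem (M : Finset X) :
    (checkMatrix K M).conjTranspose = checkMatrix K M ∧
      checkMatrix K M ∈ Matrix.unitaryGroup (Config K X) ℂ :=
  permMatrix_mem_unitaryGroup
    (σ := fun q => ((if q.2.2 ∈ M then !q.1.1 else q.1.1, q.1.2), q.2))
    (fun p => by by_cases h : p.2.2 ∈ M <;> simp [h]) fun _ _ => rfl

lemma refMatrix_conj_mem {r : X → ℂ} (hr : ∑ x, ‖r x‖ ^ 2 = 1) :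
    (refMatrix r).conjTranspose = refMatrix r ∧
      refMatrix r ∈ Matrix.unitaryGroup (X × X) ℂ := by
  have h1 : ((2 : ℂ) • Matrix.vecMulVec r (star r) - 1).conjTranspose
      = (2 : ℂ) • Matrix.vecMulVec r (star r) - 1 := by
    simp [Matrix.conjTranspose_sub, Matrix.conjTranspose_smul, Matrix.conjTranspose_vecMulVec]
  have hrr : star r ⬝ᵥ r = 1 := by
    have : star r ⬝ᵥ r = ((∑ x, ‖r x‖ ^ 2 : ℝ) : ℂ) := by
      push_cast
      exact Finset.sum_congr rfl fun x _ => by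
        rw [Pi.star_apply, RCLike.star_def, Complex.conj_mul']
    rw [this, hr, Complex.ofReal_one]
  have h2 : (2 : ℂ) • Matrix.vecMulVec r (star r) - 1 ∈ Matrix.unitaryGroup X ℂ := by
    rw [Matrix.mem_unitaryGroup_iff, Matrix.star_eq_conjTranspose, h1]
    have : Matrix.vecMulVec r (star r) * Matrix.vecMulVec r (star r)
        = Matrix.vecMulVec r (star r) := by
      rw [Matrix.vecMulVec_mul_vecMulVec, hrr, one_smul]
    rw [sub_mul, mul_sub, mul_one, one_mul, smul_mul_smul_comm, this]
    module
  refine ⟨?_, Matrix.kronecker_mem_unitary h2 (one_mem _)⟩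
  rw [refMatrix, Matrix.conjTranspose_kronecker, h1, Matrix.conjTranspose_one]

variable {P : Matrix.rowStochastic ℝ X} {π : stdSimplex ℝ X} (O : WalkImplementation P π)
  (M : Finset X)

/-- The inverse operation. -/
def Gate.inverse : Gate K → Gate K
  | .memory W => .memory W⁻¹
  | .setup => .setupInv
  | .setupInv => .setup
  | .shift c => .shift c
  | .reflect c => .reflect c
  | .walk c => .walkInv c
  | .walkInv c => .walk c
  | .check => .check

lemma Gate.toMatrix_mem (g : Gate K) : g.toMatrix O M ∈ Matrix.unitaryGroup (Config K X) ℂ := by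
  cases g with
  | memory W => exact Matrix.kronecker_mem_unitary W.2 (one_mem _)
  | setup =>
    exact Matrix.kronecker_mem_unitary (one_mem _)
      (Matrix.kronecker_mem_unitary (one_mem _) O.setup.2)
  | setupInv =>
    exact Matrix.kronecker_mem_unitary (one_mem _)
      (Matrix.kronecker_mem_unitary (one_mem _) (star O.setup).2)
  | shift c => exact controlled_mem_unitaryGroup c shiftMatrix_conj_mem.2
  | reflect c => exact controlled_mem_unitaryGroup c (refMatrix_conj_mem O.ref_unit).2
  | walk c => exact controlled_mem_unitaryGroup c O.V.2
  | walkInv c => exact controlled_mem_unitaryGroup c (star O.V).2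
  | check => exact (checkMatrix_conj_mem M).2

lemma Gate.toMatrix_inverse (g : Gate K) :
    g.inverse.toMatrix O M = (g.toMatrix O M).conjTranspose := by
  cases g with
  | memory W =>
    simp [Gate.inverse, Gate.toMatrix, Matrix.conjTranspose_kronecker, Matrix.star_eq_conjTranspose]
  | setup => simp [Gate.inverse, Gate.toMatrix, Matrix.conjTranspose_kronecker]
  | setupInv => simp [Gate.inverse, Gate.toMatrix, Matrix.conjTranspose_kronecker]
  | shift c =>
    simp [Gate.inverse, Gate.toMatrix, controlled_conjTranspose, shiftMatrix_conj_mem.1]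
  | reflect c =>
    simp [Gate.inverse, Gate.toMatrix, controlled_conjTranspose, (refMatrix_conj_mem O.ref_unit).1]
  | walk c => simp [Gate.inverse, Gate.toMatrix, controlled_conjTranspose]
  | walkInv c => simp [Gate.inverse, Gate.toMatrix, controlled_conjTranspose]
  | check => simp [Gate.inverse, Gate.toMatrix, (checkMatrix_conj_mem M).1]

/-- The inverse of a sequence of operations. -/
def inverseCircuit (A : List (Gate K)) : List (Gate K) := (A.map Gate.inverse).reverse

/-- The matrix of a sequence of operations. -/
def circuitMatrix : List (Gate K) → Matrix (Config K X) (Config K X) ℂ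
  | [] => 1
  | g :: A => circuitMatrix A * g.toMatrix O M

lemma circuitMatrix_append (A B : List (Gate K)) :
    circuitMatrix O M (A ++ B) = circuitMatrix O M B * circuitMatrix O M A := by
  induction A with
  | nil => simp [circuitMatrix]
  | cons g A ih => simp [circuitMatrix, ih, mul_assoc]

lemma circuitMatrix_singleton (g : Gate K) : circuitMatrix O M [g] = g.toMatrix O M := by
  simp [circuitMatrix]

lemma circuitMatrix_mem (A : List (Gate K)) :
    circuitMatrix O M A ∈ Matrix.unitaryGroup (Config K X) ℂ := by
  induction A with
  | nil => exact one_mem _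
  | cons g A ih => exact mul_mem ih (g.toMatrix_mem O M)

lemma circuitMatrix_inverse (A : List (Gate K)) :
    circuitMatrix O M (inverseCircuit A) = (circuitMatrix O M A).conjTranspose := by
  induction A with
  | nil => simp [inverseCircuit, circuitMatrix]
  | cons g A ih =>
    rw [circuitMatrix, Matrix.conjTranspose_mul, ← ih, ← Gate.toMatrix_inverse]
    simp [inverseCircuit, circuitMatrix_append, circuitMatrix_singleton]

lemma finalState_eq_mulVec (A : QuantumAlgorithm K) :
    A.finalState O M = (circuitMatrix O M A).mulVec (initialState K O) := by
  have key : ∀ (B : List (Gate K)) (ψ : Config K X → ℂ),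
      B.foldl (fun ψ g => (g.toMatrix O M).mulVec ψ) ψ = (circuitMatrix O M B).mulVec ψ := by
    intro B
    induction B with
    | nil => simp [circuitMatrix]
    | cons g B ih => intro ψ; simp [circuitMatrix, ih, Matrix.mulVec_mulVec]
  exact key A _

lemma unitary_mulVec_normSq {n : Type*} [Fintype n] [DecidableEq n] {A : Matrix n n ℂ}
    (hA : A ∈ Matrix.unitaryGroup n ℂ) (f : n → ℂ) :
    star (A.mulVec f) ⬝ᵥ A.mulVec f = star f ⬝ᵥ f := by
  rw [Matrix.star_mulVec, Matrix.dotProduct_mulVec, Matrix.vecMul_vecMul,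
    ← Matrix.star_eq_conjTranspose, Matrix.mem_unitaryGroup_iff'.1 hA, Matrix.vecMul_one]

lemma star_dotProduct_self_eq {n : Type*} [Fintype n] (f : n → ℂ) :
    star f ⬝ᵥ f = ((∑ i, ‖f i‖ ^ 2 : ℝ) : ℂ) := by
  push_cast
  exact Finset.sum_congr rfl fun x _ => by rw [Pi.star_apply, RCLike.star_def, Complex.conj_mul']

end Gates

/-! ### Circuit building blocks on a labelled workspace -/

section Registers

variable {X : Type*} [Fintype X] [DecidableEq X] {K : ℕ} {L : Type*} [Fintype L] [DecidableEq L]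
  (e : L ≃ Fin (K + 1)) {P : Matrix.rowStochastic ℝ X} {π : stdSimplex ℝ X}
  (O : WalkImplementation P π) (M : Finset X)

/-- The state of the machine in which the workspace is labelled by `L`. -/
def memState (ψ : Bool → L → X × X → ℂ) : Config K X → ℂ :=
  fun p => ψ p.1.1 (e.symm p.1.2) p.2

/-- The relabelling of the memory. -/
def memEquiv : Bool × L ≃ Memory K := (Equiv.refl Bool).prodCongr e

/-- A unitary on the labelled memory. -/
def memGate (W : Matrix.unitaryGroup (Bool × L) ℂ) : Gate K :=
  .memory ⟨Matrix.reindex (memEquiv e) (memEquiv e) W.1, by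
    have h := Matrix.mem_unitaryGroup_iff.1 W.2
    rw [Matrix.mem_unitaryGroup_iff, Matrix.star_eq_conjTranspose, Matrix.conjTranspose_reindex,
      Matrix.reindex_apply, Matrix.reindex_apply, Matrix.submatrix_mul_equiv,
      ← Matrix.star_eq_conjTranspose, h, Matrix.submatrix_one_equiv]⟩

lemma memGate_mulVec (W : Matrix.unitaryGroup (Bool × L) ℂ) (ψ : Bool → L → X × X → ℂ) :
    ((memGate e W).toMatrix O M).mulVec (memState e ψ)
      = memState e fun b l v => ∑ p, W.1 (b, l) p * ψ p.1 p.2 v := by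
  ext ⟨⟨b, k⟩, v⟩
  rw [memGate, Gate.toMatrix, kronecker_one_mulVec]
  refine (Fintype.sum_equiv (memEquiv e) _ _ fun p => ?_).symm
  obtain ⟨b', l⟩ := p
  simp [memState, memEquiv]

/-- The memory states whose label belongs to `c`. -/
def labelSet (c : Finset L) : Finset (Memory K) :=
  Finset.univ.filter fun m => e.symm m.2 ∈ c

lemma controlled_mulVec_memState (c : Finset (Memory K)) (A : Matrix (X × X) (X × X) ℂ)
    (ψ : Bool → L → X × X → ℂ) :
    (controlled c A).mulVec (memState e ψ)
      = memState e fun b l => if (b, e l) ∈ c then A.mulVec (ψ b l) else ψ b l := by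
  ext ⟨⟨b, k⟩, v⟩
  rw [controlled_mulVec]
  by_cases h : (b, k) ∈ c <;> simp [memState, h]

lemma check_mulVec (ψ : Bool → L → X × X → ℂ) :
    ((Gate.check : Gate K).toMatrix O M).mulVec (memState e ψ)
      = memState e fun b l v => ψ (if v.2 ∈ M then !b else b) l v := by
  ext ⟨⟨b, k⟩, v⟩
  rw [Gate.toMatrix, Matrix.mulVec, dotProduct,
    Finset.sum_eq_single ((if v.2 ∈ M then !b else b, k), v)]
  · by_cases h : v.2 ∈ M <;> simp [checkMatrix, memState, h]
  · rintro ⟨⟨b', k'⟩, v'⟩ _ hne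
    have : ((b, k), v) ≠ ((if v'.2 ∈ M then !b' else b', k'), v') := by
      intro h
      simp only [Prod.mk.injEq] at h
      obtain ⟨⟨h1, rfl⟩, rfl⟩ := h
      apply hne
      by_cases hv : v.2 ∈ M <;> simp_all
    simp only [checkMatrix, Matrix.of_apply]
    rw [if_neg this, zero_mul]
  · simp

lemma setup_mulVec (ψ : Bool → L → X × X → ℂ) :
    ((Gate.setup : Gate K).toMatrix O M).mulVec (memState e ψ)
      = memState e fun b l => ((1 : Matrix X X ℂ) ⊗ₖ O.setup.1).mulVec (ψ b l) := by
  ext ⟨⟨b, k⟩, v⟩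
  rw [Gate.toMatrix, one_kronecker_mulVec]
  rfl

end Registers

section Blocks

variable {X : Type*} [Fintype X] [DecidableEq X] {K : ℕ} {L : Type*} [Fintype L] [DecidableEq L]
  (e : L ≃ Fin (K + 1)) {P : Matrix.rowStochastic ℝ X} {π : stdSimplex ℝ X}
  (O : WalkImplementation P π) (M : Finset X)

lemma circuitMatrix_cons_mulVec (g : Gate K) (A : List (Gate K)) (f : Config K X → ℂ) :
    (circuitMatrix O M (g :: A)).mulVec f
      = (circuitMatrix O M A).mulVec ((g.toMatrix O M).mulVec f) := by
  rw [circuitMatrix, Matrix.mulVec_mulVec]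

lemma circuitMatrix_append_mulVec (A B : List (Gate K)) (f : Config K X → ℂ) :
    (circuitMatrix O M (A ++ B)).mulVec f
      = (circuitMatrix O M B).mulVec ((circuitMatrix O M A).mulVec f) := by
  rw [circuitMatrix_append, Matrix.mulVec_mulVec]

lemma circuitMatrix_nil_mulVec (f : Config K X → ℂ) :
    (circuitMatrix O M []).mulVec f = f := by
  rw [circuitMatrix, Matrix.one_mulVec]

/-- The state in which the qubit `R₃` is off and the workspace is labelled by `L`. -/
def labState (η : L → X × X → ℂ) : Config K X → ℂ :=
  memState e fun b l => if b then 0 else η l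

/-- A unitary on the labels. -/
def labelGate (W : Matrix.unitaryGroup L ℂ) : Gate K :=
  memGate e ⟨(1 : Matrix Bool Bool ℂ) ⊗ₖ W.1, Matrix.kronecker_mem_unitary (one_mem _) W.2⟩

lemma labelGate_mulVec (W : Matrix.unitaryGroup L ℂ) (η : L → X × X → ℂ) :
    ((labelGate e W).toMatrix O M).mulVec (labState e η)
      = labState e fun l v => ∑ l', W.1 l l' * η l' v := by
  rw [labelGate, labState, memGate_mulVec, labState]
  congr 1
  funext b l v
  cases b <;> simp [Fintype.sum_prod_type]

/-- The projection of the qubit onto the basis state `b`. -/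
def boolProj (b : Bool) : Matrix Bool Bool ℂ := Matrix.diagonal fun b' => if b' = b then 1 else 0

lemma boolProj_mul (b b' : Bool) :
    boolProj b * boolProj b' = if b = b' then boolProj b else 0 := by
  rw [boolProj, boolProj, Matrix.diagonal_mul_diagonal]
  ext i j
  cases b <;> cases b' <;> cases i <;> cases j <;> simp

lemma boolProj_conjTranspose (b : Bool) : (boolProj b).conjTranspose = boolProj b := by
  ext i j
  cases b <;> cases i <;> cases j <;> simp [boolProj]

lemma boolProj_add : boolProj false + boolProj true = 1 := by
  ext i j
  cases i <;> cases j <;> simp [boolProj]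

lemma flagged_mem_unitary (W : Matrix.unitaryGroup L ℂ) :
    boolProj false ⊗ₖ (1 : Matrix L L ℂ) + boolProj true ⊗ₖ W.1
      ∈ Matrix.unitaryGroup (Bool × L) ℂ := by
  have h := Matrix.mem_unitaryGroup_iff.1 W.2
  rw [Matrix.mem_unitaryGroup_iff, Matrix.star_eq_conjTranspose, Matrix.conjTranspose_add,
    Matrix.conjTranspose_kronecker, Matrix.conjTranspose_kronecker, boolProj_conjTranspose,
    boolProj_conjTranspose, Matrix.conjTranspose_one, mul_add, add_mul, add_mul,
    ← Matrix.mul_kronecker_mul, ← Matrix.mul_kronecker_mul, ← Matrix.mul_kronecker_mul,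
    ← Matrix.mul_kronecker_mul, boolProj_mul, boolProj_mul, boolProj_mul, boolProj_mul,
    ← Matrix.star_eq_conjTranspose, h]
  simp [← Matrix.add_kronecker, boolProj_add]

/-- A unitary on the labels, applied if the vertex in the second register is marked. -/
def markedCircuit (W : Matrix.unitaryGroup L ℂ) : List (Gate K) :=
  [.check, memGate e ⟨_, flagged_mem_unitary W⟩, .check]

/-- The first check writes into `R₃` whether the vertex is marked, `W` is controlled by `R₃`, and
the second check erases it. -/
lemma markedCircuit_mulVec (W : Matrix.unitaryGroup L ℂ) (η : L → X × X → ℂ) :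
    (circuitMatrix O M (markedCircuit e W)).mulVec (labState e η)
      = labState e fun l v => if v.2 ∈ M then ∑ l', W.1 l l' * η l' v else η l v := by
  rw [markedCircuit, labState, circuitMatrix_cons_mulVec, check_mulVec, circuitMatrix_cons_mulVec,
    memGate_mulVec, circuitMatrix_cons_mulVec, check_mulVec, circuitMatrix_nil_mulVec, labState]
  congr 1
  funext b l v
  by_cases hv : v.2 ∈ M <;> cases b <;>
    simp [hv, Fintype.sum_prod_type, boolProj, Matrix.one_apply]

lemma controlled_mulVec_labState (c : Finset L) (A : Matrix (X × X) (X × X) ℂ)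
    (η : L → X × X → ℂ) :
    (controlled (labelSet e c) A).mulVec (labState e η)
      = labState e fun l => if l ∈ c then A.mulVec (η l) else η l := by
  rw [labState, controlled_mulVec_memState, labState]
  congr 1
  funext b l
  by_cases h : l ∈ c <;> cases b <;> simp [labelSet, h]

lemma setup_mulVec_labState (η : L → X × X → ℂ) :
    ((Gate.setup : Gate K).toMatrix O M).mulVec (labState e η)
      = labState e fun l => ((1 : Matrix X X ℂ) ⊗ₖ O.setup.1).mulVec (η l) := by
  rw [labState, setup_mulVec, labState]
  congr 1
  funext b l
  cases b <;> simp

/-- The Hadamard matrix. -/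
def hadamard : Matrix Bool Bool ℂ :=
  Matrix.of fun b b' => ((√2)⁻¹ : ℝ) * if b && b' then -1 else 1

lemma hadamard_mem : hadamard ∈ Matrix.unitaryGroup Bool ℂ := by
  have h : (((√2)⁻¹ : ℝ) : ℂ) * ((√2)⁻¹ : ℝ) = 1 / 2 := by
    rw [← Complex.ofReal_mul, ← mul_inv, Real.mul_self_sqrt two_pos.le]
    norm_num
  rw [Matrix.mem_unitaryGroup_iff, Matrix.star_eq_conjTranspose]
  ext i j
  cases i <;> cases j <;> simp [hadamard, Matrix.mul_apply] <;> norm_num at h <;>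
    rw [h] <;> norm_num

/-- The Hadamard gate on `R₃`. -/
def hadamardGate : Gate K :=
  memGate e ⟨hadamard ⊗ₖ (1 : Matrix L L ℂ), Matrix.kronecker_mem_unitary hadamard_mem (one_mem _)⟩

lemma hadamardGate_mulVec (ψ : Bool → L → X × X → ℂ) :
    ((hadamardGate e).toMatrix O M).mulVec (memState e ψ)
      = memState e fun b l => (((√2)⁻¹ : ℝ) : ℂ) •
          (ψ false l + (if b then -1 else 1 : ℂ) • ψ true l) := by
  rw [hadamardGate, memGate_mulVec]
  congr 1
  funext b l v
  cases b <;> simp [Fintype.sum_prod_type, hadamard, Matrix.one_apply] <;> ring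

lemma signMatrix_mem {n : Type*} [Fintype n] [DecidableEq n] (c : Finset n) :
    Matrix.diagonal (fun i => if i ∈ c then (-1 : ℂ) else 1) ∈ Matrix.unitaryGroup n ℂ := by
  rw [Matrix.mem_unitaryGroup_iff, Matrix.star_eq_conjTranspose, Matrix.diagonal_conjTranspose,
    Matrix.diagonal_mul_diagonal, ← Matrix.diagonal_one]
  congr 1
  funext i
  by_cases h : i ∈ c <;> simp [h]

/-- The diagonal unitary with entries `-1` on `c` and `1` elsewhere. -/
def signUnitary {n : Type*} [Fintype n] [DecidableEq n] (c : Finset n) :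
    Matrix.unitaryGroup n ℂ := ⟨_, signMatrix_mem c⟩

lemma sum_signUnitary {n : Type*} [Fintype n] [DecidableEq n] (c : Finset n) (i : n)
    (f : n → ℂ) : ∑ j, (signUnitary c).1 i j * f j = if i ∈ c then -f i else f i := by
  by_cases h : i ∈ c <;> simp [signUnitary, Matrix.diagonal_apply, h]

/-- The projection onto the reference state. -/
def refProj (r : X → ℂ) : Matrix X X ℂ := Matrix.vecMulVec r (star r)

lemma refProj_mul_self {r : X → ℂ} (hr : ∑ x, ‖r x‖ ^ 2 = 1) :
    refProj r * refProj r = refProj r := by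
  rw [refProj, Matrix.vecMulVec_mul_vecMulVec, star_dotProduct_self_eq, hr]
  simp

lemma refMatrix_eq (r : X → ℂ) :
    refMatrix r = (2 : ℂ) • (refProj r ⊗ₖ (1 : Matrix X X ℂ)) - 1 := by
  rw [eq_sub_iff_add_eq, refMatrix, ← Matrix.one_kronecker_one, ← Matrix.add_kronecker,
    sub_add_cancel, Matrix.smul_kronecker]
  rfl

lemma shiftMatrix_mulVec (f : X × X → ℂ) : (shiftMatrix X).mulVec f = fun v => f v.swap := by
  funext v
  rw [Matrix.mulVec, dotProduct, Finset.sum_eq_single v.swap]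
  · simp [shiftMatrix]
  · intro w _ hw
    have : v ≠ w.swap := fun h => hw (by rw [h, Prod.swap_swap])
    simp [shiftMatrix, this]
  · simp

lemma refMatrix_mulVec (r : X → ℂ) (f : X × X → ℂ) :
    (refMatrix r).mulVec f = (2 : ℂ) • (refProj r ⊗ₖ (1 : Matrix X X ℂ)).mulVec f - f := by
  rw [refMatrix_eq, Matrix.sub_mulVec, Matrix.smul_mulVec, Matrix.one_mulVec]

lemma shift_ref_shift_mulVec (r : X → ℂ) (f : X × X → ℂ) :
    (shiftMatrix X).mulVec ((refMatrix r).mulVec ((shiftMatrix X).mulVec f))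
      = (2 : ℂ) • ((1 : Matrix X X ℂ) ⊗ₖ refProj r).mulVec f - f := by
  rw [refMatrix_mulVec, shiftMatrix_mulVec, shiftMatrix_mulVec]
  funext ⟨a, b⟩
  simp only [Pi.sub_apply, Pi.smul_apply, Prod.swap_prod_mk, kronecker_one_mulVec,
    one_kronecker_mulVec]
  rfl

lemma shift_mulVec_memState (c : Finset (Memory K)) (ψ : Bool → L → X × X → ℂ) :
    ((Gate.shift c).toMatrix O M).mulVec (memState e ψ) = memState e fun b l =>
      if (b, e l) ∈ c then (shiftMatrix X).mulVec (ψ b l) else ψ b l :=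
  controlled_mulVec_memState e c _ ψ

lemma reflect_mulVec_memState (c : Finset (Memory K)) (ψ : Bool → L → X × X → ℂ) :
    ((Gate.reflect c).toMatrix O M).mulVec (memState e ψ) = memState e fun b l =>
      if (b, e l) ∈ c then (refMatrix O.ref).mulVec (ψ b l) else ψ b l :=
  controlled_mulVec_memState e c _ ψ

lemma signGate_mulVec (c : Finset (Bool × L)) (ψ : Bool → L → X × X → ℂ) :
    ((memGate e (signUnitary c)).toMatrix O M).mulVec (memState e ψ) = memState e fun b l =>
      if (b, l) ∈ c then -ψ b l else ψ b l := by
  rw [memGate_mulVec]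
  congr 1
  funext b l v
  rw [sum_signUnitary c (b, l) fun p => ψ p.1 p.2 v]
  split_ifs <;> rfl

/-- Reflections about the reference state of the second register, controlled on `R₃`. -/
def flagCircuit (c : Finset L) : List (Gate K) :=
  [hadamardGate e, .shift (labelSet e c),
    .reflect ((labelSet e c).filter fun m => m.1 = true), .shift (labelSet e c), hadamardGate e]

/-- Reflection about the reference state of both vertex registers, for the labels in `c`. -/
def zeroReflection (c : Finset L) : List (Gate K) :=
  flagCircuit e c ++ [.reflect ((labelSet e c).filter fun m => m.1 = false),
    memGate e (signUnitary (Finset.univ.filter fun p => p.1 = true ∧ p.2 ∈ c))] ++ flagCircuit e c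

/-- Phase kickback: between two Hadamard gates, a reflection controlled on `R₃` becomes a flip of
`R₃` on the complement of the reference state of the second register. The reflection is only given
on the first register, hence the shifts, which cancel where no reflection is made. -/
lemma flagCircuit_mulVec (c : Finset L) (ψ : Bool → L → X × X → ℂ) :
    (circuitMatrix O M (flagCircuit e c)).mulVec (memState e ψ)
      = memState e fun b l => if l ∈ c then
          ((1 : Matrix X X ℂ) ⊗ₖ refProj O.ref).mulVec (ψ b l)
            + (ψ (!b) l - ((1 : Matrix X X ℂ) ⊗ₖ refProj O.ref).mulVec (ψ (!b) l))
        else ψ b l := by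
  have hs : (((√2)⁻¹ : ℝ) : ℂ) * ((√2)⁻¹ : ℝ) = 1 / 2 := by
    rw [← Complex.ofReal_mul, ← mul_inv, Real.mul_self_sqrt two_pos.le]
    norm_num
  simp only [flagCircuit, circuitMatrix_cons_mulVec, circuitMatrix_nil_mulVec, hadamardGate_mulVec,
    shift_mulVec_memState, reflect_mulVec_memState]
  congr 1
  funext b l
  by_cases h : l ∈ c
  · have h1 : ∀ b : Bool, (b, e l) ∈ labelSet e c := fun b => by simp [labelSet, h]
    have hss : ∀ f : X × X → ℂ, (shiftMatrix X).mulVec ((shiftMatrix X).mulVec f) = f := fun f => by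
      rw [shiftMatrix_mulVec, shiftMatrix_mulVec]; simp
    simp only [Finset.mem_filter, h1, true_and, if_true, h, Bool.false_eq_true, if_false, hss,
      shift_ref_shift_mulVec, Matrix.mulVec_add, Matrix.mulVec_smul]
    funext v
    cases b
    all_goals
      simp only [Pi.add_apply, Pi.sub_apply, Pi.smul_apply, smul_eq_mul, if_true,
        Bool.false_eq_true, if_false, Bool.not_true, Bool.not_false]
      generalize ((1 : Matrix X X ℂ) ⊗ₖ refProj O.ref).mulVec (ψ false l) v = q0
      generalize ((1 : Matrix X X ℂ) ⊗ₖ refProj O.ref).mulVec (ψ true l) v = q1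
    · linear_combination (2 * q0 + 2 * (ψ true l v - q1)) * hs
    · linear_combination (2 * q1 + 2 * (ψ false l v - q0)) * hs
  · have h1 : ∀ b : Bool, (b, e l) ∉ labelSet e c := fun b => by simp [labelSet, h]
    simp only [Finset.mem_filter, h1, false_and, h, if_false]
    funext v
    cases b <;> simp only [Pi.add_apply, Pi.smul_apply, smul_eq_mul, if_true,
      Bool.false_eq_true, if_false]
    · linear_combination (2 * ψ false l v) * hs
    · linear_combination (2 * ψ true l v) * hs

/-- Where `R₃` is off, the second register is in the reference state and reflecting the first one is
correct; where `R₃` is on, the sign `-1` is correct. The second `flagCircuit` undoes the first one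
and resets `R₃`. -/
lemma zeroReflection_mulVec (c : Finset L) (η : L → X × X → ℂ) :
    (circuitMatrix O M (zeroReflection e c)).mulVec (labState e η)
      = labState e fun l => if l ∈ c then
          (2 : ℂ) • (refProj O.ref ⊗ₖ refProj O.ref).mulVec (η l) - η l else η l := by
  have h12 : (refProj O.ref ⊗ₖ (1 : Matrix X X ℂ)) * ((1 : Matrix X X ℂ) ⊗ₖ refProj O.ref)
      = refProj O.ref ⊗ₖ refProj O.ref := by rw [← Matrix.mul_kronecker_mul]; simp
  have h2 : ((1 : Matrix X X ℂ) ⊗ₖ refProj O.ref) * (refProj O.ref ⊗ₖ refProj O.ref)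
      = refProj O.ref ⊗ₖ refProj O.ref := by
    rw [← Matrix.mul_kronecker_mul, refProj_mul_self O.ref_unit, one_mul]
  have h22 : ((1 : Matrix X X ℂ) ⊗ₖ refProj O.ref) * ((1 : Matrix X X ℂ) ⊗ₖ refProj O.ref)
      = (1 : Matrix X X ℂ) ⊗ₖ refProj O.ref := by
    rw [← Matrix.mul_kronecker_mul, refProj_mul_self O.ref_unit, one_mul]
  have hR : refMatrix O.ref * ((1 : Matrix X X ℂ) ⊗ₖ refProj O.ref)
      = (2 : ℂ) • (refProj O.ref ⊗ₖ refProj O.ref) - (1 : Matrix X X ℂ) ⊗ₖ refProj O.ref := by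
    rw [refMatrix_eq, sub_mul, smul_mul_assoc, h12, one_mul]
  simp only [zeroReflection, circuitMatrix_append_mulVec, labState, flagCircuit_mulVec,
    circuitMatrix_cons_mulVec, circuitMatrix_nil_mulVec, signGate_mulVec, reflect_mulVec_memState]
  congr 1
  funext b l
  by_cases h : l ∈ c
  · have h1 : ∀ b : Bool, (b, e l) ∈ labelSet e c := fun b => by simp [labelSet, h]
    cases b <;> simp [h, h1, Matrix.mulVec_sub, Matrix.mulVec_mulVec,
      Matrix.sub_mulVec, Matrix.smul_mulVec, hR, h22]
    all_goals
      rw [Matrix.mulVec_smul, Matrix.mulVec_mulVec, h2]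
    rw [sub_self]
  · have h1 : ∀ b : Bool, (b, e l) ∉ labelSet e c := fun b => by simp [labelSet, h]
    cases b <;> simp [h, h1]

end Blocks

/-! ### The quantum walk with a coin -/

section WalkOperator

variable {X : Type*} [Fintype X] [DecidableEq X]

/-- The inner product of two states of the coin and the vertex registers. -/
def coinInner (w w' : Bool → X × X → ℂ) : ℂ := ∑ b, star (w b) ⬝ᵥ w' b

/-- A matrix on the coin, applied if the vertex in the second register is marked. -/
def coinRotate (M : Finset X) (R : Matrix Bool Bool ℂ) (w : Bool → X × X → ℂ) :
    Bool → X × X → ℂ := fun b v => if v.2 ∈ M then ∑ b', R b b' * w b' v else w b v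

/-- A matrix on the vertex registers, applied if the coin is off. -/
def coinOff (A : Matrix (X × X) (X × X) ℂ) (w : Bool → X × X → ℂ) : Bool → X × X → ℂ :=
  fun b => if b then w b else A.mulVec (w b)

variable (M : Finset X) (R : Matrix Bool Bool ℂ) (A : Matrix (X × X) (X × X) ℂ)

lemma star_dotProduct_conjTranspose_mulVec {n : Type*} [Fintype n] (B : Matrix n n ℂ)
    (f g : n → ℂ) : star f ⬝ᵥ B.conjTranspose.mulVec g = star (B.mulVec f) ⬝ᵥ g := by
  rw [Matrix.star_mulVec, Matrix.dotProduct_mulVec]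

lemma coinInner_coinOff (w w' : Bool → X × X → ℂ) :
    coinInner w (coinOff A.conjTranspose w') = coinInner (coinOff A w) w' := by
  simp [coinInner, coinOff, star_dotProduct_conjTranspose_mulVec]

lemma coinOff_coinOff {A B : Matrix (X × X) (X × X) ℂ} (h : A * B = 1) (w : Bool → X × X → ℂ) :
    coinOff A (coinOff B w) = w := by
  funext b
  cases b <;> simp [coinOff, Matrix.mulVec_mulVec, h]

lemma coinInner_coinRotate (w w' : Bool → X × X → ℂ) :
    coinInner w (coinRotate M R.conjTranspose w') = coinInner (coinRotate M R w) w' := by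
  simp only [coinInner, dotProduct, Fintype.sum_bool, ← Finset.sum_add_distrib, Pi.star_apply]
  refine Finset.sum_congr rfl fun v _ => ?_
  by_cases hv : v.2 ∈ M
  · simp only [coinRotate, hv, if_true, Fintype.sum_bool, Matrix.conjTranspose_apply, star_add,
      star_mul']
    ring
  · simp [coinRotate, hv]

lemma coinRotate_coinRotate {R S : Matrix Bool Bool ℂ} (h : R * S = 1) (w : Bool → X × X → ℂ) :
    coinRotate M R (coinRotate M S w) = w := by
  funext b v
  by_cases hv : v.2 ∈ M
  · have e := congrFun (congrArg (fun N => Matrix.mulVec N fun b => w b v) h) b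
    simp only [← Matrix.mulVec_mulVec, Matrix.one_mulVec] at e
    simpa [coinRotate, hv, Matrix.mulVec, dotProduct] using e
  · simp [coinRotate, hv]

/-- The state with coin off and first register in the reference state `r`. -/
def coinEmbed (r : X → ℂ) (f : X → ℂ) : Bool → X × X → ℂ :=
  fun b v => if b then 0 else r v.1 * f v.2

/-- The adjoint of `coinEmbed r`. -/
def coinProject (r : X → ℂ) (w : Bool → X × X → ℂ) : X → ℂ :=
  fun x => ∑ a, star (r a) * w false (a, x)

/-- The reflection about the range of `coinEmbed r`. -/
def coinReflect (r : X → ℂ) (w : Bool → X × X → ℂ) : Bool → X × X → ℂ :=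
  fun b => if b then -w b else (refMatrix r).mulVec (w b)

lemma coinReflect_eq (r : X → ℂ) (w : Bool → X × X → ℂ) :
    coinReflect r w = (2 : ℂ) • coinEmbed r (coinProject r w) - w := by
  funext b ⟨a, x⟩
  cases b
  · rw [coinReflect, refMatrix_mulVec]
    simp [coinEmbed, coinProject, kronecker_one_mulVec, refProj, Matrix.vecMulVec_apply,
      Finset.mul_sum, mul_assoc]
  · simp [coinReflect, coinEmbed]

lemma coinInner_coinEmbed (r f : X → ℂ) (w : Bool → X × X → ℂ) :
    coinInner (coinEmbed r f) w = star f ⬝ᵥ coinProject r w := by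
  simp only [coinInner, coinEmbed, coinProject, dotProduct, Fintype.sum_bool, Pi.star_apply,
    Fintype.sum_prod_type, if_true, star_zero, zero_mul, Finset.sum_const_zero, zero_add,
    Bool.false_eq_true, if_false, star_mul', Finset.mul_sum]
  rw [Finset.sum_comm]
  exact Finset.sum_congr rfl fun x _ => Finset.sum_congr rfl fun a _ => by ring

lemma coinProject_coinEmbed {r : X → ℂ} (hr : ∑ x, ‖r x‖ ^ 2 = 1) (f : X → ℂ) :
    coinProject r (coinEmbed r f) = f := by
  funext x
  have h := star_dotProduct_self_eq r
  rw [hr, Complex.ofReal_one] at h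
  simp only [coinProject, coinEmbed, Bool.false_eq_true, if_false, ← mul_assoc]
  rw [← Finset.sum_mul]
  exact (congrArg (· * f x) h).trans (one_mul _)

lemma coinProject_smul (r : X → ℂ) (c : ℂ) (w : Bool → X × X → ℂ) :
    coinProject r (c • w) = c • coinProject r w := by
  funext x; simp [coinProject, Finset.mul_sum, mul_left_comm]

lemma coinProject_sub (r : X → ℂ) (w w' : Bool → X × X → ℂ) :
    coinProject r (w - w') = coinProject r w - coinProject r w' := by
  funext x; simp [coinProject, mul_sub, Finset.sum_sub_distrib]

/-- The operator `E⁻¹ ∘ Shift ∘ E`, where `E` is a coin rotation followed by `V`. -/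
def coinSwap (V : Matrix (X × X) (X × X) ℂ) (w : Bool → X × X → ℂ) : Bool → X × X → ℂ :=
  coinRotate M R.conjTranspose (coinOff V.conjTranspose (coinOff (shiftMatrix X)
    (coinOff V (coinRotate M R w))))

/-- One step of the quantum walk. -/
def coinStep (r : X → ℂ) (V : Matrix (X × X) (X × X) ℂ) (w : Bool → X × X → ℂ) :
    Bool → X × X → ℂ := coinReflect r (coinSwap M R V w)

section Unitary

variable {M R} {V : Matrix (X × X) (X × X) ℂ} {r : X → ℂ}

lemma coinSwap_add (w w' : Bool → X × X → ℂ) :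
    coinSwap M R V (w + w') = coinSwap M R V w + coinSwap M R V w' := by
  have h1 : ∀ (A : Matrix (X × X) (X × X) ℂ) (w w' : Bool → X × X → ℂ),
      coinOff A (w + w') = coinOff A w + coinOff A w' := fun A w w' => by
    funext b; cases b <;> simp [coinOff, Matrix.mulVec_add]
  have h2 : ∀ (R : Matrix Bool Bool ℂ) (w w' : Bool → X × X → ℂ),
      coinRotate M R (w + w') = coinRotate M R w + coinRotate M R w' := fun R w w' => by
    funext b v
    by_cases hv : v.2 ∈ M <;> simp [coinRotate, hv]
    ring
  simp only [coinSwap, h1, h2]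

lemma coinSwap_smul (c : ℂ) (w : Bool → X × X → ℂ) :
    coinSwap M R V (c • w) = c • coinSwap M R V w := by
  have h1 : ∀ (A : Matrix (X × X) (X × X) ℂ) (w : Bool → X × X → ℂ),
      coinOff A (c • w) = c • coinOff A w := fun A w => by
    funext b; cases b <;> simp [coinOff, Matrix.mulVec_smul]
  have h2 : ∀ (R : Matrix Bool Bool ℂ) (w : Bool → X × X → ℂ),
      coinRotate M R (c • w) = c • coinRotate M R w := fun R w => by
    funext b v
    by_cases hv : v.2 ∈ M <;> simp [coinRotate, hv]
    ring
  simp only [coinSwap, h1, h2]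

variable (hR : R ∈ Matrix.unitaryGroup Bool ℂ) (hV : V ∈ Matrix.unitaryGroup (X × X) ℂ)
  (hr : ∑ x, ‖r x‖ ^ 2 = 1)
include hR hV

/-- A conjugate of an involution is an involution. The Chebyshev recurrence for the powers of the
walk rests on this. -/
lemma coinSwap_coinSwap (w : Bool → X × X → ℂ) : coinSwap M R V (coinSwap M R V w) = w := by
  have hR1 := Matrix.mem_unitaryGroup_iff.1 hR
  have hR2 := Matrix.mem_unitaryGroup_iff'.1 hR
  have hV1 := Matrix.mem_unitaryGroup_iff.1 hV
  have hV2 := Matrix.mem_unitaryGroup_iff'.1 hV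
  have hS := Matrix.mem_unitaryGroup_iff.1 (shiftMatrix_conj_mem (X := X)).2
  rw [Matrix.star_eq_conjTranspose] at hR1 hR2 hV1 hV2 hS
  rw [shiftMatrix_conj_mem.1] at hS
  simp only [coinSwap]
  rw [coinRotate_coinRotate M hR1, coinOff_coinOff hV1, coinOff_coinOff hS, coinOff_coinOff hV2,
    coinRotate_coinRotate M hR2]

lemma coinInner_coinSwap (w w' : Bool → X × X → ℂ) :
    coinInner w (coinSwap M R V w') = coinInner (coinSwap M R V w) w' := by
  have hs : ∀ w w' : Bool → X × X → ℂ, coinInner w (coinOff (shiftMatrix X) w')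
      = coinInner (coinOff (shiftMatrix X) w) w' := fun w w' => by
    rw [← coinInner_coinOff, shiftMatrix_conj_mem.1]
  have hRR := coinInner_coinRotate M R.conjTranspose
  have hVV := coinInner_coinOff V.conjTranspose
  rw [Matrix.conjTranspose_conjTranspose] at hRR hVV
  rw [coinSwap, coinInner_coinRotate, coinInner_coinOff, hs, hVV, hRR, coinSwap]

include hr

lemma coinInner_coinStep (w : Bool → X × X → ℂ) :
    coinInner (coinStep M R r V w) (coinStep M R r V w) = coinInner w w := by
  have hrefl : ∀ w, coinInner (coinReflect r w) (coinReflect r w) = coinInner w w := fun w => by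
    have hadd : ∀ a b c : Bool → X × X → ℂ, coinInner a (b - c) = coinInner a b - coinInner a c :=
      fun a b c => by simp [coinInner, dotProduct_sub]
    have hsub : ∀ a b c : Bool → X × X → ℂ, coinInner (b - c) a = coinInner b a - coinInner c a :=
      fun a b c => by simp [coinInner, sub_dotProduct]
    have hsm : ∀ (a b : Bool → X × X → ℂ), coinInner a ((2 : ℂ) • b) = 2 * coinInner a b :=
      fun a b => by simp [coinInner, dotProduct_smul, mul_add]
    have hsm' : ∀ (a b : Bool → X × X → ℂ), coinInner ((2 : ℂ) • a) b = 2 * coinInner a b :=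
      fun a b => by simp [coinInner, smul_dotProduct, mul_add]
    have hconj : ∀ a b : Bool → X × X → ℂ, coinInner a b = star (coinInner b a) := fun a b => by
      rw [coinInner, coinInner, star_sum]
      exact Finset.sum_congr rfl fun i _ => Matrix.star_dotProduct _ _
    have e1 : coinInner (coinEmbed r (coinProject r w)) w
        = star (coinProject r w) ⬝ᵥ coinProject r w := coinInner_coinEmbed r _ w
    have e2 : coinInner w (coinEmbed r (coinProject r w))
        = star (coinProject r w) ⬝ᵥ coinProject r w := by
      rw [hconj, e1, ← Matrix.star_dotProduct]
    have e3 : coinInner (coinEmbed r (coinProject r w)) (coinEmbed r (coinProject r w))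
        = star (coinProject r w) ⬝ᵥ coinProject r w := by
      rw [coinInner_coinEmbed, coinProject_coinEmbed hr]
    rw [coinReflect_eq, hadd, hsub, hsub, hsm, hsm', hsm, hsm', e1, e2, e3]
    ring
  rw [coinStep, hrefl, coinInner_coinSwap hR hV, coinSwap_coinSwap hR hV]

end Unitary

end WalkOperator

/-! ### Compression of the quantum walk to Chebyshev polynomials of the discriminant -/

section Amplitudes

variable {X : Type*} [Fintype X] [DecidableEq X] {P : Matrix.rowStochastic ℝ X}
  {π : stdSimplex ℝ X} (O : WalkImplementation P π) (M : Finset X)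

/-- The rotation of the coin at marked vertices. -/
def coinMatrix (ρ : ℝ) : Matrix Bool Bool ℂ := Matrix.of fun b b' =>
  if b = b' then ((√ρ⁻¹ : ℝ) : ℂ)
  else if b then ((√(1 - ρ⁻¹) : ℝ) : ℂ) else -((√(1 - ρ⁻¹) : ℝ) : ℂ)

lemma coinMatrix_mem {ρ : ℝ} (hρ : 1 ≤ ρ) : coinMatrix ρ ∈ Matrix.unitaryGroup Bool ℂ := by
  have h1 : 0 ≤ ρ⁻¹ := by positivity
  have h2 : 0 ≤ 1 - ρ⁻¹ := sub_nonneg.2 (inv_le_one_of_one_le₀ hρ)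
  have h : ((√ρ⁻¹ : ℝ) : ℂ) * (√ρ⁻¹ : ℝ) + ((√(1 - ρ⁻¹) : ℝ) : ℂ) * (√(1 - ρ⁻¹) : ℝ) = 1 := by
    rw [← Complex.ofReal_mul, ← Complex.ofReal_mul, Real.mul_self_sqrt h1, Real.mul_self_sqrt h2,
      ← Complex.ofReal_add]
    norm_num
  rw [Matrix.mem_unitaryGroup_iff, Matrix.star_eq_conjTranspose]
  ext i j
  cases i <;> cases j <;>
    simp only [coinMatrix, Matrix.mul_apply, Matrix.conjTranspose_apply, Matrix.of_apply,
      Fintype.sum_bool, Matrix.one_apply, if_true, Bool.false_eq_true, if_false, reduceCtorEq,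
      map_neg, RCLike.star_def, Complex.conj_ofReal]
  · linear_combination h
  · ring
  · ring
  · linear_combination h

/-- The weights of the transitions after the coin rotation. -/
def coinWeight (ρ : ℝ) (x : X) : ℝ := if x ∈ M then √ρ⁻¹ else 1

lemma walk_mulVec (f : X → ℂ) :
    O.V.1.mulVec (fun v => O.ref v.1 * f v.2) = fun v => ((√(P.1 v.2 v.1) : ℝ) : ℂ) * f v.2 := by
  have e : (fun v : X × X => O.ref v.1 * f v.2)
      = ∑ x, f x • fun v : X × X => if v.2 = x then O.ref v.1 else 0 := by
    funext v; simp [Finset.sum_apply, mul_comm]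
  rw [e, Matrix.mulVec_sum]
  simp_rw [Matrix.mulVec_smul, O.V_apply]
  funext v
  simp only [Finset.sum_apply, Pi.smul_apply, smul_eq_mul, mul_ite, mul_zero, Finset.sum_ite_eq,
    Finset.mem_univ, if_true, mul_comm]

lemma coinOff_coinRotate_coinEmbed (ρ : ℝ) (f : X → ℂ) :
    coinOff O.V.1 (coinRotate M (coinMatrix ρ) (coinEmbed O.ref f)) = fun b v =>
      if b then O.ref v.1 * (if v.2 ∈ M then ((√(1 - ρ⁻¹) : ℝ) : ℂ) * f v.2 else 0)
      else ((√(P.1 v.2 v.1) : ℝ) : ℂ) * ((coinWeight M ρ v.2 : ℝ) * f v.2) := by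
  funext b
  cases b
  · have e : coinRotate M (coinMatrix ρ) (coinEmbed O.ref f) false
        = fun v => O.ref v.1 * ((coinWeight M ρ v.2 : ℝ) * f v.2) := by
      funext v
      by_cases hv : v.2 ∈ M <;> simp [coinRotate, coinMatrix, coinEmbed, coinWeight, hv]
      ring
    simp only [coinOff, Bool.false_eq_true, if_false]
    rw [e]
    exact walk_mulVec O fun x => (coinWeight M ρ x : ℝ) * f x
  · funext v
    by_cases hv : v.2 ∈ M <;> simp [coinOff, coinRotate, coinMatrix, coinEmbed, hv]
    ring

lemma discriminant_eq {ρ : ℝ} (hρ : 1 ≤ ρ) (x y : X) :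
    discriminant P.1 M ρ x y = √(P.1 x y) * coinWeight M ρ x * (√(P.1 y x) * coinWeight M ρ y)
      + if x = y ∧ x ∈ M then 1 - ρ⁻¹ else 0 := by
  have h1 : 0 ≤ ρ⁻¹ := by positivity
  have hw : ∀ x, coinWeight M ρ x * coinWeight M ρ x = if x ∈ M then ρ⁻¹ else 1 := fun x => by
    unfold coinWeight; split_ifs
    · exact Real.mul_self_sqrt h1
    · norm_num
  by_cases hxy : x = y
  · subst hxy
    have h2 := Real.mul_self_sqrt (P.2.1 x x)
    rw [discriminant, Real.sqrt_mul_self (slowed_nonneg P.2.1 hρ x x)]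
    have h3 := hw x
    by_cases hx : x ∈ M
    · simp only [slowed, hx, if_true, true_and] at h3 ⊢
      linear_combination -(coinWeight M ρ x * coinWeight M ρ x) * h2 - P.1 x x * h3
    · simp only [slowed, hx, if_false, and_false] at h3 ⊢
      linear_combination -(coinWeight M ρ x * coinWeight M ρ x) * h2 - P.1 x x * h3
  · have hyx : y ≠ x := fun h => hxy h.symm
    have hs : ∀ a b : X, a ≠ b → slowed P.1 M ρ a b
        = P.1 a b * (coinWeight M ρ a * coinWeight M ρ a) := fun a b hab => by
      rw [hw]
      by_cases ha : a ∈ M <;> simp [slowed, ha, hab, mul_comm]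
    have hwn : ∀ x, 0 ≤ coinWeight M ρ x := fun x => by
      unfold coinWeight; split_ifs <;> positivity
    rw [discriminant, hs x y hxy, hs y x hyx, Real.sqrt_mul (mul_nonneg (P.2.1 x y)
      (mul_self_nonneg _)), Real.sqrt_mul (P.2.1 x y), Real.sqrt_mul (P.2.1 y x),
      Real.sqrt_mul_self (hwn x), Real.sqrt_mul_self (hwn y)]
    simp [hxy]

/-- Moving the adjoints to the left makes each entry an overlap of two states after rotation and
`V`. With the coin off, the shift matches the transition from `x` to `y` with the reverse one,
giving `√(P x y) √(P y x)` times the coin weights. With the coin on nothing moves, which gives the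
holding probability `1 - ρ⁻¹` at `x = y ∈ M`. -/
lemma coinProject_coinSwap {ρ : ℝ} (hρ : 1 ≤ ρ) (f : X → ℂ) (x : X) :
    coinProject O.ref (coinSwap M (coinMatrix ρ) O.V.1 (coinEmbed O.ref f)) x
      = ∑ y, (discriminant P.1 M ρ x y : ℂ) * f y := by
  have h2 : 0 ≤ 1 - ρ⁻¹ := sub_nonneg.2 (inv_le_one_of_one_le₀ hρ)
  have hss : ((√(1 - ρ⁻¹) : ℝ) : ℂ) * (√(1 - ρ⁻¹) : ℝ) = (1 - ρ⁻¹ : ℝ) := by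
    rw [← Complex.ofReal_mul, Real.mul_self_sqrt h2]
  have hrr : ∑ a, star (O.ref a) * O.ref a = 1 := by
    have h := star_dotProduct_self_eq O.ref
    rw [O.ref_unit, Complex.ofReal_one] at h
    exact h
  have e1 : coinProject O.ref (coinSwap M (coinMatrix ρ) O.V.1 (coinEmbed O.ref f)) x
      = coinInner (coinEmbed O.ref (Pi.single x 1))
        (coinSwap M (coinMatrix ρ) O.V.1 (coinEmbed O.ref f)) := by
    rw [coinInner_coinEmbed]
    simp [dotProduct, Pi.single_apply, apply_ite]
  rw [e1, coinSwap, coinInner_coinRotate, coinInner_coinOff, coinOff_coinRotate_coinEmbed,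
    coinOff_coinRotate_coinEmbed]
  simp only [coinInner, Fintype.sum_bool, coinOff, if_true, Bool.false_eq_true, if_false,
    shiftMatrix_mulVec, dotProduct, Pi.star_apply, Fintype.sum_prod_type, Prod.swap_prod_mk]
  have t1 : ∀ a : X, ∑ y, star (O.ref a * (if y ∈ M then ((√(1 - ρ⁻¹) : ℝ) : ℂ)
        * (Pi.single x 1 : X → ℂ) y else 0))
      * (O.ref a * (if y ∈ M then ((√(1 - ρ⁻¹) : ℝ) : ℂ) * f y else 0))
      = (star (O.ref a) * O.ref a) * (if x ∈ M then ((1 - ρ⁻¹ : ℝ) : ℂ) * f x else 0) := fun a => by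
    rw [Finset.sum_eq_single x]
    · by_cases hx : x ∈ M
      · simp only [hx, if_true, Pi.single_eq_same, mul_one, star_mul', RCLike.star_def,
          Complex.conj_ofReal, ← hss]
        ring
      · simp [hx]
    · intro y _ hy
      simp [hy]
    · simp
  have t2 : ∀ y : X, ∑ z, star (((√(P.1 z y) : ℝ) : ℂ) * ((coinWeight M ρ z : ℝ)
        * (Pi.single x 1 : X → ℂ) z))
      * (((√(P.1 y z) : ℝ) : ℂ) * ((coinWeight M ρ y : ℝ) * f y))
      = ((√(P.1 x y) * coinWeight M ρ x * (√(P.1 y x) * coinWeight M ρ y) : ℝ) : ℂ) * f y :=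
    fun y => by
    rw [Finset.sum_eq_single x]
    · simp only [Pi.single_eq_same, mul_one, star_mul', RCLike.star_def, Complex.conj_ofReal]
      push_cast
      ring
    · intro z _ hz
      simp [hz]
    · simp
  simp_rw [t1, t2, discriminant_eq (P := P) M hρ]
  rw [← Finset.sum_mul, hrr, one_mul]
  push_cast
  simp only [add_mul, Finset.sum_add_distrib]
  rw [add_comm]
  congr 1
  by_cases hx : x ∈ M <;> simp [hx, apply_ite Complex.ofReal, ite_mul]

/-- The overlap of the quantum walk with its initial subspace is given by the Chebyshev polynomials
of the discriminant. -/
lemma coinProject_iterate {ρ : ℝ} (hρ : 1 ≤ ρ) (u : X → ℝ) (k : ℕ) :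
    coinProject O.ref ((coinStep M (coinMatrix ρ) O.ref O.V.1)^[k]
        (coinEmbed O.ref fun x => (u x : ℂ)))
      = fun x => (chebVec (discriminant P.1 M ρ) u k x : ℂ) := by
  have hR := coinMatrix_mem hρ
  have hV := O.V.2
  set W := coinStep M (coinMatrix ρ) O.ref O.V.1 with hW
  set B := coinSwap M (coinMatrix ρ) O.V.1 with hB
  have hp : ∀ w, coinProject O.ref (coinReflect O.ref w) = coinProject O.ref w := fun w => by
    rw [coinReflect_eq, coinProject_sub, coinProject_smul, coinProject_coinEmbed O.ref_unit]
    module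
  have hD : ∀ g : X → ℝ, coinProject O.ref (B (coinEmbed O.ref fun x => (g x : ℂ)))
      = fun x => (((discriminant P.1 M ρ).mulVec g x : ℝ) : ℂ) := fun g => by
    funext x
    rw [hB, coinProject_coinSwap O M hρ]
    simp [Matrix.mulVec, dotProduct]
  set w0 := coinEmbed O.ref fun x => (u x : ℂ) with hw0
  -- Let `Π` be the projection onto the embedded states. Then `W^[k+1] w0 = 2 Π W^[k+1] w0 - B
  -- (W^[k] w0)`; applying the involution `B` and projecting gives the three-term recurrence. Two
  -- consecutive values are carried through the induction.
  have key : ∀ k, coinProject O.ref (W^[k] w0)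
        = (fun x => (chebVec (discriminant P.1 M ρ) u k x : ℂ))
      ∧ coinProject O.ref (W^[k + 1] w0)
        = fun x => (chebVec (discriminant P.1 M ρ) u (k + 1) x : ℂ) := by
    intro k
    induction k with
    | zero =>
      refine ⟨by simp [hw0, coinProject_coinEmbed O.ref_unit, chebVec], ?_⟩
      rw [Function.iterate_succ_apply', Function.iterate_zero_apply, hW, coinStep, hp]
      exact hD u
    | succ k ih =>
      refine ⟨ih.2, ?_⟩
      have h1 : coinProject O.ref (W^[k + 1] w0) = coinProject O.ref (B (W^[k] w0)) := by
        rw [Function.iterate_succ_apply', hW, coinStep, hp]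
      have h2 : coinProject O.ref (W^[k + 1 + 1] w0)
          = (2 : ℂ) • coinProject O.ref (B (coinEmbed O.ref (coinProject O.ref (W^[k + 1] w0))))
            - coinProject O.ref (W^[k] w0) := by
        have e1 : W^[k + 1 + 1] w0 = coinReflect O.ref (B (W^[k + 1] w0)) := by
          rw [Function.iterate_succ_apply' W (k + 1)]; rfl
        have e2 : W^[k + 1] w0 = (2 : ℂ) • coinEmbed O.ref (coinProject O.ref (W^[k + 1] w0))
            - B (W^[k] w0) := by
          rw [h1, ← coinReflect_eq, Function.iterate_succ_apply']; rfl
        have e3 : B (W^[k + 1] w0)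
            = (2 : ℂ) • B (coinEmbed O.ref (coinProject O.ref (W^[k + 1] w0))) - W^[k] w0 := by
          conv_lhs => rw [e2]
          rw [sub_eq_add_neg, ← neg_one_smul ℂ (B _), hB, coinSwap_add, coinSwap_smul,
            coinSwap_smul, coinSwap_coinSwap hR hV]
          module
        rw [e1, hp, e3, coinProject_sub, coinProject_smul]
      rw [h2, ih.2, hD, ih.1]
      funext x
      rw [chebVec_add_two]
      push_cast
      simp
  exact (key k).1

lemma coinInner_self (w : Bool → X × X → ℂ) :
    coinInner w w = ((∑ b, ∑ v, ‖w b v‖ ^ 2 : ℝ) : ℂ) := by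
  simp only [coinInner, star_dotProduct_self_eq]
  push_cast
  rfl

/-- Cauchy-Schwarz in the first register. Projecting can only lose marked weight, so the algorithm
may measure the walk state without ever performing the projection. -/
lemma sum_coinProject_le {r : X → ℂ} (hr : ∑ x, ‖r x‖ ^ 2 = 1) (w : Bool → X × X → ℂ) :
    ∑ x ∈ M, ‖coinProject r w x‖ ^ 2 ≤ ∑ b, ∑ a, ∑ x ∈ M, ‖w b (a, x)‖ ^ 2 := by
  have h : ∀ x, ‖coinProject r w x‖ ^ 2 ≤ ∑ a, ‖w false (a, x)‖ ^ 2 := fun x => by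
    have h1 : ‖coinProject r w x‖ ≤ ∑ a, ‖r a‖ * ‖w false (a, x)‖ := by
      refine (norm_sum_le _ _).trans_eq (Finset.sum_congr rfl fun a _ => ?_)
      rw [norm_mul, norm_star]
    calc ‖coinProject r w x‖ ^ 2 ≤ (∑ a, ‖r a‖ * ‖w false (a, x)‖) ^ 2 :=
          pow_le_pow_left₀ (norm_nonneg _) h1 2
      _ ≤ (∑ a, ‖r a‖ ^ 2) * ∑ a, ‖w false (a, x)‖ ^ 2 :=
          Finset.sum_mul_sq_le_sq_mul_sq _ _ _
      _ = _ := by rw [hr, one_mul]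
  rw [Fintype.sum_bool]
  refine le_add_of_nonneg_of_le (Finset.sum_nonneg fun a _ => Finset.sum_nonneg fun x _ =>
    sq_nonneg _) ((Finset.sum_le_sum fun x _ => h x).trans_eq Finset.sum_comm)

lemma coinInner_iterate {ρ : ℝ} (hρ : 1 ≤ ρ) (k : ℕ) (w : Bool → X × X → ℂ) :
    coinInner ((coinStep M (coinMatrix ρ) O.ref O.V.1)^[k] w)
      ((coinStep M (coinMatrix ρ) O.ref O.V.1)^[k] w) = coinInner w w := by
  induction k with
  | zero => rfl
  | succ k ih =>
    rw [Function.iterate_succ_apply', coinInner_coinStep (coinMatrix_mem hρ) O.V.2 O.ref_unit, ih]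

/-- The quantum walk started from the stationary superposition. -/
def walkState (ρ : ℝ) (k : ℕ) : Bool → X × X → ℂ :=
  (coinStep M (coinMatrix ρ) O.ref O.V.1)^[k] (coinEmbed O.ref fun x => ((√(π.1 x) : ℝ) : ℂ))

lemma sum_walkState {ρ : ℝ} (hρ : 1 ≤ ρ) (k : ℕ) :
    ∑ b, ∑ v, ‖walkState O M ρ k b v‖ ^ 2 = 1 := by
  have h := coinInner_iterate O M hρ k (coinEmbed O.ref fun x => ((√(π.1 x) : ℝ) : ℂ))
  rw [coinInner_self, coinInner_coinEmbed, coinProject_coinEmbed O.ref_unit,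
    star_dotProduct_self_eq] at h
  have h' := Complex.ofReal_injective h
  rw [walkState, h', ← π.2.2]
  refine Finset.sum_congr rfl fun x _ => ?_
  rw [Complex.norm_real, Real.norm_eq_abs, sq_abs, Real.sq_sqrt (π.2.1 x)]

lemma sum_chebVec_sq_le {ρ : ℝ} (hρ : 1 ≤ ρ) (k : ℕ) :
    ∑ x ∈ M, chebVec (discriminant P.1 M ρ) (fun x => √(π.1 x)) k x ^ 2
      ≤ ∑ b, ∑ a, ∑ x ∈ M, ‖walkState O M ρ k b (a, x)‖ ^ 2 := by
  refine le_trans (le_of_eq ?_) (sum_coinProject_le M O.ref_unit _)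
  rw [walkState, coinProject_iterate O M hρ]
  exact Finset.sum_congr rfl fun x _ => by rw [Complex.norm_real, Real.norm_eq_abs, sq_abs]

/-- Unitarity of the walk takes the place of a bound on the spectrum of the discriminant; this is
the only role of `O`. -/
lemma sum_chebVec_sq_le_one {ρ : ℝ} (hρ : 1 ≤ ρ) (k : ℕ) (O : WalkImplementation P π) :
    ∑ x ∈ M, chebVec (discriminant P.1 M ρ) (fun x => √(π.1 x)) k x ^ 2 ≤ 1 := by
  refine (sum_chebVec_sq_le O M hρ k).trans ?_
  rw [← sum_walkState O M hρ k]
  refine Finset.sum_le_sum fun b _ => ?_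
  rw [Fintype.sum_prod_type]
  exact Finset.sum_le_sum fun a _ => Finset.sum_le_sum_of_subset_of_nonneg (Finset.subset_univ _)
    fun _ _ _ => sq_nonneg _

end Amplitudes

/-! ### Circuits for walks whose length and slowdown depend on the label -/

section StepCircuit

variable {X : Type*} [Fintype X] [DecidableEq X] {K : ℕ} {N : Type*} [Fintype N] [DecidableEq N]
  (e : N × Bool ≃ Fin (K + 1)) {P : Matrix.rowStochastic ℝ X} {π : stdSimplex ℝ X}
  (O : WalkImplementation P π) (M : Finset X)

/-- A family of coin matrices, as a block diagonal matrix. -/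
def coinBlocks (R : N → Matrix Bool Bool ℂ) : Matrix (N × Bool) (N × Bool) ℂ :=
  Matrix.of fun l l' => if l.1 = l'.1 then R l.1 l.2 l'.2 else 0

lemma sum_coinBlocks (R : N → Matrix Bool Bool ℂ) (l : N × Bool) (f : N × Bool → ℂ) :
    ∑ l', coinBlocks R l l' * f l' = ∑ b, R l.1 l.2 b * f (l.1, b) := by
  rw [Fintype.sum_prod_type, Finset.sum_eq_single l.1]
  · simp [coinBlocks]
  · intro n _ hn
    simp [coinBlocks, Ne.symm hn]
  · simp

lemma coinBlocks_mem {R : N → Matrix Bool Bool ℂ} (hR : ∀ n, R n ∈ Matrix.unitaryGroup Bool ℂ) :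
    coinBlocks R ∈ Matrix.unitaryGroup (N × Bool) ℂ := by
  rw [Matrix.mem_unitaryGroup_iff, Matrix.star_eq_conjTranspose]
  ext ⟨n, b⟩ ⟨n', b'⟩
  rw [Matrix.mul_apply, sum_coinBlocks R (n, b) fun l => (coinBlocks R).conjTranspose l (n', b')]
  by_cases h : n' = n
  · subst h
    have h1 := congrFun (congrFun (Matrix.mem_unitaryGroup_iff.1 (hR n')) b) b'
    rw [Matrix.mul_apply] at h1
    simp only [Matrix.conjTranspose_apply, coinBlocks, Matrix.of_apply, if_true]
    refine Eq.trans h1 ?_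
    simp [Matrix.one_apply]
  · simp [coinBlocks, h, Ne.symm h]

/-- The family `R` on the labels in `s`. -/
def coinOn (s : Finset N) (R : N → Matrix.unitaryGroup Bool ℂ) :
    Matrix.unitaryGroup (N × Bool) ℂ :=
  ⟨coinBlocks fun n => if n ∈ s then (R n).1 else 1, coinBlocks_mem fun n => by
    split_ifs
    exacts [(R n).2, one_mem _]⟩

lemma markedCircuit_coinOn_mulVec (s : Finset N) (R : N → Matrix.unitaryGroup Bool ℂ)
    (η : N × Bool → X × X → ℂ) :
    (circuitMatrix O M (markedCircuit e (coinOn s R))).mulVec (labState e η)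
      = labState e fun l => if l.1 ∈ s then coinRotate M (R l.1).1 (fun b => η (l.1, b)) l.2
        else η l := by
  rw [markedCircuit_mulVec]
  congr 1
  funext l v
  rw [coinOn, sum_coinBlocks _ l fun l' => η l' v]
  by_cases hl : l.1 ∈ s <;> by_cases hv : v.2 ∈ M <;>
    simp [hl, hv, coinRotate, Matrix.one_apply]

/-- One step of the quantum walks, for the labels in `s`. -/
def stepCircuit (s : Finset N) (R : N → Matrix.unitaryGroup Bool ℂ) : List (Gate K) :=
  markedCircuit e (coinOn s R) ++
  ([.walk (labelSet e (s ×ˢ {false})), .shift (labelSet e (s ×ˢ {false})),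
    .walkInv (labelSet e (s ×ˢ {false}))] ++
  (markedCircuit e (coinOn s fun n => (R n)⁻¹) ++
  -- The reflection for coin off and the sign for coin on together make up `coinReflect`.
  [.reflect (labelSet e (s ×ˢ {false})), labelGate e (signUnitary (s ×ˢ {true}))]))

lemma coinOff_labels (s : Finset N) (A : Matrix (X × X) (X × X) ℂ) (η : N × Bool → X × X → ℂ) :
    (controlled (labelSet e (s ×ˢ {false})) A).mulVec (labState e η)
      = labState e fun l => if l.1 ∈ s then coinOff A (fun b => η (l.1, b)) l.2 else η l := by
  rw [controlled_mulVec_labState]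
  congr 1
  funext ⟨n, b⟩
  by_cases hn : n ∈ s <;> cases b <;> simp [hn, coinOff]

lemma stepCircuit_mulVec (s : Finset N) (R : N → Matrix.unitaryGroup Bool ℂ)
    (η : N × Bool → X × X → ℂ) :
    (circuitMatrix O M (stepCircuit e s R)).mulVec (labState e η)
      = labState e fun l => if l.1 ∈ s then
          coinStep M (R l.1).1 O.ref O.V.1 (fun b => η (l.1, b)) l.2 else η l := by
  have hw : ∀ η : N × Bool → X × X → ℂ,
      ((Gate.walk (labelSet e (s ×ˢ {false}))).toMatrix O M).mulVec (labState e η) = _ :=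
    fun η => coinOff_labels e s _ η
  have hs : ∀ η : N × Bool → X × X → ℂ,
      ((Gate.shift (labelSet e (s ×ˢ {false}))).toMatrix O M).mulVec (labState e η) = _ :=
    fun η => coinOff_labels e s _ η
  have hwi : ∀ η : N × Bool → X × X → ℂ,
      ((Gate.walkInv (labelSet e (s ×ˢ {false}))).toMatrix O M).mulVec (labState e η) = _ :=
    fun η => coinOff_labels e s _ η
  have hr : ∀ η : N × Bool → X × X → ℂ,
      ((Gate.reflect (labelSet e (s ×ˢ {false}))).toMatrix O M).mulVec (labState e η) = _ :=
    fun η => coinOff_labels e s _ η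
  simp only [stepCircuit, circuitMatrix_append_mulVec, circuitMatrix_cons_mulVec,
    circuitMatrix_nil_mulVec, markedCircuit_coinOn_mulVec, hw, hs, hwi, hr, labelGate_mulVec]
  congr 1
  funext ⟨n, b⟩ v
  rw [sum_signUnitary (s ×ˢ {true}) (n, b)]
  by_cases hn : n ∈ s
  · simp only [hn, if_true, coinStep, coinReflect, coinSwap]
    cases b <;> simp [hn] <;> rfl
  · simp [hn]

/-- The quantum walks, where the label `n` specifies the number `k n` of steps. -/
def walkCircuit (R : N → Matrix.unitaryGroup Bool ℂ) (k : N → ℕ) (τ : ℕ) : List (Gate K) :=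
  (List.range τ).flatMap fun i => stepCircuit e (Finset.univ.filter fun n => i < k n) R

/-- Step `i` acts only on labels with `i < k n`, so walks of all lengths share the same `τ` steps.
-/
lemma walkCircuit_mulVec (R : N → Matrix.unitaryGroup Bool ℂ) (k : N → ℕ) (τ : ℕ)
    (η : N × Bool → X × X → ℂ) :
    (circuitMatrix O M (walkCircuit e R k τ)).mulVec (labState e η)
      = labState e fun l =>
          (coinStep M (R l.1).1 O.ref O.V.1)^[min τ (k l.1)] (fun b => η (l.1, b)) l.2 := by
  induction τ with
  | zero => simp [walkCircuit, circuitMatrix_nil_mulVec]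
  | succ τ ih =>
    rw [walkCircuit, List.range_succ, List.flatMap_append, circuitMatrix_append_mulVec]
    change (circuitMatrix O M ([τ].flatMap _)).mulVec
      ((circuitMatrix O M (walkCircuit e R k τ)).mulVec (labState e η)) = _
    rw [ih, List.flatMap_singleton, stepCircuit_mulVec]
    congr 1
    funext l
    by_cases h : τ < k l.1
    · have h1 : min τ (k l.1) = τ := by omega
      have h2 : min (τ + 1) (k l.1) = τ + 1 := by omega
      simp only [Finset.mem_filter, Finset.mem_univ, true_and, h, if_true, h1, h2]
      rw [Function.iterate_succ_apply']
    · have h1 : min τ (k l.1) = k l.1 := by omega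
      have h2 : min (τ + 1) (k l.1) = k l.1 := by omega
      simp only [Finset.mem_filter, Finset.mem_univ, true_and, h, if_false, h1, h2]

lemma coinStep_smul (R : Matrix Bool Bool ℂ) (r : X → ℂ) (V : Matrix (X × X) (X × X) ℂ) (c : ℂ)
    (w : Bool → X × X → ℂ) : coinStep M R r V (c • w) = c • coinStep M R r V w := by
  rw [coinStep, coinStep, coinSwap_smul, coinReflect_eq, coinReflect_eq, coinProject_smul]
  funext b v
  cases b
  · simp [coinEmbed]; ring
  · simp [coinEmbed]

lemma iterate_coinStep_smul (R : Matrix Bool Bool ℂ) (r : X → ℂ) (V : Matrix (X × X) (X × X) ℂ)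
    (c : ℂ) (w : Bool → X × X → ℂ) (k : ℕ) :
    (coinStep M R r V)^[k] (c • w) = c • (coinStep M R r V)^[k] w := by
  induction k with
  | zero => rfl
  | succ k ih => rw [Function.iterate_succ_apply', Function.iterate_succ_apply', ih, coinStep_smul]

end StepCircuit

/-! ### Preparation of the superposition of walks, and the sectors it preserves -/

section Preparation

variable {X : Type*} [Fintype X] [DecidableEq X] {K : ℕ} {D I : Type*} [Fintype D] [DecidableEq D]
  [Fintype I] [DecidableEq I] (e : (D × I) × Bool ≃ Fin (K + 1)) {P : Matrix.rowStochastic ℝ X}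
  {π : stdSimplex ℝ X} (O : WalkImplementation P π) (M : Finset X)

/-- A unit vector is the column of some unitary matrix. -/
lemma exists_unitary_column (i₀ : I) {f : I → ℂ} (hf : ∑ i, ‖f i‖ ^ 2 = 1) :
    ∃ W : Matrix.unitaryGroup I ℂ, ∀ i, W.1 i i₀ = f i := by
  have hn : ‖(WithLp.toLp 2 f : EuclideanSpace ℂ I)‖ = 1 := by
    rw [EuclideanSpace.norm_eq, Real.sqrt_eq_one]
    exact hf
  have ho : Orthonormal ℂ (({i₀} : Set I).domRestrict
      fun _ : I => (WithLp.toLp 2 f : EuclideanSpace ℂ I)) := by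
    refine ⟨fun i => hn, fun i j hij => absurd (Subsingleton.elim i j) hij⟩
  obtain ⟨b, hb⟩ := ho.exists_orthonormalBasis_extension_of_card_eq (by simp)
  refine ⟨⟨_, (EuclideanSpace.basisFun I ℂ).toMatrix_orthonormalBasis_mem_unitary b⟩, fun i => ?_⟩
  simp [Module.Basis.toMatrix_apply, hb i₀ rfl]

/-- A unitary on the second component of the labels. -/
def prepUnitary (W : Matrix.unitaryGroup I ℂ) : Matrix.unitaryGroup ((D × I) × Bool) ℂ :=
  ⟨((1 : Matrix D D ℂ) ⊗ₖ W.1) ⊗ₖ (1 : Matrix Bool Bool ℂ),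
    Matrix.kronecker_mem_unitary (Matrix.kronecker_mem_unitary (one_mem _) W.2) (one_mem _)⟩

lemma sum_prepUnitary (W : Matrix.unitaryGroup I ℂ) (d : D) (i : I) (b : Bool)
    (f : (D × I) × Bool → ℂ) :
    ∑ l, (prepUnitary W).1 ((d, i), b) l * f l = ∑ i', W.1 i i' * f ((d, i'), b) := by
  have h := kronecker_one_mulVec ((1 : Matrix D D ℂ) ⊗ₖ W.1) f (d, i) b
  have h2 := one_kronecker_mulVec (m := D) W.1 (fun p => f (p, b)) d i
  exact h.trans h2

/-- The circuit that prepares the superposition of the quantum walks. -/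
def prepCircuit (W : Matrix.unitaryGroup I ℂ) (R : I → Matrix.unitaryGroup Bool ℂ) (k : I → ℕ)
    (τ : ℕ) : List (Gate K) :=
  [labelGate e (prepUnitary W), .setup] ++ walkCircuit e (fun n => R n.2) (fun n => k n.2) τ

lemma prepCircuit_mulVec (W : Matrix.unitaryGroup I ℂ) (R : I → Matrix.unitaryGroup Bool ℂ)
    (k : I → ℕ) (τ : ℕ) (η : (D × I) × Bool → X × X → ℂ) :
    (circuitMatrix O M (prepCircuit e W R k τ)).mulVec (labState e η)
      = labState e fun l => (coinStep M (R l.1.2).1 O.ref O.V.1)^[min τ (k l.1.2)]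
          (fun b => ((1 : Matrix X X ℂ) ⊗ₖ O.setup.1).mulVec
            (∑ i, W.1 l.1.2 i • η ((l.1.1, i), b))) l.2 := by
  rw [prepCircuit, circuitMatrix_append_mulVec, circuitMatrix_cons_mulVec,
    circuitMatrix_cons_mulVec, circuitMatrix_nil_mulVec, labelGate_mulVec, setup_mulVec_labState,
    walkCircuit_mulVec]
  have h : ∀ (d : D) (i : I) (b : Bool),
      (fun v => ∑ l', (prepUnitary W).1 ((d, i), b) l' * η l' v) = ∑ i', W.1 i i' • η ((d, i'), b) :=
    fun d i b => by
      funext v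
      rw [sum_prepUnitary W d i b fun l' => η l' v]
      simp
  simp only [h]

lemma initialState_eq {d₀ : D} {i₀ : I} (he : e ((d₀, i₀), false) = 0) :
    initialState K O = labState e fun l v =>
      if l = ((d₀, i₀), false) then O.ref v.1 * O.ref v.2 else 0 := by
  have h : ∀ j, j = 0 ↔ e.symm j = ((d₀, i₀), false) := fun j => by
    rw [Equiv.symm_apply_eq, he]
  funext ⟨⟨b, j⟩, v⟩
  cases b <;> simp [initialState, labState, memState, h]

lemma prepCircuit_initialState {d₀ : D} {i₀ : I} (he : e ((d₀, i₀), false) = 0)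
    (W : Matrix.unitaryGroup I ℂ) {ρ : I → ℝ} (hρ : ∀ i, 1 ≤ ρ i) {k : I → ℕ} {τ : ℕ}
    (hk : ∀ i, k i ≤ τ) :
    (circuitMatrix O M (prepCircuit e W (fun i => ⟨_, coinMatrix_mem (hρ i)⟩) k τ)).mulVec
        (initialState K O)
      = labState e fun l v => if l.1.1 = d₀ then
          W.1 l.1.2 i₀ * walkState O M (ρ l.1.2) (k l.1.2) l.2 v else 0 := by
  rw [initialState_eq e O he, prepCircuit_mulVec]
  congr 1
  funext ⟨⟨d, i⟩, b⟩ v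
  have h1 : (fun b => ((1 : Matrix X X ℂ) ⊗ₖ O.setup.1).mulVec
      (∑ i', W.1 i i' • fun v : X × X => if (((d, i'), b) : (D × I) × Bool) = ((d₀, i₀), false)
        then O.ref v.1 * O.ref v.2 else 0))
      = (if d = d₀ then W.1 i i₀ else 0) •
        coinEmbed O.ref fun x => ((√(π.1 x) : ℝ) : ℂ) := by
    funext b
    have h2 : (∑ i', W.1 i i' • fun v : X × X =>
        if (((d, i'), b) : (D × I) × Bool) = ((d₀, i₀), false)
        then O.ref v.1 * O.ref v.2 else 0)
        = fun v => ((if d = d₀ then W.1 i i₀ else 0) * if b then 0 else O.ref v.1) * O.ref v.2 := by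
      funext v
      rw [Finset.sum_apply, Finset.sum_eq_single i₀]
      · by_cases hd : d = d₀ <;> cases b <;> simp [hd, mul_assoc]
      · intro i' _ hi'
        simp [hi']
      · simp
    rw [h2]
    funext ⟨a, x⟩
    rw [one_kronecker_mulVec]
    have h3 := congrFun O.setup_apply x
    change (O.setup.1.mulVec (((if d = d₀ then W.1 i i₀ else 0) * if b then 0 else O.ref a) •
      O.ref)) x = _
    rw [Matrix.mulVec_smul, Pi.smul_apply, h3]
    by_cases hd : d = d₀ <;> cases b <;> simp [hd, coinEmbed, mul_assoc]
  simp only [h1, iterate_coinStep_smul, min_eq_right (hk i)]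
  by_cases hd : d = d₀ <;> simp [hd, walkState]

/-- The states whose labels `d` satisfy `s d`. -/
def sector (s : D → Prop) : Submodule ℂ (Config K X → ℂ) where
  carrier := {f | ∃ η : (D × I) × Bool → X × X → ℂ, (∀ l, ¬ s l.1.1 → η l = 0) ∧ f = labState e η}
  add_mem' := by
    rintro _ _ ⟨η, h, rfl⟩ ⟨η', h', rfl⟩
    refine ⟨η + η', fun l hl => by simp [h l hl, h' l hl], ?_⟩
    funext ⟨⟨b, j⟩, v⟩
    cases b <;> simp [labState, memState]
  zero_mem' := by
    refine ⟨0, fun _ _ => rfl, ?_⟩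
    funext ⟨⟨b, j⟩, v⟩
    cases b <;> simp [labState, memState]
  smul_mem' := by
    rintro c _ ⟨η, h, rfl⟩
    refine ⟨c • η, fun l hl => by simp [h l hl], ?_⟩
    funext ⟨⟨b, j⟩, v⟩
    cases b <;> simp [labState, memState]

/-- `Setup` cannot be controlled, so the preparation acts on every sector. What matters is that it
never changes the first label. -/
lemma prepCircuit_mem_sector (s : D → Prop) (W : Matrix.unitaryGroup I ℂ)
    (R : I → Matrix.unitaryGroup Bool ℂ) (k : I → ℕ) (τ : ℕ) {f : Config K X → ℂ}
    (hf : f ∈ sector e s) :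
    (circuitMatrix O M (prepCircuit e W R k τ)).mulVec f ∈ sector e s := by
  obtain ⟨η, h, rfl⟩ := hf
  refine ⟨_, fun l hl => ?_, prepCircuit_mulVec e O M W R k τ η⟩
  have h0 : (fun b => ((1 : Matrix X X ℂ) ⊗ₖ O.setup.1).mulVec
      (∑ i, W.1 l.1.2 i • η ((l.1.1, i), b))) = (0 : ℂ) • (0 : Bool → X × X → ℂ) := by
    funext b
    rw [Finset.sum_eq_zero fun i _ => by rw [h ((l.1.1, i), b) hl, smul_zero]]
    simp
  rw [h0, iterate_coinStep_smul, zero_smul]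
  rfl

/-- In finite dimension an injective map of `S` into itself is onto, so the inverse preserves `S` as
well. -/
lemma conjTranspose_mulVec_mem {n : Type*} [Fintype n] [DecidableEq n] {U : Matrix n n ℂ}
    (hU : U ∈ Matrix.unitaryGroup n ℂ) {S : Submodule ℂ (n → ℂ)}
    (hS : ∀ f ∈ S, U.mulVec f ∈ S) {f : n → ℂ} (hf : f ∈ S) :
    U.conjTranspose.mulVec f ∈ S := by
  have h1 := Matrix.mem_unitaryGroup_iff.1 hU
  have h2 := Matrix.mem_unitaryGroup_iff'.1 hU
  rw [Matrix.star_eq_conjTranspose] at h1 h2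
  have hinj : Function.Injective U.mulVecLin := fun a b hab => by
    have := congrArg U.conjTranspose.mulVec (show U.mulVec a = U.mulVec b from hab)
    simpa [Matrix.mulVec_mulVec, h2] using this
  have hle : S.map U.mulVecLin ≤ S := by
    rintro _ ⟨a, ha, rfl⟩
    exact hS a ha
  have heq : S.map U.mulVecLin = S := Submodule.eq_of_le_of_finrank_eq hle
    (Submodule.equivMapOfInjective _ hinj S).finrank_eq.symm
  rw [← heq] at hf
  obtain ⟨a, ha, rfl⟩ := hf
  simpa [Matrix.mulVec_mulVec, h2] using ha

end Preparation

/-! ### Amplitude amplification and the recording of success -/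

section Amplification

variable {X : Type*} [Fintype X] [DecidableEq X] {K : ℕ} {D I : Type*} [Fintype D] [DecidableEq D]
  [Fintype I] [DecidableEq I] (e : (D × I) × Bool ≃ Fin (K + 1)) {P : Matrix.rowStochastic ℝ X}
  {π : stdSimplex ℝ X} (O : WalkImplementation P π) (M : Finset X)

lemma labState_add {L : Type*} (e : L ≃ Fin (K + 1)) (η η' : L → X × X → ℂ) :
    labState e (η + η') = labState e η + labState e η' := by
  funext ⟨⟨b, j⟩, v⟩
  cases b <;> simp [labState, memState]

lemma labState_smul {L : Type*} (e : L ≃ Fin (K + 1)) (c : ℂ) (η : L → X × X → ℂ) :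
    labState e (c • η) = c • labState e η := by
  funext ⟨⟨b, j⟩, v⟩
  cases b <;> simp [labState, memState]

lemma sum_labState {L R : Type*} [Fintype L] [AddCommMonoid R] (e : L ≃ Fin (K + 1))
    (η : L → X × X → ℂ) (F : ℂ → X × X → R) (hF : ∀ v, F 0 v = 0) :
    ∑ q, F (labState e η q) q.2 = ∑ l, ∑ v, F (η l v) v := by
  rw [Fintype.sum_prod_type, Fintype.sum_prod_type, Fintype.sum_bool]
  have h : ∀ j : Fin (K + 1), ∑ v, F (labState e η ((true, j), v)) v = 0 := fun j =>
    Finset.sum_eq_zero fun v _ => hF v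
  simp only [h, Finset.sum_const_zero, zero_add]
  exact (Fintype.sum_equiv e _ _ fun l => by simp [labState, memState]).symm

/-- Reflection about the initial state, on the states whose first label is `d₀`. -/
def initialReflection (d₀ : D) (i₀ : I) : List (Gate K) :=
  zeroReflection e {((d₀, i₀), false)} ++ [labelGate e (signUnitary
    (Finset.univ.filter fun l => l.1.1 = d₀ ∧ l ≠ ((d₀, i₀), false)))]

lemma initialReflection_mulVec (d₀ : D) (i₀ : I) (η : (D × I) × Bool → X × X → ℂ) :
    (circuitMatrix O M (initialReflection e d₀ i₀)).mulVec (labState e η)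
      = labState e fun l => if l = ((d₀, i₀), false) then
          (2 : ℂ) • (refProj O.ref ⊗ₖ refProj O.ref).mulVec (η l) - η l
        else if l.1.1 = d₀ then -η l else η l := by
  rw [initialReflection, circuitMatrix_append_mulVec, zeroReflection_mulVec,
    circuitMatrix_cons_mulVec, circuitMatrix_nil_mulVec, labelGate_mulVec]
  congr 1
  funext l v
  rw [sum_signUnitary _ l fun l' => (if l' ∈ ({((d₀, i₀), false)} : Finset _) then
    (2 : ℂ) • (refProj O.ref ⊗ₖ refProj O.ref).mulVec (η l') - η l' else η l') v]
  by_cases h : l = ((d₀, i₀), false)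
  · simp [h]
  · by_cases h' : l.1.1 = d₀ <;> simp [h, h']

lemma refProj_kronecker_mulVec (r : X → ℂ) (f : X × X → ℂ) :
    (refProj r ⊗ₖ refProj r).mulVec f
      = (∑ w : X × X, star (r w.1 * r w.2) * f w) • fun v => r v.1 * r v.2 := by
  funext v
  simp only [Matrix.mulVec, dotProduct, Pi.smul_apply, smul_eq_mul, Finset.sum_mul]
  refine Finset.sum_congr rfl fun w _ => ?_
  change r v.1 * star (r w.1) * (r v.2 * star (r w.2)) * f w = _
  rw [star_mul']
  ring

lemma initialReflection_sector {d₀ : D} {i₀ : I} (he : e ((d₀, i₀), false) = 0)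
    {f : Config K X → ℂ} (hf : f ∈ sector (I := I) e (· = d₀)) :
    (circuitMatrix O M (initialReflection e d₀ i₀)).mulVec f
      = (2 * (star (initialState K O) ⬝ᵥ f)) • initialState K O - f := by
  obtain ⟨η, h, rfl⟩ := hf
  have h1 : star (initialState K O) ⬝ᵥ labState e η
      = ∑ w : X × X, star (O.ref w.1 * O.ref w.2) * η ((d₀, i₀), false) w := by
    rw [dotProduct, Fintype.sum_prod_type, Finset.sum_eq_single (false, 0)]
    · refine Finset.sum_congr rfl fun w _ => ?_
      have : e.symm 0 = ((d₀, i₀), false) := by rw [Equiv.symm_apply_eq, he]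
      simp [initialState, labState, memState, this]
    · intro m _ hm
      simp [initialState, hm]
    · simp
  rw [h1, initialReflection_mulVec, initialState_eq e O he, ← labState_smul, sub_eq_add_neg,
    ← neg_one_smul ℂ (labState e η), ← labState_smul, ← labState_add]
  congr 1
  funext l v
  by_cases hl : l = ((d₀, i₀), false)
  · subst hl
    simp only [if_true, refProj_kronecker_mulVec, Pi.sub_apply, Pi.smul_apply, Pi.add_apply,
      smul_eq_mul]
    ring
  · by_cases hd : l.1.1 = d₀
    · simp [hl, hd]
    · simp [hl, hd, h l hd]

lemma initialReflection_sector_ne {d₀ : D} (i₀ : I)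
    {f : Config K X → ℂ} (hf : f ∈ sector (I := I) e (· ≠ d₀)) :
    (circuitMatrix O M (initialReflection e d₀ i₀)).mulVec f = f := by
  obtain ⟨η, h, rfl⟩ := hf
  rw [initialReflection_mulVec]
  congr 1
  funext l
  by_cases hd : l.1.1 = d₀
  · rw [h l (by simpa using hd)]
    simp
  · have : l ≠ ((d₀, i₀), false) := fun h => hd (by rw [h])
    simp [this, hd]

/-- The conjugate by `A` of the reflection about the initial state. -/
def conjReflection (d₀ : D) (i₀ : I) (A : List (Gate K)) : List (Gate K) :=
  inverseCircuit A ++ (initialReflection e d₀ i₀ ++ A)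

lemma circuitMatrix_mulVec_inverse (A : List (Gate K)) (f : Config K X → ℂ) :
    (circuitMatrix O M A).mulVec ((circuitMatrix O M (inverseCircuit A)).mulVec f) = f := by
  have h := Matrix.mem_unitaryGroup_iff.1 (circuitMatrix_mem O M A)
  rw [circuitMatrix_inverse, Matrix.mulVec_mulVec, ← Matrix.star_eq_conjTranspose, h,
    Matrix.one_mulVec]

lemma inverseCircuit_mem {A : List (Gate K)} {S : Submodule ℂ (Config K X → ℂ)}
    (hA : ∀ f ∈ S, (circuitMatrix O M A).mulVec f ∈ S) {f : Config K X → ℂ} (hf : f ∈ S) :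
    (circuitMatrix O M (inverseCircuit A)).mulVec f ∈ S := by
  rw [circuitMatrix_inverse]
  exact conjTranspose_mulVec_mem (circuitMatrix_mem O M A) hA hf

lemma conjReflection_sector {d₀ : D} {i₀ : I} (he : e ((d₀, i₀), false) = 0) {A : List (Gate K)}
    (hA : ∀ f ∈ sector (I := I) (X := X) e (· = d₀),
      (circuitMatrix O M A).mulVec f ∈ sector (I := I) e (· = d₀))
    {f : Config K X → ℂ} (hf : f ∈ sector (I := I) e (· = d₀)) :
    (circuitMatrix O M (conjReflection e d₀ i₀ A)).mulVec f
      = (2 * (star ((circuitMatrix O M A).mulVec (initialState K O)) ⬝ᵥ f)) •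
        (circuitMatrix O M A).mulVec (initialState K O) - f := by
  rw [conjReflection, circuitMatrix_append_mulVec, circuitMatrix_append_mulVec,
    initialReflection_sector e O M he (inverseCircuit_mem O M hA hf), Matrix.mulVec_sub,
    Matrix.mulVec_smul, circuitMatrix_mulVec_inverse, circuitMatrix_inverse,
    star_dotProduct_conjTranspose_mulVec]

/-- Outside the sector of `d₀` the middle reflection is trivial and `A` cancels its inverse. Thus
amplification leaves recorded successes alone, although `A` is not controlled. -/
lemma conjReflection_sector_ne {d₀ : D} (i₀ : I) {A : List (Gate K)}
    (hA : ∀ f ∈ sector (I := I) (X := X) e (· ≠ d₀),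
      (circuitMatrix O M A).mulVec f ∈ sector (I := I) e (· ≠ d₀))
    {f : Config K X → ℂ} (hf : f ∈ sector (I := I) e (· ≠ d₀)) :
    (circuitMatrix O M (conjReflection e d₀ i₀ A)).mulVec f = f := by
  rw [conjReflection, circuitMatrix_append_mulVec, circuitMatrix_append_mulVec,
    initialReflection_sector_ne e O M i₀ (inverseCircuit_mem O M hA hf),
    circuitMatrix_mulVec_inverse]

/-- The component of a state in which the second vertex register holds a marked vertex. -/
def markedPart (f : Config K X → ℂ) : Config K X → ℂ := fun q => if q.2.2 ∈ M then f q else 0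

lemma markedPart_labState {L : Type*} (e : L ≃ Fin (K + 1)) (η : L → X × X → ℂ) :
    markedPart M (labState e η) = labState e fun l v => if v.2 ∈ M then η l v else 0 := by
  funext ⟨⟨b, j⟩, v⟩
  cases b <;> simp [labState, memState, markedPart]

lemma markedPart_mem_sector {s : D → Prop} {f : Config K X → ℂ}
    (hf : f ∈ sector (I := I) e s) : markedPart M f ∈ sector (I := I) e s := by
  obtain ⟨η, h, rfl⟩ := hf
  refine ⟨_, fun l hl => ?_, markedPart_labState M e η⟩
  funext v
  simp [h l hl]

/-- The operation that changes the sign of the marked component, on the states whose first label is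
`d₀`. -/
def signCircuit (d₀ : D) : List (Gate K) :=
  markedCircuit e (signUnitary (Finset.univ.filter fun l : (D × I) × Bool => l.1.1 = d₀))

lemma signCircuit_mulVec (d₀ : D) (η : (D × I) × Bool → X × X → ℂ) :
    (circuitMatrix O M (signCircuit e d₀)).mulVec (labState e η)
      = labState e fun l v => if l.1.1 = d₀ ∧ v.2 ∈ M then -η l v else η l v := by
  rw [signCircuit, markedCircuit_mulVec]
  congr 1
  funext l v
  rw [sum_signUnitary _ l fun l' => η l' v]
  by_cases h : l.1.1 = d₀ <;> by_cases hv : v.2 ∈ M <;> simp [h, hv]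

lemma signCircuit_sector {d₀ : D} {f : Config K X → ℂ}
    (hf : f ∈ sector (I := I) e (· = d₀)) :
    (circuitMatrix O M (signCircuit (I := I) e d₀)).mulVec f = f - (2 : ℂ) • markedPart M f := by
  obtain ⟨η, h, rfl⟩ := hf
  rw [signCircuit_mulVec, markedPart_labState, sub_eq_add_neg, ← neg_smul, ← labState_smul,
    ← labState_add]
  congr 1
  funext l v
  by_cases hd : l.1.1 = d₀
  · by_cases hv : v.2 ∈ M
    · simp [hd, hv]; ring
    · simp [hd, hv]
  · simp [hd, h l hd]

lemma signCircuit_sector_ne {d₀ : D} {f : Config K X → ℂ}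
    (hf : f ∈ sector (I := I) e (· ≠ d₀)) :
    (circuitMatrix O M (signCircuit (I := I) e d₀)).mulVec f = f := by
  obtain ⟨η, h, rfl⟩ := hf
  rw [signCircuit_mulVec]
  congr 1
  funext l v
  by_cases hd : l.1.1 = d₀
  · simp [h l (by simpa using hd)]
  · simp [hd]

/-- The iteration of amplitude amplification. -/
def groverCircuit (d₀ : D) (i₀ : I) (A : List (Gate K)) : List (Gate K) :=
  signCircuit (I := I) e d₀ ++ conjReflection e d₀ i₀ A

/-- The permutation of the labels which exchanges the first labels `d₀` and `d`. -/
def swapLabels (d₀ d : D) : Matrix.unitaryGroup ((D × I) × Bool) ℂ :=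
  ⟨Matrix.of fun l l' => if l = ((Equiv.swap d₀ d l'.1.1, l'.1.2), l'.2) then 1 else 0,
    (permMatrix_mem_unitaryGroup (σ := fun l => ((Equiv.swap d₀ d l.1.1, l.1.2), l.2))
      (fun l => by simp) fun _ _ => rfl).2⟩

lemma sum_swapLabels (d₀ d : D) (l : (D × I) × Bool) (f : (D × I) × Bool → ℂ) :
    ∑ l', (swapLabels d₀ d).1 l l' * f l' = f ((Equiv.swap d₀ d l.1.1, l.1.2), l.2) := by
  rw [Finset.sum_eq_single ((Equiv.swap d₀ d l.1.1, l.1.2), l.2)]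
  · simp [swapLabels]
  · intro l' _ hl'
    have : l ≠ ((Equiv.swap d₀ d l'.1.1, l'.1.2), l'.2) := fun h => hl' (by rw [h]; simp)
    simp [swapLabels, this]
  · simp

/-- The operation which records in the label `d` that a marked vertex has been found. -/
def recordCircuit (d₀ d : D) : List (Gate K) := markedCircuit e (swapLabels (I := I) d₀ d)

lemma recordCircuit_mulVec (d₀ d : D) (η : (D × I) × Bool → X × X → ℂ) :
    (circuitMatrix O M (recordCircuit e d₀ d)).mulVec (labState e η)
      = labState e fun l v =>
        if v.2 ∈ M then η ((Equiv.swap d₀ d l.1.1, l.1.2), l.2) v else η l v := by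
  rw [recordCircuit, markedCircuit_mulVec]
  congr 1
  funext l v
  rw [sum_swapLabels d₀ d l fun l' => η l' v]

/-- The states with a marked vertex in the second register whose first label satisfies `s`. -/
def recorded (s : D → Prop) : Submodule ℂ (Config K X → ℂ) where
  carrier := {f | f ∈ sector (I := I) e s ∧ markedPart M f = f}
  add_mem' := by
    rintro f g ⟨hf, hf'⟩ ⟨hg, hg'⟩
    refine ⟨add_mem hf hg, ?_⟩
    conv_rhs => rw [← hf', ← hg']
    funext q
    by_cases h : q.2.2 ∈ M <;> simp [markedPart, h]
  zero_mem' := ⟨zero_mem _, by funext q; simp [markedPart]⟩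
  smul_mem' := by
    rintro c f ⟨hf, hf'⟩
    refine ⟨Submodule.smul_mem _ c hf, ?_⟩
    conv_rhs => rw [← hf']
    funext q
    by_cases h : q.2.2 ∈ M <;> simp [markedPart, h]

lemma sector_mono {s s' : D → Prop} (h : ∀ d, s d → s' d) :
    sector (I := I) (X := X) e s ≤ sector (I := I) e s' := by
  rintro _ ⟨η, hη, rfl⟩
  exact ⟨η, fun l hl => hη l fun h' => hl (h _ h'), rfl⟩

lemma recorded_mono {s s' : D → Prop} (h : ∀ d, s d → s' d) :
    recorded (I := I) (X := X) e M s ≤ recorded (I := I) e M s' :=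
  fun _ hf => ⟨sector_mono e h hf.1, hf.2⟩

lemma recordCircuit_of_unmarked (d₀ d : D) {f : Config K X → ℂ} {s : D → Prop}
    (hf : f ∈ sector (I := I) e s) (h0 : markedPart M f = 0) :
    (circuitMatrix O M (recordCircuit (I := I) e d₀ d)).mulVec f = f := by
  obtain ⟨η, h, rfl⟩ := hf
  rw [recordCircuit_mulVec]
  congr 1
  funext l v
  have h1 : ∀ l v, v.2 ∈ M → η l v = 0 := fun l v hv => by
    have := congrFun h0 ((false, e l), v)
    simpa [markedPart, hv, labState, memState] using this
  by_cases hv : v.2 ∈ M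
  · simp [hv, h1]
  · simp [hv]

/-- The swap moves only the labels `d₀` and `d`, and neither occurs in `f`. This is why every round
needs a fresh label. -/
lemma recordCircuit_of_recorded {d₀ d : D} {f : Config K X → ℂ} {s : D → Prop}
    (hf : f ∈ recorded (I := I) e M s) (h0 : ¬ s d₀) (hd : ¬ s d) :
    (circuitMatrix O M (recordCircuit (I := I) e d₀ d)).mulVec f = f := by
  obtain ⟨⟨η, h, rfl⟩, -⟩ := hf
  rw [recordCircuit_mulVec]
  congr 1
  funext l v
  by_cases h1 : l.1.1 = d₀
  · rw [h l (h1 ▸ h0), h _ (by simpa [h1] using hd)]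
    simp
  · by_cases h2 : l.1.1 = d
    · rw [h l (h2 ▸ hd), h _ (by simpa [h2] using h0)]
      simp
    · rw [Equiv.swap_apply_of_ne_of_ne h1 h2]
      simp

lemma recordCircuit_mem_recorded {d₀ d : D} {f : Config K X → ℂ}
    (hf : f ∈ recorded (I := I) e M (· = d₀)) :
    (circuitMatrix O M (recordCircuit (I := I) e d₀ d)).mulVec f
      ∈ recorded (I := I) e M (· = d) := by
  obtain ⟨⟨η, h, rfl⟩, h0⟩ := hf
  have h1 : ∀ l v, v.2 ∉ M → η l v = 0 := fun l v hv => by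
    have := congrFun h0 ((false, e l), v)
    simpa [markedPart, hv, labState, memState, eq_comm] using this
  rw [recordCircuit_mulVec]
  refine ⟨⟨_, fun l hl => ?_, rfl⟩, ?_⟩
  · funext v
    by_cases hv : v.2 ∈ M
    · have : Equiv.swap d₀ d l.1.1 ≠ d₀ := fun h' => hl (by
        rw [Equiv.swap_apply_eq_iff, Equiv.swap_apply_left] at h'
        exact h')
      simp [hv, h ((Equiv.swap d₀ d l.1.1, l.1.2), l.2) this]
    · simp [hv, h1]
  · rw [markedPart_labState]
    congr 1
    funext l v
    by_cases hv : v.2 ∈ M <;> simp [hv, h1]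

end Amplification

/-! ### Search with doubling numbers of iterations -/

section Search

variable {X : Type*} [Fintype X] [DecidableEq X] {K : ℕ} {D I : Type*} [Fintype D] [DecidableEq D]
  [Fintype I] [DecidableEq I] (e : (D × I) × Bool ≃ Fin (K + 1)) {P : Matrix.rowStochastic ℝ X}
  {π : stdSimplex ℝ X} (O : WalkImplementation P π) (M : Finset X)

lemma groverCircuit_sector_ne {d₀ : D} (i₀ : I) {A : List (Gate K)}
    (hA : ∀ f ∈ sector (I := I) (X := X) e (· ≠ d₀),
      (circuitMatrix O M A).mulVec f ∈ sector (I := I) e (· ≠ d₀))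
    {f : Config K X → ℂ} (hf : f ∈ sector (I := I) e (· ≠ d₀)) :
    (circuitMatrix O M (groverCircuit e d₀ i₀ A)).mulVec f = f := by
  rw [groverCircuit, circuitMatrix_append_mulVec, signCircuit_sector_ne e O M hf,
    conjReflection_sector_ne e O M i₀ hA hf]

lemma circuitMatrix_replicate_mulVec (A : List (Gate K)) (n : ℕ) (f : Config K X → ℂ) :
    (circuitMatrix O M (List.replicate n A).flatten).mulVec f
      = (circuitMatrix O M A).mulVec^[n] f := by
  induction n generalizing f with
  | zero => simp [circuitMatrix_nil_mulVec]
  | succ n ih =>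
    rw [List.replicate_succ, List.flatten_cons, circuitMatrix_append_mulVec, ih,
      Function.iterate_succ_apply]

lemma markedPart_markedPart (f : Config K X → ℂ) : markedPart M (markedPart M f) = markedPart M f := by
  funext q
  by_cases h : q.2.2 ∈ M <;> simp [markedPart, h]

lemma markedPart_sub (f g : Config K X → ℂ) :
    markedPart M (f - g) = markedPart M f - markedPart M g := by
  funext q
  by_cases h : q.2.2 ∈ M <;> simp [markedPart, h]

lemma star_dotProduct_markedPart (f : Config K X → ℂ) :
    star f ⬝ᵥ markedPart M f = ((∑ q, ‖markedPart M f q‖ ^ 2 : ℝ) : ℂ) := by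
  rw [← star_dotProduct_self_eq]
  refine Finset.sum_congr rfl fun q _ => ?_
  by_cases h : q.2.2 ∈ M <;> simp [markedPart, h]

/-- Two reflections make a rotation by `2 * θ` in the plane of the unmarked and the marked part of
`φ`. These vectors are not normalized: their norms are `|cos θ|` and `|sin θ|`, which explains the
coefficients. -/
lemma groverCircuit_mulVec {d₀ : D} {i₀ : I} (he : e ((d₀, i₀), false) = 0) {A : List (Gate K)}
    (hA : ∀ f ∈ sector (I := I) (X := X) e (· = d₀),
      (circuitMatrix O M A).mulVec f ∈ sector (I := I) e (· = d₀))
    {φ : Config K X → ℂ} (hφ : (circuitMatrix O M A).mulVec (initialState K O) = φ)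
    (hφs : φ ∈ sector (I := I) e (· = d₀)) (h1 : star φ ⬝ᵥ φ = 1) {θ : ℝ}
    (hp : ∑ q, ‖markedPart M φ q‖ ^ 2 = Real.sin θ ^ 2) :
    (circuitMatrix O M (groverCircuit e d₀ i₀ A)).mulVec (φ - markedPart M φ)
        = (Real.cos (2 * θ) : ℂ) • (φ - markedPart M φ)
          + (2 * (Real.cos θ) ^ 2 : ℂ) • markedPart M φ ∧
      (circuitMatrix O M (groverCircuit e d₀ i₀ A)).mulVec (markedPart M φ)
        = (Real.cos (2 * θ) : ℂ) • markedPart M φ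
          - (2 * (Real.sin θ) ^ 2 : ℂ) • (φ - markedPart M φ) := by
  have hg := markedPart_mem_sector e M hφs
  have hb := sub_mem hφs hg
  have hip : star φ ⬝ᵥ markedPart M φ = ((Real.sin θ) ^ 2 : ℂ) := by
    rw [star_dotProduct_markedPart, hp]
    push_cast
    rfl
  have hc : (Real.cos θ : ℂ) ^ 2 = 1 - (Real.sin θ : ℂ) ^ 2 := by
    exact_mod_cast Real.cos_sq' θ
  have hc2 : (Real.cos (2 * θ) : ℂ) = 1 - 2 * (Real.sin θ : ℂ) ^ 2 := by
    rw [Real.cos_two_mul, Real.cos_sq']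
    push_cast
    ring
  constructor
  · rw [groverCircuit, circuitMatrix_append_mulVec, signCircuit_sector e O M hb, markedPart_sub,
      markedPart_markedPart, sub_self, smul_zero, sub_zero,
      conjReflection_sector e O M he hA hb, hφ, dotProduct_sub, h1, hip, hc, hc2]
    module
  · rw [groverCircuit, circuitMatrix_append_mulVec, signCircuit_sector e O M hg,
      markedPart_markedPart,
      conjReflection_sector e O M he hA (sub_mem hg (Submodule.smul_mem _ _ hg)), hφ,
      dotProduct_sub, dotProduct_smul, hip, hc2, smul_eq_mul]
    module

lemma exists_iterate_groverCircuit {d₀ : D} {i₀ : I} (he : e ((d₀, i₀), false) = 0)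
    {A : List (Gate K)}
    (hA : ∀ f ∈ sector (I := I) (X := X) e (· = d₀),
      (circuitMatrix O M A).mulVec f ∈ sector (I := I) e (· = d₀))
    {φ : Config K X → ℂ} (hφ : (circuitMatrix O M A).mulVec (initialState K O) = φ)
    (hφs : φ ∈ sector (I := I) e (· = d₀)) (h1 : star φ ⬝ᵥ φ = 1) {θ : ℝ}
    (hp : ∑ q, ‖markedPart M φ q‖ ^ 2 = Real.sin θ ^ 2) (hθ : Real.sin θ ≠ 0) (n : ℕ) :
    (circuitMatrix O M (groverCircuit e d₀ i₀ A)).mulVec^[n] (φ - markedPart M φ)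
        = (Real.cos (n * (2 * θ)) : ℂ) • (φ - markedPart M φ)
          + (Real.sin (n * (2 * θ)) * (Real.cos θ / Real.sin θ) : ℂ) • markedPart M φ := by
  have hs : (Real.sin θ : ℂ) ≠ 0 := by exact_mod_cast hθ
  obtain ⟨hG1, hG2⟩ := groverCircuit_mulVec e O M he hA hφ hφs h1 hp
  induction n with
  | zero => simp
  | succ n ih =>
    have e1 : ((n + 1 : ℕ) : ℝ) * (2 * θ) = n * (2 * θ) + 2 * θ := by push_cast; ring
    rw [Function.iterate_succ_apply', ih, Matrix.mulVec_add, Matrix.mulVec_smul, Matrix.mulVec_smul,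
      hG1, hG2, e1, Real.cos_add, Real.sin_add, Real.sin_two_mul]
    rw [Complex.ofReal_sin] at hs
    push_cast
    funext q
    simp only [Pi.add_apply, Pi.sub_apply, Pi.smul_apply, smul_eq_mul]
    field_simp
    ring

/-- Amplitude amplification with a number of iterations which is doubled in every round. -/
def searchCircuit (δ : ℕ → D) (i₀ : I) (A : List (Gate K)) : ℕ → List (Gate K)
  | 0 => A ++ recordCircuit (I := I) e (δ 0) (δ 1)
  | m + 1 => searchCircuit δ i₀ A m ++ ((List.replicate (2 ^ m) (groverCircuit e (δ 0) i₀ A)).flatten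
      ++ recordCircuit (I := I) e (δ 0) (δ (m + 2)))

/-- What a round finds goes to a fresh label, on which later rounds act trivially, so overshooting
the rotation does no harm. Only the unmarked part goes on rotating, and a round of `2 ^ j`
iterations multiplies it by `cos (2 ^ j * (2 * θ))`. -/
lemma searchCircuit_mulVec {δ : ℕ → D} {i₀ : I} (he : e ((δ 0, i₀), false) = 0)
    {A : List (Gate K)}
    (hA : ∀ s : D → Prop, ∀ f ∈ sector (I := I) (X := X) e s,
      (circuitMatrix O M A).mulVec f ∈ sector (I := I) e s)
    {φ : Config K X → ℂ} (hφ : (circuitMatrix O M A).mulVec (initialState K O) = φ)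
    (hφs : φ ∈ sector (I := I) e (· = δ 0)) (h1 : star φ ⬝ᵥ φ = 1) {θ : ℝ}
    (hp : ∑ q, ‖markedPart M φ q‖ ^ 2 = Real.sin θ ^ 2) (hθ : Real.sin θ ≠ 0) (m : ℕ)
    (hδ : Set.InjOn δ (Set.Iic (m + 1))) :
    ∃ z ∈ recorded (I := I) e M (fun d => ∃ j, 1 ≤ j ∧ j ≤ m + 1 ∧ d = δ j),
      (circuitMatrix O M (searchCircuit e δ i₀ A m)).mulVec (initialState K O)
        = ((∏ j ∈ Finset.range m, Real.cos (2 ^ j * (2 * θ)) : ℝ) : ℂ) • (φ - markedPart M φ) + z := by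
  have hgs : markedPart M φ ∈ recorded (I := I) e M (· = δ 0) :=
    ⟨markedPart_mem_sector e M hφs, markedPart_markedPart M φ⟩
  have hbs : φ - markedPart M φ ∈ sector (I := I) e (· = δ 0) := sub_mem hφs hgs.1
  have hb0 : markedPart M (φ - markedPart M φ) = 0 := by
    rw [markedPart_sub, markedPart_markedPart, sub_self]
  induction m with
  | zero =>
    refine ⟨_, recorded_mono e M (fun d hd => ⟨1, le_rfl, by simp, hd⟩)
      (recordCircuit_mem_recorded e O M (d := δ 1) hgs), ?_⟩
    rw [searchCircuit, circuitMatrix_append_mulVec, hφ]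
    conv_lhs => rw [← sub_add_cancel φ (markedPart M φ)]
    rw [Matrix.mulVec_add, recordCircuit_of_unmarked e O M _ _ hbs hb0]
    simp
  | succ m ih =>
    obtain ⟨z, hz, hs⟩ := ih (hδ.mono (Set.Iic_subset_Iic.2 (by omega)))
    have hne : ∀ i j, i ≤ m + 2 → j ≤ m + 2 → i ≠ j → δ i ≠ δ j := fun i j hi hj hij h =>
      hij (hδ hi hj h)
    set G := (circuitMatrix O M (groverCircuit e (δ 0) i₀ A)).mulVec with hG
    have hz1 : G^[2 ^ m] z = z := by
      refine Function.iterate_fixed (groverCircuit_sector_ne e O M i₀ (hA _)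
        (sector_mono e ?_ hz.1)) _
      rintro d ⟨j, hj1, hj2, rfl⟩
      exact hne _ _ (by omega) (by omega) (by omega)
    have hz2 : (circuitMatrix O M (recordCircuit (I := I) e (δ 0) (δ (m + 2)))).mulVec z = z := by
      refine recordCircuit_of_recorded e O M hz ?_ ?_
      · rintro ⟨j, hj1, hj2, h⟩
        exact hne 0 j (by omega) (by omega) (by omega) h
      · rintro ⟨j, hj1, hj2, h⟩
        exact hne (m + 2) j (by omega) (by omega) (by omega) h
    have hlin : ∀ (n : ℕ) (c : ℂ) (f g : Config K X → ℂ),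
        G^[n] (c • f + g) = c • G^[n] f + G^[n] g := by
      intro n c f g
      induction n with
      | zero => rfl
      | succ n ih =>
        rw [Function.iterate_succ_apply', ih, hG, Matrix.mulVec_add, Matrix.mulVec_smul, ← hG,
          ← Function.iterate_succ_apply' G, ← Function.iterate_succ_apply' G]
    have hGn := exists_iterate_groverCircuit e O M he (hA _) hφ hφs h1 hp hθ (2 ^ m)
    rw [← hG] at hGn
    set α : ℂ := ((∏ j ∈ Finset.range m, Real.cos (2 ^ j * (2 * θ)) : ℝ) : ℂ) with hα
    refine ⟨(α * (Real.sin ((2 ^ m : ℕ) * (2 * θ)) * (Real.cos θ / Real.sin θ))) •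
        (circuitMatrix O M (recordCircuit (I := I) e (δ 0) (δ (m + 2)))).mulVec (markedPart M φ)
        + z, add_mem (Submodule.smul_mem _ _ (recorded_mono e M
          (fun d hd => ⟨m + 2, by omega, le_rfl, hd⟩)
          (recordCircuit_mem_recorded e O M (d := δ (m + 2)) hgs)))
        (recorded_mono e M (fun d ⟨j, hj1, hj2, h⟩ => ⟨j, hj1, by omega, h⟩) hz), ?_⟩
    rw [searchCircuit, circuitMatrix_append_mulVec, circuitMatrix_append_mulVec, hs,
      circuitMatrix_replicate_mulVec, ← hG, hlin, hz1, hGn, smul_add, Matrix.mulVec_add,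
      Matrix.mulVec_add, Matrix.mulVec_smul, Matrix.mulVec_smul, Matrix.mulVec_smul,
      Matrix.mulVec_smul, hz2, recordCircuit_of_unmarked e O M _ _ hbs hb0,
      Finset.prod_range_succ, Complex.ofReal_mul, ← hα]
    push_cast
    simp only [smul_smul, add_assoc]

lemma prod_cos_two_pow (θ : ℝ) (m : ℕ) :
    2 ^ m * Real.sin θ * ∏ j ∈ Finset.range m, Real.cos (2 ^ j * θ) = Real.sin (2 ^ m * θ) := by
  induction m with
  | zero => simp
  | succ m ih =>
    have h : (2 : ℝ) ^ (m + 1) * θ = 2 * (2 ^ m * θ) := by ring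
    rw [Finset.prod_range_succ, h, Real.sin_two_mul, ← ih]
    ring

lemma initialState_normSq : star (initialState K O) ⬝ᵥ initialState K O = 1 := by
  rw [star_dotProduct_self_eq, Fintype.sum_prod_type, Finset.sum_eq_single (false, 0)]
  · simp only [initialState, if_true, norm_mul, mul_pow, Fintype.sum_prod_type]
    simp_rw [← Finset.mul_sum, O.ref_unit, mul_one, O.ref_unit]
    simp
  · intro m _ hm
    simp [initialState, hm]
  · simp

lemma searchCircuit_success {δ : ℕ → D} {i₀ : I} (he : e ((δ 0, i₀), false) = 0)
    {A : List (Gate K)}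
    (hA : ∀ s : D → Prop, ∀ f ∈ sector (I := I) (X := X) e s,
      (circuitMatrix O M A).mulVec f ∈ sector (I := I) e s)
    {p : ℝ} (hp0 : 0 < p)
    (hp : p ≤ ∑ q, ‖markedPart M ((circuitMatrix O M A).mulVec (initialState K O)) q‖ ^ 2) (m : ℕ)
    (hδ : Set.InjOn δ (Set.Iic (m + 1))) :
    1 - (4 ^ (m + 1) * p)⁻¹
      ≤ ∑ x ∈ M, QuantumAlgorithm.outputProb (searchCircuit e δ i₀ A m) O M x := by
  set φ := (circuitMatrix O M A).mulVec (initialState K O) with hφ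
  have hini : initialState K O ∈ sector (I := I) (X := X) e (· = δ 0) := by
    refine ⟨_, fun l hl => ?_, initialState_eq e O he⟩
    have : l ≠ ((δ 0, i₀), false) := fun h => hl (by rw [h])
    funext v
    simp [this]
  have h1 : star φ ⬝ᵥ φ = 1 := by
    rw [hφ, unitary_mulVec_normSq (circuitMatrix_mem O M A), initialState_normSq]
  have hsplit : ∀ f : Config K X → ℂ, ∑ q, ‖f q‖ ^ 2
      = ∑ q, ‖markedPart M f q‖ ^ 2 + ∑ q, ‖(f - markedPart M f) q‖ ^ 2 := fun f => by
    rw [← Finset.sum_add_distrib]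
    refine Finset.sum_congr rfl fun q _ => ?_
    by_cases h : q.2.2 ∈ M <;> simp [markedPart, h]
  set p' := ∑ q, ‖markedPart M φ q‖ ^ 2 with hp'
  have hφ1 : ∑ q, ‖φ q‖ ^ 2 = 1 := by
    rw [star_dotProduct_self_eq] at h1
    exact_mod_cast h1
  have hp1 : p' ≤ 1 := by
    rw [← hφ1, hsplit φ]
    exact le_add_of_nonneg_right (Finset.sum_nonneg fun q _ => sq_nonneg _)
  have hp'0 : 0 < p' := hp0.trans_le hp
  have hsin : Real.sin (Real.arcsin √p') = √p' :=
    Real.sin_arcsin (by linarith [Real.sqrt_nonneg p']) (Real.sqrt_le_one.2 hp1)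
  set θ := Real.arcsin √p' with hθ
  have hsq : p' = Real.sin θ ^ 2 := by rw [hsin, Real.sq_sqrt hp'0.le]
  have hs0 : Real.sin θ ≠ 0 := by rw [hsin]; exact (Real.sqrt_pos.2 hp'0).ne'
  obtain ⟨z, hz, hfin⟩ := searchCircuit_mulVec e O M he hA hφ.symm (hφ ▸ hA _ _ hini) h1 hsq hs0 m hδ
  set ψ := (circuitMatrix O M (searchCircuit e δ i₀ A m)).mulVec (initialState K O) with hψ
  have hψ1 : ∑ q, ‖ψ q‖ ^ 2 = 1 := by
    have h := unitary_mulVec_normSq (circuitMatrix_mem O M (searchCircuit e δ i₀ A m))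
      (initialState K O)
    rw [initialState_normSq, star_dotProduct_self_eq] at h
    exact_mod_cast h
  have hout : ∑ x ∈ M, QuantumAlgorithm.outputProb (searchCircuit e δ i₀ A m) O M x
      = ∑ q, ‖markedPart M ψ q‖ ^ 2 := by
    simp only [QuantumAlgorithm.outputProb, finalState_eq_mulVec, ← hψ]
    rw [Finset.sum_comm, Fintype.sum_prod_type (f := fun q => ‖markedPart M ψ q‖ ^ 2)]
    refine Finset.sum_congr rfl fun μ _ => ?_
    rw [Finset.sum_comm, Fintype.sum_prod_type (f := fun v => ‖markedPart M ψ (μ, v)‖ ^ 2)]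
    refine Finset.sum_congr rfl fun y _ => ?_
    have h3 : ∀ x, ‖markedPart M ψ (μ, (y, x))‖ ^ 2
        = if x ∈ M then ‖ψ (μ, (y, x))‖ ^ 2 else 0 := fun x => by
      by_cases h : x ∈ M <;> simp [markedPart, h]
    simp only [h3, Finset.sum_ite_mem, Finset.univ_inter]
  set α : ℝ := ∏ j ∈ Finset.range m, Real.cos (2 ^ j * (2 * θ)) with hα
  have hbad : ∑ q, ‖(ψ - markedPart M ψ) q‖ ^ 2 = α ^ 2 * (1 - p') := by
    have h2 : ψ - markedPart M ψ = (α : ℂ) • (φ - markedPart M φ) := by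
      rw [hfin]
      have hz0 := hz.2
      funext q
      have hq := congrFun hz0 q
      by_cases h : q.2.2 ∈ M
      · simp [markedPart, h]
      · simp only [markedPart, h, if_false] at hq
        simp [markedPart, h, ← hq]
    rw [h2]
    simp only [Pi.smul_apply, norm_smul, mul_pow, ← Finset.mul_sum]
    have h3 := hsplit φ
    rw [hφ1, ← hp'] at h3
    rw [Complex.norm_real, Real.norm_eq_abs, sq_abs, h3]
    ring
  -- Since `1 - p' = cos θ ^ 2` supplies the missing cosine, repeated doubling of the angle
  -- collapses the product to `sin (2 ^ (m + 1) * θ) / (2 ^ (m + 1) * sin θ)`; the numerator is at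
  -- most `1` for every `θ`.
  have hα2 : α ^ 2 * (1 - p') ≤ (4 ^ (m + 1) * p')⁻¹ := by
    have h3 : 1 - p' = Real.cos θ ^ 2 := by rw [Real.cos_sq', hsq]
    have h4 := prod_cos_two_pow θ (m + 1)
    rw [Finset.prod_range_succ'] at h4
    have h5 : ∏ k ∈ Finset.range m, Real.cos (2 ^ (k + 1) * θ) = α :=
      Finset.prod_congr rfl fun k _ => by rw [pow_succ, mul_assoc]
    rw [h5, pow_zero, one_mul] at h4
    have h6 : (4 : ℝ) ^ (m + 1) * p' * (α ^ 2 * (1 - p')) = Real.sin (2 ^ (m + 1) * θ) ^ 2 := by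
      rw [← h4, h3, hsq, show (4 : ℝ) = 2 ^ 2 by norm_num, ← pow_mul]
      ring
    rw [← one_div, le_div_iff₀ (by positivity), mul_comm, h6]
    exact Real.sin_sq_le_one _
  have hmono : ((4 : ℝ) ^ (m + 1) * p')⁻¹ ≤ (4 ^ (m + 1) * p)⁻¹ := by gcongr
  have := hsplit ψ
  rw [hψ1, hbad] at this
  rw [hout]
  linarith

end Search

/-! ### Costs of the circuits -/

section Cost

variable {K : ℕ} (S U C : ℝ)

lemma cost_append (A B : List (Gate K)) :
    QuantumAlgorithm.cost (A ++ B) S U C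
      = QuantumAlgorithm.cost A S U C + QuantumAlgorithm.cost B S U C := by
  simp [QuantumAlgorithm.cost]

lemma cost_flatten_replicate (A : List (Gate K)) (n : ℕ) :
    QuantumAlgorithm.cost (List.replicate n A).flatten S U C
      = n * QuantumAlgorithm.cost A S U C := by
  induction n with
  | zero => simp [QuantumAlgorithm.cost]
  | succ n ih =>
    rw [List.replicate_succ, List.flatten_cons, cost_append, ih]
    push_cast
    ring

lemma cost_inverseCircuit (A : List (Gate K)) :
    QuantumAlgorithm.cost (inverseCircuit A) S U C = QuantumAlgorithm.cost A S U C := by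
  have h : Gate.cost S U C ∘ Gate.inverse = (Gate.cost S U C : Gate K → ℝ) := by
    funext g
    cases g <;> rfl
  rw [QuantumAlgorithm.cost, inverseCircuit, List.map_reverse, List.sum_reverse, List.map_map, h]
  rfl

lemma cost_markedCircuit {L : Type*} [Fintype L] [DecidableEq L] (e : L ≃ Fin (K + 1))
    (W : Matrix.unitaryGroup L ℂ) :
    QuantumAlgorithm.cost (markedCircuit e W) S U C = 2 * C := by
  simp [QuantumAlgorithm.cost, markedCircuit, Gate.cost, memGate]
  ring

lemma cost_zeroReflection {L : Type*} [Fintype L] [DecidableEq L] (e : L ≃ Fin (K + 1))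
    (c : Finset L) : QuantumAlgorithm.cost (zeroReflection e c) S U C = 7 * U := by
  simp [QuantumAlgorithm.cost, zeroReflection, flagCircuit, hadamardGate, Gate.cost, memGate]
  ring

lemma cost_stepCircuit {N : Type*} [Fintype N] [DecidableEq N] (e : N × Bool ≃ Fin (K + 1))
    (s : Finset N) (R : N → Matrix.unitaryGroup Bool ℂ) :
    QuantumAlgorithm.cost (stepCircuit e s R) S U C = 4 * (U + C) := by
  rw [stepCircuit, cost_append, cost_append, cost_append, cost_markedCircuit, cost_markedCircuit]
  simp [QuantumAlgorithm.cost, labelGate, Gate.cost, memGate]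
  ring

lemma cost_walkCircuit {N : Type*} [Fintype N] [DecidableEq N] (e : N × Bool ≃ Fin (K + 1))
    (R : N → Matrix.unitaryGroup Bool ℂ) (k : N → ℕ) (τ : ℕ) :
    QuantumAlgorithm.cost (walkCircuit e R k τ) S U C = τ * (4 * (U + C)) := by
  induction τ with
  | zero => simp [walkCircuit, QuantumAlgorithm.cost]
  | succ τ ih =>
    rw [walkCircuit, List.range_succ, List.flatMap_append, cost_append, List.flatMap_singleton,
      cost_stepCircuit]
    change QuantumAlgorithm.cost (walkCircuit e R k τ) S U C + _ = _
    rw [ih]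
    push_cast
    ring

variable {D I : Type*} [Fintype D] [DecidableEq D] [Fintype I] [DecidableEq I]
  (e : (D × I) × Bool ≃ Fin (K + 1))

lemma cost_prepCircuit (W : Matrix.unitaryGroup I ℂ) (R : I → Matrix.unitaryGroup Bool ℂ)
    (k : I → ℕ) (τ : ℕ) :
    QuantumAlgorithm.cost (prepCircuit e W R k τ) S U C = S + τ * (4 * (U + C)) := by
  rw [prepCircuit, cost_append, cost_walkCircuit]
  simp [QuantumAlgorithm.cost, labelGate, Gate.cost, memGate]

lemma cost_groverCircuit (d₀ : D) (i₀ : I) (A : List (Gate K)) :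
    QuantumAlgorithm.cost (groverCircuit e d₀ i₀ A) S U C
      = 2 * QuantumAlgorithm.cost A S U C + 7 * U + 2 * C := by
  rw [groverCircuit, cost_append, signCircuit, cost_markedCircuit, conjReflection, cost_append,
    cost_append, cost_inverseCircuit, initialReflection, cost_append, cost_zeroReflection]
  simp only [QuantumAlgorithm.cost, labelGate, Gate.cost, memGate, List.map_cons, List.map_nil,
    List.sum_cons, List.sum_nil]
  ring

/-- A round of `2 ^ j` iterations uses `A` or its inverse `2 ^ (j + 1)` times; together with the
initial use this makes `2 ^ (m + 1) - 1`. -/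
lemma cost_searchCircuit (δ : ℕ → D) (i₀ : I) (A : List (Gate K)) (m : ℕ) :
    QuantumAlgorithm.cost (searchCircuit e δ i₀ A m) S U C
      = (2 ^ (m + 1) - 1) * QuantumAlgorithm.cost A S U C + (2 ^ m - 1) * (7 * U + 2 * C)
        + (m + 1) * (2 * C) := by
  induction m with
  | zero =>
    rw [searchCircuit, cost_append, recordCircuit, cost_markedCircuit]
    push_cast
    ring
  | succ m ih =>
    rw [searchCircuit, cost_append, cost_append, ih, cost_flatten_replicate, cost_groverCircuit,
      recordCircuit, cost_markedCircuit]
    push_cast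
    ring

end Cost

/-! ### From a distribution over walks to a search algorithm -/

section Existence

/-- Different labels `i` are orthogonal, so the superposition is marked with the averaged
probability. -/
lemma sum_markedPart_prepCircuit {X : Type*} [Fintype X] [DecidableEq X] {K : ℕ} {D I : Type*}
    [Fintype D] [DecidableEq D] [Fintype I] [DecidableEq I] (e : (D × I) × Bool ≃ Fin (K + 1))
    {P : Matrix.rowStochastic ℝ X} {π : stdSimplex ℝ X} (O : WalkImplementation P π)
    (M : Finset X) {d₀ : D} {i₀ : I} (he : e ((d₀, i₀), false) = 0)
    (W : Matrix.unitaryGroup I ℂ) {ρ : I → ℝ} (hρ : ∀ i, 1 ≤ ρ i) {k : I → ℕ} {τ : ℕ}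
    (hk : ∀ i, k i ≤ τ) :
    ∑ q, ‖markedPart M ((circuitMatrix O M
        (prepCircuit e W (fun i => ⟨_, coinMatrix_mem (hρ i)⟩) k τ)).mulVec
        (initialState K O)) q‖ ^ 2
      = ∑ i, ‖W.1 i i₀‖ ^ 2 *
        ∑ b, ∑ a, ∑ x ∈ M, ‖walkState O M (ρ i) (k i) b (a, x)‖ ^ 2 := by
  rw [prepCircuit_initialState e O M he W hρ hk, markedPart_labState,
    sum_labState e _ (fun z _ => ‖z‖ ^ 2) fun _ => by simp]
  simp only [Fintype.sum_prod_type (α₁ := D × I), Fintype.sum_prod_type (α₁ := D)]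
  rw [Finset.sum_eq_single d₀]
  · refine Finset.sum_congr rfl fun i _ => ?_
    rw [Finset.mul_sum]
    refine Finset.sum_congr rfl fun b _ => ?_
    rw [Fintype.sum_prod_type, Finset.mul_sum]
    refine Finset.sum_congr rfl fun a _ => ?_
    have h : ∀ x, ‖(if x ∈ M then W.1 i i₀ * walkState O M (ρ i) (k i) b (a, x) else 0 : ℂ)‖ ^ 2
        = if x ∈ M then ‖W.1 i i₀‖ ^ 2 * ‖walkState O M (ρ i) (k i) b (a, x)‖ ^ 2 else 0 :=
      fun x => by by_cases hx : x ∈ M <;> simp [hx, mul_pow]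
    simp only [if_true, h, Finset.sum_ite_mem, Finset.univ_inter, Finset.mul_sum]
  · intro d _ hd
    simp [hd]
  · simp

universe u

/-- Amplitude amplification applied to a superposition of quantum walks. -/
lemma exists_searchAlgorithm {I : Type} [Fintype I] [DecidableEq I] (i₀ : I) {q : I → ℝ}
    (hq : ∀ i, 0 ≤ q i) (hq1 : ∑ i, q i = 1) {ρ : I → ℝ} (hρ : ∀ i, 1 ≤ ρ i) {k : I → ℕ} {τ : ℕ}
    (hk : ∀ i, k i ≤ τ) (m : ℕ) :
    ∃ (K : ℕ) (A : QuantumAlgorithm K),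
      (∀ S U C : ℝ, 0 ≤ S → 0 ≤ U → 0 ≤ C →
        A.cost S U C ≤ 2 ^ m * (2 * S + (8 * τ + 7) * (U + C))) ∧
      ∀ (X : Type u) [Fintype X] [DecidableEq X]
        (P : Matrix.rowStochastic ℝ X) (π : stdSimplex ℝ X) (M : Finset X)
        (O : WalkImplementation P π) (p : ℝ), 0 < p →
        p ≤ ∑ i, q i *
          ∑ x ∈ M, chebVec (discriminant P.1 M (ρ i)) (fun x => √(π.1 x)) (k i) x ^ 2 →
        1 - (4 ^ (m + 1) * p)⁻¹ ≤ ∑ x ∈ M, A.outputProb O M x := by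
  set K := Fintype.card ((Fin (m + 2) × I) × Bool) - 1 with hK
  have hcard : Fintype.card ((Fin (m + 2) × I) × Bool) = K + 1 := by
    have : 0 < Fintype.card ((Fin (m + 2) × I) × Bool) :=
      Fintype.card_pos_iff.2 ⟨((0, i₀), false)⟩
    omega
  set e₀ := Fintype.equivFinOfCardEq hcard with he₀
  -- The swap places the initial label at `0`, where the initial state of the workspace sits.
  set e := e₀.trans (Equiv.swap (e₀ ((0, i₀), false)) 0) with he
  have he0 : e ((0, i₀), false) = 0 := by simp [he]
  obtain ⟨W, hW⟩ := exists_unitary_column i₀ (f := fun i => ((√(q i) : ℝ) : ℂ)) (by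
    rw [← hq1]
    refine Finset.sum_congr rfl fun i _ => ?_
    rw [Complex.norm_real, Real.norm_eq_abs, sq_abs, Real.sq_sqrt (hq i)])
  set A := prepCircuit e W (fun i => ⟨_, coinMatrix_mem (hρ i)⟩) k τ with hA
  refine ⟨K, searchCircuit e (fun n => Fin.ofNat (m + 2) n) i₀ A m, fun S U C hS hU hC => ?_, ?_⟩
  · rw [cost_searchCircuit, hA, cost_prepCircuit]
    -- The `m + 1` recordings at `2 * C` each fit under `2 ^ m * (7 * (U + C))` together with the
    -- overhead `7 * U + 2 * C` per iteration.
    have h1 : ((m : ℝ) + 1) ≤ 2 ^ m := by exact_mod_cast Nat.lt_two_pow_self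
    have h2 : (1 : ℝ) ≤ 2 ^ m := one_le_pow₀ one_le_two
    have h3 : 0 ≤ S + τ * (4 * (U + C)) := by positivity
    rw [pow_succ]
    have h4 := mul_le_mul_of_nonneg_right h1 (by positivity : 0 ≤ 2 * C)
    nlinarith
  · intro X _ _ P π M O p hp0 hp
    refine searchCircuit_success e O M (by simpa using he0)
      (fun s f hf => prepCircuit_mem_sector e O M s _ _ _ _ hf) hp0 (hp.trans ?_) m ?_
    · rw [sum_markedPart_prepCircuit e O M he0 W hρ hk]
      refine Finset.sum_le_sum fun i _ => ?_
      rw [hW, Complex.norm_real, Real.norm_eq_abs, sq_abs, Real.sq_sqrt (hq i)]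
      exact mul_le_mul_of_nonneg_left (sum_chebVec_sq_le O M (hρ i) (k i)) (hq i)
    · intro i hi j hj h
      have := congrArg Fin.val h
      simp only [Set.mem_Iic] at hi hj
      simpa [Fin.ofNat, Nat.mod_eq_of_lt (show i < m + 2 by omega),
        Nat.mod_eq_of_lt (show j < m + 2 by omega)] using this

end Existence

/-! ### The marked weight of the averaged walks -/

section MarkedAmplitude

variable {X : Type*} [Fintype X] [DecidableEq X]

/-- If `π(M) ≤ 1/4`, Green's identity gives at least `1 - 1/2 - 1/8 - 1/8 - 1/16`. Otherwise the
largest slowdown suffices: it nearly freezes the marked vertices, so `√π` keeps most of its marked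
weight. -/
lemma one_tenth_le_sum_discriminant {P : Matrix.rowStochastic ℝ X} {π : stdSimplex ℝ X}
    (hrev : IsReversibleChain P π) {M : Finset X} {T : ℝ} (hT : 3 ≤ T)
    (h : hittingTime P π M ≤ ENNReal.ofReal T) {l : ℝ} (hl : l = 1 - 1 / (16 * T)) {n J : ℕ}
    (hn : l ^ n ≤ 1 / 128) (hJ : 128 * T ≤ 2 ^ J) :
    1 / 10 ≤ ∑ j ∈ Finset.range (J + 1), (1 - l ^ 2) * ∑ t ∈ Finset.range n, (l ^ 2) ^ t *
      ∑ x ∈ M, ((discriminant P.1 M (2 ^ j)) ^ t).mulVec (fun y => √(π.1 y)) x ^ 2 := by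
  have hT0 : 0 < T := by linarith
  have hP := fun x y => P.2.1 x y
  have hs := fun x => Matrix.sum_row_of_mem_rowStochastic P.2 x
  have hu : 1 / (16 * T) ≤ 1 / 48 := one_div_le_one_div_of_le (by norm_num) (by linarith)
  have hu0 : 0 < 1 / (16 * T) := by positivity
  have h0 : 0 ≤ l := by linarith
  have h1 : l < 1 := by linarith
  have hTu : 1 / (16 * T) * T = 1 / 16 := by field_simp
  have hd1 : 1 - l ^ 2 ≤ 2 * (1 / (16 * T)) := by nlinarith
  have hd2 : 1 / (16 * T) ≤ 1 - l ^ 2 := by nlinarith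
  have hd0 : 0 < 1 - l ^ 2 := hu0.trans_le hd2
  have h2J : (0 : ℝ) < 2 ^ J := by positivity
  rcases le_or_gt (∑ x ∈ M, π.1 x) (1 / 4) with hM | hM
  · have hmain := le_sum_unmarkedProb_sq (M := M) hP hs π.2.1 π.2.2 hrev.detailed_balance h0 h1
      (sum_survival_le P π M hT0.le h) n J
    have e1 : (1 - l ^ 2) * T ≤ 1 / 8 := by nlinarith
    have e2 : ((1 - l ^ 2) * 2 ^ J)⁻¹ ≤ 1 / 8 := by
      rw [← one_div]
      refine one_div_le_one_div_of_le (by norm_num) ?_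
      calc (8 : ℝ) = 1 / (16 * T) * (128 * T) := by field_simp; norm_num
        _ ≤ (1 - l ^ 2) * 2 ^ J := by gcongr
    refine le_trans (by linarith) (hmain.trans ?_)
    refine Finset.sum_le_sum fun j _ => mul_le_mul_of_nonneg_left
      (Finset.sum_le_sum fun t _ => mul_le_mul_of_nonneg_left ?_ (by positivity)) hd0.le
    rw [Finset.mul_sum]
    exact Finset.sum_le_sum fun x hx => le_discriminant_pow_mulVec_sq hP π.2.1
      hrev.detailed_balance (one_le_pow₀ one_le_two) t hx
  · have hnn : ∀ j ∈ Finset.range (J + 1), 0 ≤ (1 - l ^ 2) * ∑ t ∈ Finset.range n, (l ^ 2) ^ t *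
        ∑ x ∈ M, ((discriminant P.1 M (2 ^ j)) ^ t).mulVec (fun y => √(π.1 y)) x ^ 2 :=
      fun j _ => mul_nonneg hd0.le (Finset.sum_nonneg fun t _ => mul_nonneg (by positivity)
        (Finset.sum_nonneg fun x _ => sq_nonneg _))
    refine le_trans ?_ (Finset.single_le_sum hnn (Finset.self_mem_range_succ J))
    set κ := (1 - ((2 : ℝ) ^ J)⁻¹) ^ 2 with hκ
    have hi0 : 0 < ((2 : ℝ) ^ J)⁻¹ := by positivity
    have hi : ((2 : ℝ) ^ J)⁻¹ ≤ 1 / (16 * T) / 8 := by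
      rw [← one_div, div_div]
      exact one_div_le_one_div_of_le (by positivity) (by linarith)
    have hκ1 : κ ≤ 1 := by rw [hκ]; nlinarith
    have hκ0 : 0 ≤ κ := sq_nonneg _
    have hκ2 : 1 - 1 / (16 * T) / 4 ≤ κ := by rw [hκ]; nlinarith
    have hl1 : l ^ 2 ≤ 1 := by nlinarith
    set r := l ^ 2 * κ with hr
    have hr1 : 1 - r ≤ 5 / 4 * (1 - l ^ 2) := by
      rw [hr]; nlinarith [sq_nonneg l]
    have hr0 : 0 ≤ r := by positivity
    have hrn : r ^ n ≤ 1 / 128 := by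
      refine (pow_le_pow_left₀ hr0 ?_ n).trans hn
      rw [hr]; nlinarith [sq_nonneg l]
    have hgeom := mul_neg_geom_sum r n
    have hsum : 0 ≤ ∑ t ∈ Finset.range n, r ^ t := Finset.sum_nonneg fun t _ => by positivity
    have hlow : (1 - l ^ 2) * ((∑ t ∈ Finset.range n, r ^ t) * ∑ x ∈ M, π.1 x) ≤
        (1 - l ^ 2) * ∑ t ∈ Finset.range n, (l ^ 2) ^ t *
        ∑ x ∈ M, ((discriminant P.1 M (2 ^ J)) ^ t).mulVec (fun y => √(π.1 y)) x ^ 2 := by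
      refine mul_le_mul_of_nonneg_left ?_ hd0.le
      rw [Finset.sum_mul]
      refine Finset.sum_le_sum fun t _ => ?_
      rw [hr, mul_pow, mul_assoc]
      refine mul_le_mul_of_nonneg_left ?_ (by positivity)
      rw [Finset.mul_sum]
      exact Finset.sum_le_sum fun x hx => le_discriminant_pow_mulVec_sq' hP π.2.1
        (one_le_pow₀ one_le_two) t hx
    refine le_trans ?_ hlow
    -- The ratio `r` is close enough to `l ^ 2` that the normalization loses at most the factor
    -- `4/5`; the factor `127/128` is due to stopping at `n`.
    have hA : 127 / 128 * (4 / 5) ≤ (1 - l ^ 2) * ∑ t ∈ Finset.range n, r ^ t := by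
      have := mul_le_mul_of_nonneg_right hr1 hsum
      linarith
    rw [← mul_assoc]
    nlinarith

/-- The weight of the walk of length `k` in the superposition of quantum walks. -/
def stepWeight (l : ℝ) (n k : ℕ) : ℝ :=
  (1 - l ^ 2) * ∑ t ∈ Finset.range n, (l ^ 2) ^ t * walkWeight t k

lemma stepWeight_nonneg {l : ℝ} (hl : l ^ 2 ≤ 1) (n k : ℕ) : 0 ≤ stepWeight l n k :=
  mul_nonneg (by linarith) (Finset.sum_nonneg fun t _ =>
    mul_nonneg (by positivity) (walkWeight_nonneg t k))

lemma sum_stepWeight_le_one {l : ℝ} (hl : l ^ 2 ≤ 1) (n τ : ℕ) :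
    ∑ k ∈ Finset.range (τ + 1), stepWeight l n k ≤ 1 := by
  have h := mul_neg_geom_sum (l ^ 2) n
  have h2 : 0 ≤ (l ^ 2) ^ n := by positivity
  simp only [stepWeight]
  rw [← Finset.mul_sum, Finset.sum_comm]
  calc _ ≤ (1 - l ^ 2) * ∑ t ∈ Finset.range n, (l ^ 2) ^ t := by
        refine mul_le_mul_of_nonneg_left (Finset.sum_le_sum fun t _ => ?_) (by linarith)
        rw [← Finset.mul_sum]
        exact mul_le_of_le_one_right (by positivity) (sum_walkWeight_le_one t τ)
    _ ≤ 1 := by linarith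

/-- Cutting off the degrees at `τ` costs at most `1/(20 (J + 1))` per slowdown, hence `1/20` of the
total `1/10`. Dividing by `J + 1` makes the slowdown uniformly distributed. -/
lemma le_sum_stepWeight {P : Matrix.rowStochastic ℝ X} {π : stdSimplex ℝ X}
    (hrev : IsReversibleChain P π) {M : Finset X} (O : WalkImplementation P π) {T : ℝ} (hT : 3 ≤ T)
    (h : hittingTime P π M ≤ ENNReal.ofReal T) {l : ℝ} (hl : l = 1 - 1 / (16 * T)) {n J τ : ℕ}
    (hn0 : 0 < n) (hn : l ^ n ≤ 1 / 128) (hJ : 128 * T ≤ 2 ^ J)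
    (hτ : 2 * Real.exp (-(τ ^ 2 / (2 * n) : ℝ)) ≤ 1 / (20 * (J + 1))) :
    1 / (20 * (J + 1)) ≤ ∑ k ∈ Finset.range (τ + 1), ∑ j ∈ Finset.range (J + 1),
      stepWeight l n k / (J + 1) *
        ∑ x ∈ M, chebVec (discriminant P.1 M (2 ^ j)) (fun x => √(π.1 x)) k x ^ 2 := by
  have hmain := one_tenth_le_sum_discriminant hrev hT h hl hn hJ
  have hu : 1 / (16 * T) ≤ 1 / 48 := one_div_le_one_div_of_le (by norm_num) (by linarith)
  have hu0 : 0 < 1 / (16 * T) := by have : 0 < T := by linarith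
                                    positivity
  have hl1 : l ^ 2 ≤ 1 := by nlinarith
  set c : ℕ → ℕ → ℝ := fun k j =>
    ∑ x ∈ M, chebVec (discriminant P.1 M (2 ^ j)) (fun x => √(π.1 x)) k x ^ 2 with hc
  set ε := 2 * Real.exp (-(τ ^ 2 / (2 * n) : ℝ)) with hε
  have hgeom := mul_neg_geom_sum (l ^ 2) n
  have hpn : 0 ≤ (l ^ 2) ^ n := by positivity
  have hε0 : 0 ≤ ε := by positivity
  have hj : ∀ j ∈ Finset.range (J + 1), (1 - l ^ 2) * ∑ t ∈ Finset.range n, (l ^ 2) ^ t *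
      ∑ x ∈ M, ((discriminant P.1 M (2 ^ j)) ^ t).mulVec (fun y => √(π.1 y)) x ^ 2
      ≤ (∑ k ∈ Finset.range (τ + 1), stepWeight l n k * c k j) + ε := by
    intro j _
    calc _ ≤ (1 - l ^ 2) * ∑ t ∈ Finset.range n, (l ^ 2) ^ t *
          ((∑ k ∈ Finset.range (τ + 1), walkWeight t k * c k j) + ε) := by
          refine mul_le_mul_of_nonneg_left (Finset.sum_le_sum fun t ht =>
            mul_le_mul_of_nonneg_left ?_ (by positivity)) (by linarith)
          exact sum_pow_mulVec_sq_le
            (fun k => sum_chebVec_sq_le_one M (one_le_pow₀ one_le_two) k O) hn0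
            (Finset.mem_range.1 ht).le τ
      _ = (∑ k ∈ Finset.range (τ + 1), stepWeight l n k * c k j)
          + ((1 - l ^ 2) * ∑ t ∈ Finset.range n, (l ^ 2) ^ t) * ε := by
          simp only [stepWeight, mul_add, Finset.sum_add_distrib, Finset.mul_sum, Finset.sum_mul]
          rw [Finset.sum_comm]
          congr 1
          · exact Finset.sum_congr rfl fun k _ => Finset.sum_congr rfl fun t _ => by ring
          · exact Finset.sum_congr rfl fun t _ => by ring
      _ ≤ _ := by
          rw [hgeom]
          nlinarith
  have hsum := hmain.trans (Finset.sum_le_sum hj)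
  rw [Finset.sum_add_distrib, Finset.sum_const, Finset.card_range, nsmul_eq_mul,
    Finset.sum_comm] at hsum
  have hJ0 : (0 : ℝ) < J + 1 := by positivity
  have e1 : ∑ k ∈ Finset.range (τ + 1), ∑ j ∈ Finset.range (J + 1),
      stepWeight l n k / (J + 1) * c k j
      = (∑ k ∈ Finset.range (τ + 1), ∑ j ∈ Finset.range (J + 1), stepWeight l n k * c k j)
        / (J + 1) := by
    simp only [Finset.sum_div]
    exact Finset.sum_congr rfl fun k _ => Finset.sum_congr rfl fun t _ => by ring
  rw [e1, le_div_iff₀ hJ0]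
  have e2 : 1 / (20 * ((J : ℝ) + 1)) * (J + 1) = 1 / 20 := by field_simp
  have e3 := mul_le_mul_of_nonneg_right hτ hJ0.le
  push_cast at hsum
  linarith

end MarkedAmplitude

/-! ### Choice of the parameters -/

section Parameters

universe u

lemma exists_walkAlgorithm {T l : ℝ} (hT : 3 ≤ T) (hl : l = 1 - 1 / (16 * T)) {n J τ m : ℕ}
    (hn0 : 0 < n) (hn : l ^ n ≤ 1 / 128) (hJ : 128 * T ≤ 2 ^ J)
    (hτ : 2 * Real.exp (-(τ ^ 2 / (2 * n) : ℝ)) ≤ 1 / (20 * (J + 1)))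
    (hm : 60 * ((J : ℝ) + 1) ≤ 4 ^ (m + 1)) :
    ∃ (K : ℕ) (A : QuantumAlgorithm K),
      (∀ S U C : ℝ, 0 ≤ S → 0 ≤ U → 0 ≤ C →
        A.cost S U C ≤ 2 ^ m * (2 * S + (8 * τ + 7) * (U + C))) ∧
      ∀ (X : Type u) [Fintype X] [DecidableEq X]
        (P : Matrix.rowStochastic ℝ X) (π : stdSimplex ℝ X) (M : Finset X),
        IsReversibleChain P π → hittingTime P π M ≤ ENNReal.ofReal T →
        ∀ O : WalkImplementation P π, 2 / 3 ≤ ∑ x ∈ M, A.outputProb O M x := by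
  have hu : 1 / (16 * T) ≤ 1 / 48 := one_div_le_one_div_of_le (by norm_num) (by linarith)
  have hu0 : 0 < 1 / (16 * T) := by
    have : 0 < T := by linarith
    positivity
  have hl1 : l ^ 2 ≤ 1 := by nlinarith
  have hJ0 : (0 : ℝ) < J + 1 := by positivity
  set w : Fin (τ + 1) × Fin (J + 1) → ℝ := fun i => stepWeight l n i.1 / (J + 1) with hw
  have hw0 : ∀ i, 0 ≤ w i := fun i => div_nonneg (stepWeight_nonneg hl1 n _) hJ0.le
  have hw1 : ∑ i, w i ≤ 1 := by
    rw [Fintype.sum_prod_type]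
    simp only [hw, Finset.sum_const, Finset.card_univ, Fintype.card_fin, nsmul_eq_mul]
    refine le_trans (le_of_eq ?_) (sum_stepWeight_le_one hl1 n τ)
    rw [← Fin.sum_univ_eq_sum_range (stepWeight l n)]
    refine Finset.sum_congr rfl fun k _ => ?_
    push_cast
    field_simp
  -- The truncations leave `w` with total mass at most `1`. The missing mass goes to an arbitrary
  -- index and can only increase the marked probability.
  set q : Fin (τ + 1) × Fin (J + 1) → ℝ := fun i => w i + if i = (0, 0) then 1 - ∑ i, w i else 0
    with hq
  have hwq : ∀ i, w i ≤ q i := fun i => by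
    simp only [hq]
    split_ifs <;> linarith
  obtain ⟨K, A, hA1, hA2⟩ := exists_searchAlgorithm.{u} (0, 0) (q := q)
    (fun i => (hw0 i).trans (hwq i))
    (by simp [hq, Finset.sum_add_distrib]) (ρ := fun i => 2 ^ (i.2 : ℕ))
    (fun i => one_le_pow₀ one_le_two) (k := fun i => (i.1 : ℕ)) (τ := τ)
    (fun i => Nat.lt_succ_iff.1 i.1.2) m
  refine ⟨K, A, hA1, fun X _ _ P π M hrev h O => ?_⟩
  have hp : (0 : ℝ) < 1 / (20 * (J + 1)) := by positivity
  refine le_trans ?_ (hA2 X P π M O (1 / (20 * (J + 1))) hp ?_)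
  · have h3 : 3 ≤ (4 : ℝ) ^ (m + 1) * (1 / (20 * (J + 1))) := by
      rw [mul_one_div, le_div_iff₀ (by positivity)]
      linarith
    have := inv_anti₀ (by norm_num) h3
    linarith
  · refine (le_sum_stepWeight hrev O hT h hl hn0 hn hJ hτ).trans ?_
    rw [Fintype.sum_prod_type, ← Fin.sum_univ_eq_sum_range (fun k => ∑ j ∈ Finset.range (J + 1),
      stepWeight l n k / (J + 1) *
        ∑ x ∈ M, chebVec (discriminant P.1 M (2 ^ j)) (fun x => √(π.1 x)) k x ^ 2)]
    refine Finset.sum_le_sum fun k _ => ?_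
    rw [← Fin.sum_univ_eq_sum_range (fun j => stepWeight l n k / (J + 1) *
        ∑ x ∈ M, chebVec (discriminant P.1 M (2 ^ j)) (fun x => √(π.1 x)) k x ^ 2)]
    exact Finset.sum_le_sum fun j _ => mul_le_mul_of_nonneg_right (hwq (k, j))
      (Finset.sum_nonneg fun x _ => sq_nonneg _)

/-- A bound above `1` keeps `log (log T)` away from `0` for `T ≥ 3`. In 25th powers it reads `e ^ 27
≤ 3 ^ 25`. -/
lemma le_log_three : (1.08 : ℝ) ≤ Real.log 3 := by
  rw [Real.le_log_iff_exp_le (by norm_num)]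
  have h1 : Real.exp 1 ≤ 2.7182818286 := Real.exp_one_lt_d9.le
  have h2 : Real.exp 1.08 ^ 25 ≤ (3 : ℝ) ^ 25 := by
    rw [← Real.exp_nat_mul, show ((25 : ℕ) : ℝ) * 1.08 = (27 : ℕ) * 1 by norm_num,
      Real.exp_nat_mul]
    exact (pow_le_pow_left₀ (Real.exp_pos 1).le h1 27).trans (by norm_num)
  exact le_of_pow_le_pow_left₀ (by norm_num) (by norm_num) h2

lemma le_exp_natCast (k : ℕ) : (2.7 : ℝ) ^ k ≤ Real.exp k := by
  have h1 : (2.7 : ℝ) ≤ Real.exp 1 := by linarith [Real.exp_one_gt_d9]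
  rw [show (k : ℝ) = k * 1 by ring, Real.exp_nat_mul]
  exact pow_le_pow_left₀ (by norm_num) h1 k

/-- Choice of the number of damping factors. -/
lemma exists_dampings {T : ℝ} (hT : 3 ≤ T) :
    ∃ J : ℕ, 128 * T ≤ 2 ^ J ∧ (J : ℝ) + 1 ≤ 11 * Real.log T := by
  obtain ⟨j, hj1, hj2⟩ := exists_nat_pow_near (x := 128 * T) (by linarith) one_lt_two
  refine ⟨j + 1, hj2.le, ?_⟩
  have hL : 1.08 ≤ Real.log T := le_log_three.trans (Real.log_le_log (by norm_num) hT)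
  have h := Real.log_le_log (by positivity) hj1
  rw [Real.log_pow, Real.log_mul (by norm_num) (by linarith),
    show (128 : ℝ) = 2 ^ 7 by norm_num, Real.log_pow] at h
  have hlog2 : 0.69 < Real.log 2 := by linarith [Real.log_two_gt_d9]
  push_cast at h ⊢
  by_contra! hc
  nlinarith

/-- Choice of the number of steps of the quantum walks. -/
lemma exists_steps {T : ℝ} (hT : 3 ≤ T) {n J : ℕ} (hn0 : 0 < n) (hn : (n : ℝ) ≤ 81 * T)
    (hJ : (J : ℝ) + 1 ≤ 11 * Real.log T) :
    ∃ τ : ℕ, 2 * Real.exp (-(τ ^ 2 / (2 * n) : ℝ)) ≤ 1 / (20 * (J + 1)) ∧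
      8 * (τ : ℝ) + 7 ≤ 1069 * √(T * Real.log (Real.log T)) := by
  have hL : 1.08 ≤ Real.log T := le_log_three.trans (Real.log_le_log (by norm_num) hT)
  set L := Real.log T with hLdef
  have hℓ : 0.07 ≤ Real.log L := by
    have h1 := Real.log_le_log (by norm_num) hL
    have h2 := Real.one_sub_inv_le_log_of_pos (x := 1.08) (by norm_num)
    norm_num at h1 h2 ⊢
    linarith
  set ℓ := Real.log L with hℓdef
  have hJ0 : (0 : ℝ) < J + 1 := by positivity
  have hn0' : (0 : ℝ) < n := by exact_mod_cast hn0
  -- The constant is absorbed by `log 440 ≤ 7 ≤ 100 * ℓ`, as `ℓ ≥ 0.07`.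
  have hlog : Real.log (40 * (J + 1)) ≤ 101 * ℓ := by
    have h1 : Real.log (40 * (J + 1)) ≤ Real.log (440 * L) :=
      Real.log_le_log (by positivity) (by linarith)
    have h2 : Real.log 440 ≤ 7 := by
      rw [Real.log_le_iff_le_exp (by norm_num)]
      exact le_trans (by norm_num) (le_exp_natCast 7)
    rw [Real.log_mul (x := 440) (by norm_num) (by linarith)] at h1
    linarith
  have hlog0 : 0 ≤ Real.log (40 * (J + 1)) := Real.log_nonneg (by
    have : (0 : ℝ) ≤ J := Nat.cast_nonneg J
    linarith)
  -- At this real value of `τ` the Gaussian tail equals `1 / (20 * (J + 1))`.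
  set s := √(2 * n * Real.log (40 * (J + 1))) with hs
  have hs2 : s ^ 2 = 2 * n * Real.log (40 * (J + 1)) := Real.sq_sqrt (by positivity)
  refine ⟨⌈s⌉₊, ?_, ?_⟩
  · have h1 : s ^ 2 ≤ (⌈s⌉₊ : ℝ) ^ 2 := pow_le_pow_left₀ (Real.sqrt_nonneg _) (Nat.le_ceil s) 2
    have h2 : Real.log (40 * (J + 1)) ≤ (⌈s⌉₊ : ℝ) ^ 2 / (2 * n) := by
      rw [le_div_iff₀ (by positivity)]
      linarith
    have h3 : Real.exp (-((⌈s⌉₊ : ℝ) ^ 2 / (2 * n))) ≤ (40 * ((J : ℝ) + 1))⁻¹ := by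
      refine (Real.exp_le_exp.2 (neg_le_neg h2)).trans_eq ?_
      rw [Real.exp_neg, Real.exp_log (by positivity)]
    refine (mul_le_mul_of_nonneg_left h3 two_pos.le).trans (le_of_eq ?_)
    field_simp
    norm_num
  · have hTℓ : 0.21 ≤ T * ℓ := by nlinarith
    have hr := Real.sq_sqrt (show 0 ≤ T * ℓ by linarith)
    have hr0 := Real.sqrt_nonneg (T * ℓ)
    -- Here `2 * 81 * 101 = 16362 ≤ 128 ^ 2`. With rounding, `8 * τ + 7 ≤ 8 * s + 15`, and `8 * 128
    -- + 15 * 3 = 1069`.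
    have h1 : s ≤ 128 * √(T * ℓ) := by
      refine abs_le_of_sq_le_sq' ?_ (by positivity) |>.2
      rw [hs2, mul_pow, hr]
      have := mul_le_mul hn hlog hlog0 (by linarith)
      nlinarith
    have h2 : 1 ≤ 3 * √(T * ℓ) := by
      by_contra! hc
      nlinarith
    have h3 := (Nat.ceil_lt_add_one (Real.sqrt_nonneg _ : 0 ≤ s)).le
    linarith

/-- Choice of the length of the walks. -/
lemma exists_length {T l : ℝ} (hT : 3 ≤ T) (hl : l = 1 - 1 / (16 * T)) :
    ∃ n : ℕ, 0 < n ∧ l ^ n ≤ 1 / 128 ∧ (n : ℝ) ≤ 81 * T := by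
  have hT0 : 0 < T := by linarith
  -- `80 * T` steps at decay rate `1 / (16 * T)` give `exp (-5) ≤ 1/128`.
  have hn : 80 * T ≤ ⌈80 * T⌉₊ := Nat.le_ceil _
  refine ⟨⌈80 * T⌉₊, Nat.ceil_pos.2 (by linarith), ?_, ?_⟩
  · have hu : 1 / (16 * T) ≤ 1 / 48 := one_div_le_one_div_of_le (by norm_num) (by linarith)
    have h1 : l ≤ Real.exp (-(1 / (16 * T))) := by
      rw [hl]
      linarith [Real.add_one_le_exp (-(1 / (16 * T)))]
    have h2 : Real.exp (-(1 / (16 * T))) ^ ⌈80 * T⌉₊ ≤ Real.exp (-5) := by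
      rw [← Real.exp_nat_mul]
      refine Real.exp_le_exp.2 ?_
      have : (5 : ℝ) = 80 * T * (1 / (16 * T)) := by field_simp; norm_num
      have h3 := mul_le_mul_of_nonneg_right hn (by positivity : 0 ≤ 1 / (16 * T))
      linarith
    have h3 : (128 : ℝ) ≤ Real.exp 5 := le_trans (by norm_num) (le_exp_natCast 5)
    refine (pow_le_pow_left₀ (by linarith) h1 _).trans (h2.trans ?_)
    rw [Real.exp_neg, ← one_div]
    exact one_div_le_one_div_of_le (by norm_num) h3
  · have := (Nat.ceil_lt_add_one (by positivity : 0 ≤ 80 * T)).le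
    linarith

end Parameters

end

theorem theorem1 :
    ∃ c : ℝ, 0 < c ∧ ∀ T : ℝ, 3 ≤ T → ∃ (K : ℕ) (A : QuantumAlgorithm K),
      (∀ S U C : ℝ, 0 ≤ S → 0 ≤ U → 0 ≤ C →
        A.cost S U C ≤
          c * (S * √(Real.log T)
            + √T * (U + C) * √(Real.log T * Real.log (Real.log T)))) ∧
      ∀ (X : Type*) [Fintype X] [DecidableEq X]
        (P : Matrix.rowStochastic ℝ X) (π : stdSimplex ℝ X) (M : Finset X),
        IsReversibleChain P π →
        hittingTime P π M ≤ ENNReal.ofReal T →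
        ∀ O : WalkImplementation P π, 2 / 3 ≤ ∑ x ∈ M, A.outputProb O M x := by
  -- `27794 = 26 * 1069`, the product of the constants for `2 ^ m` and for `8 * τ + 7`.
  refine ⟨27794, by norm_num, fun T hT => ?_⟩
  obtain ⟨n, hn0, hn, hn81⟩ := exists_length hT rfl
  obtain ⟨J, hJ, hJL⟩ := exists_dampings hT
  obtain ⟨τ, hτ, hτT⟩ := exists_steps hT hn0 hn81 hJL
  obtain ⟨m, hm1, hm2⟩ := exists_nat_pow_near (x := 60 * ((J : ℝ) + 1)) (y := 4) (by
    have : (0 : ℝ) ≤ J := Nat.cast_nonneg J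
    linarith) (by norm_num)
  obtain ⟨K, A, hA1, hA2⟩ := exists_walkAlgorithm hT rfl hn0 hn hJ hτ hm2.le
  refine ⟨K, A, fun S U C hS hU hC => (hA1 S U C hS hU hC).trans ?_, hA2⟩
  have hL : 1.08 ≤ Real.log T := le_log_three.trans (Real.log_le_log (by norm_num) hT)
  -- `4 ^ m ≤ 60 * (J + 1) ≤ 660 * log T`, and `660 ≤ 26 ^ 2`.
  have h2m : (2 : ℝ) ^ m ≤ 26 * √(Real.log T) := by
    refine abs_le_of_sq_le_sq' ?_ (by positivity) |>.2
    rw [mul_pow, Real.sq_sqrt (by linarith), ← pow_mul, mul_comm m 2, pow_mul]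
    norm_num
    linarith
  have hUC : 0 ≤ U + C := by linarith
  calc (2 : ℝ) ^ m * (2 * S + (8 * τ + 7) * (U + C))
      ≤ 26 * √(Real.log T) * (2 * S + 1069 * √(T * Real.log (Real.log T)) * (U + C)) := by
        gcongr
    _ ≤ _ := by
        rw [Real.sqrt_mul (by linarith : (0 : ℝ) ≤ T), Real.sqrt_mul (by linarith : 0 ≤ Real.log T)]
        have := mul_nonneg hS (Real.sqrt_nonneg (Real.log T))
        nlinarith
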